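/- All graphs are finite loopless multigraphs with labelled edges; embeddings are embeddings in the sphere. **Minors.** A graph $H$ is a minor of $G$ if $H=G/C\setminus D$ for disjoint $C,D\subseteq E(G)$, up to the names of vertices and after possibly deleting isolated vertices; edges keep their labels, and edges that become loops are deleted rather than contracted, i.e. $C$ is a forest. An *indefinite temporal sequence* is a sequence $(G_1,\dots,G_n)$ of graphs such that for any two consecutive graphs one is a minor of the other (the choice of $C,D$ is not part of the data); $n$ is its *length*, and its *size* is the total number of vertices and edges of $G_1,\dots,G_n$. An *(indefinite) simultaneous embedding* is a sequence of embeddings $(\sigma_1,\dots,\sigma_n)$ of $G_1,\dots,G_n$ such that whenever $G_k$ is a minor of $G_l$ with $|k-l|=1$, there is a choice of $C,D$ with $G_k=G_l/C\setminus D$ for which $\sigma_k$ is the embedding induced by $\sigma_l$. **Villages.** The *planet of equator* $m$ is a wheel with a centre and rim $s_1s_2\dots s_{4m}$. For $I\subseteq[m]$ the *village* $V(m,I)$ is obtained from it by adding for each $i\in I$ a *house* $H_i$: a path $v_1v_2\dots v_7$ with $v_1=s_{4i-3}$, $v_7=s_{4i-1}$ and $v_2,\dots,v_6$ new, together with a claw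 (the *inhabitant*) with new central vertex $w$ and leaves $v_2,v_4,v_6$. In an embedding of $V(m,I)$ the inhabitant of $H_i$ is *inside* its house if the cycle formed by $v_1\dots v_7$ and $s_{4i-3}s_{4i-2}s_{4i-1}$ separates $w$ from the centre of the planet. The *foundation* of $H_i$ is $\{s_{4i-3},\dots,s_{4i}\}$. **Semi housing sequences.** An *indefinite semi $(I,m)$-housing sequence* is an indefinite temporal sequence $(G_1,\dots,G_n)$ of $2$-connected graphs with $G_1=V(m,I)$ such that the planet is a subgraph of every $G_k$ and, in every $G_k$, every vertex other than the centre of the planet has strictly smaller degree than the centre. (Unlike for a housing sequence, the sequence need not end with a village.) Its *allocation set* is the set of all functions $f:I\to\{0,1\}$ for which there is a simultaneous embedding $(\sigma_1,\dots,\sigma_n)$ such that, for all $i\in I$, $f(i)=1$ if and only if the inhabitant of $H_i$ is inside its house in $\sigma_1$. An *arch* is an unordered pair $\{a,b\}$ of distinct elements of $I$ such that some $G_k$ contains a path between the foundations of $H_a$ and $H_b$ that meets the planet exactly in its two endvertices and is not an edge of the planet. **Lemma.** For every $m\in 3\mathbb N$ and every $i\in[m/3]$, there is an indefinite semi $(\{3i-2,3i-1,3i\},m)$-housing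 sequence of length $9$ and size at most $300\,m$ whose allocation set is $$\mathrm{OR}(\{3i-2,3i-1,3i\})=\{f:\{3i-2,3i-1,3i\}\to\{0,1\}\;:\; f(3i-2)\vee f(3i-1)\vee f(3i)=1\}$$ and whose set of arches is exactly $\{\{3i-2,3i-1\},\{3i-1,3i\}\}$. -/

import Mathlib

namespace TemporalGraph

open scoped Graph

/-! ### Connectivity of multigraphs -/

section Basic

variable {α β : Type*}

/-- A (nonempty) connected multigraph. -/
def Connected (G : Graph α β) : Prop :=
  V(G).Nonempty ∧ ∀ x ∈ V(G), ∀ y ∈ V(G), Relation.ReflTransGen G.Adj x y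

/-- A multigraph is 2-connected if it has no loops, has at least three vertices, is connected, and
stays connected when any one vertex is deleted. Parallel edges are allowed. -/
structure TwoConnected (G : Graph α β) : Prop where
  loopless : G.Loopless
  three_le : 3 ≤ V(G).encard
  connected : Connected G
  delete : ∀ v ∈ V(G), Connected (G.deleteVerts {v})

/-- The number of edges at a vertex (this is the degree, in a loopless graph). -/
noncomputable def degree (G : Graph α β) (v : α) : ℕ := {e | G.Inc e v}.ncard

/-! ### Plane embeddings of finite connected loopless multigraphs, as rotation systems -/

/-- A dart `(v, e)` stands for the edge `e` traversed starting from its end `v`. The next dart on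
the same face goes to the other end `u` of `e`, and continues with the edge that follows `e` in
the rotator at `u`. -/
def FaceStep (G : Graph α β) (ρ : α → Equiv.Perm β) (d d' : α × β) : Prop :=
  G.IsLink d.2 d.1 d'.1 ∧ d'.2 = ρ d'.1 d.2

/-- The faces of a rotation system: classes of darts under face tracing. -/
def Faces (G : Graph α β) (ρ : α → Equiv.Perm β) : Type _ :=
  Quot (fun d d' : {d : α × β // G.Inc d.2 d.1} => FaceStep G ρ d d')

/-- `ρ` is an embedding in the sphere of the finite, connected, loopless multigraph `G` (with at
least one edge), up to orientation-preserving homeomorphism: `ρ v` is a cyclic order (the rotator)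
of the edges at `v`, and Euler's formula holds. Outside of the edges at `v`, `ρ v` is the identity,
so that equality of embeddings is equality of functions. -/
structure IsPlaneEmbedding (G : Graph α β) (ρ : α → Equiv.Perm β) : Prop where
  isCycleOn : ∀ v, (ρ v).IsCycleOn {e | G.Inc e v}
  fixes : ∀ v e, ¬ G.Inc e v → ρ v e = e
  euler : V(G).ncard + Nat.card (Faces G ρ) = E(G).ncard + 2

/-- One step between darts that does not cross an edge of `C`: move along the face on the given
side of the dart, or cross an edge outside of `C` (by reversing the dart). -/
def RegionStep (G : Graph α β) (ρ : α → Equiv.Perm β) (C : Set β) (d d' : α × β) : Prop :=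
  FaceStep G ρ d d' ∨ (G.IsLink d.2 d.1 d'.1 ∧ d'.2 = d.2 ∧ d.2 ∉ C)

/-- For a cycle with edge set `C` in an embedded graph and vertices `x`, `y` off that cycle:
`x` and `y` are in the same one of the two disks bounded by the cycle. -/
def SameSide (G : Graph α β) (ρ : α → Equiv.Perm β) (C : Set β) (x y : α) : Prop :=
  ∃ e e', G.Inc e x ∧ G.Inc e' y ∧ Relation.EqvGen (RegionStep G ρ C) (x, e) (y, e')

/-! ### Minors and induced embeddings -/

/-- `x` and `y` are joined by a walk of `G` all of whose edges are in `C`. -/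
def Joined (G : Graph α β) (C : Set β) : α → α → Prop :=
  Relation.ReflTransGen (fun x y => ∃ e ∈ C, G.IsLink e x y)

/-- No edge of `C` lies on a cycle of edges of `C`. -/
def IsForest (G : Graph α β) (C : Set β) : Prop :=
  ∀ e ∈ C, ∀ x y, G.IsLink e x y → ¬ Joined G (C \ {e}) x y

/-- `H` is obtained from `G` by contracting the edges in `C` and deleting the edges in `D` (and
then deleting some isolated vertices). Edges keep their labels. The map `f` gives the names
of the vertices of the minor: it identifies two vertices of `G` exactly when they are joined
by contracted edges. As usual for minors, an edge that closes a cycle of contracted edges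
(and hence becomes a loop) is deleted rather than contracted, so `C` is a forest. -/
structure IsMinorVia (H G : Graph α β) (C D : Set β) (f : α → α) : Prop where
  contract_subset : C ⊆ E(G)
  delete_subset : D ⊆ E(G)
  disjoint : Disjoint C D
  forest : IsForest G C
  eq_iff : ∀ x ∈ V(G), ∀ y ∈ V(G), f x = f y ↔ Joined G C x y
  eq_minor : ∃ S : Set α, (∀ v ∈ S, ∀ e, ¬ ((G.deleteEdges (C ∪ D)).map f).Inc e v) ∧
    H = ((G.deleteEdges (C ∪ D)).map f).deleteVerts S

/-- `H` is a minor of the edge-labelled graph `G` (up to the names of the vertices). -/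
def IsMinor (H G : Graph α β) : Prop := ∃ C D f, IsMinorVia H G C D f

/-- Walking around a contracted tree: a deleted edge `e` at `v` is skipped, and a contracted
edge `e` at `v` is followed to its other end, where the edge after `e` is considered next. -/
inductive SkipStep (G : Graph α β) (ρ : α → Equiv.Perm β) (C D : Set β) : α × β → α × β → Prop
  | delete {v : α} {e : β} : e ∈ D → SkipStep G ρ C D (v, e) (v, ρ v e)
  | contract {v u : α} {e : β} : e ∈ C → G.IsLink e v u → SkipStep G ρ C D (v, e) (u, ρ u e)

/-- The embedding `ρ'` of the loopless graph `H` is the one that the embedding `ρ` of `G` induces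
on `H` when `C` is contracted and `D` is deleted: the successor of an edge `e` in the rotator at
the vertex `f x` is the first edge of `H` after `e` in the walk around the contracted tree. -/
def IsInducedVia (H : Graph α β) (ρ' : α → Equiv.Perm β) (G : Graph α β) (ρ : α → Equiv.Perm β)
    (C D : Set β) (f : α → α) : Prop :=
  ∀ e ∈ E(H), ∀ x, G.Inc e x →
    ρ' (f x) e ∈ E(H) ∧
      ∃ y, Relation.ReflTransGen (SkipStep G ρ C D) (x, ρ x e) (y, ρ' (f x) e)

/-- There is a choice of minor operations turning `G` into `H` under which the embedding `ρ` of `G`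
induces the embedding `ρ'` of `H`. -/
def InducesForSomeChoice (H : Graph α β) (ρ' : α → Equiv.Perm β)
    (G : Graph α β) (ρ : α → Equiv.Perm β) : Prop :=
  ∃ C D f, IsMinorVia H G C D f ∧ IsInducedVia H ρ' G ρ C D f

/-! ### Indefinite temporal sequences -/

/-- Of any two consecutive graphs, one is a minor of the other; it is not recorded by which
deletions and contractions. -/
def IsIndefiniteTemporalSequence {n : ℕ} (G : Fin n → Graph α β) : Prop :=
  ∀ k l : Fin n, (l : ℕ) = k + 1 → IsMinor (G k) (G l) ∨ IsMinor (G l) (G k)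

/-- Embeddings of the graphs in the sequence so that, whenever a graph is a minor of a
neighbour in the sequence, its embedding is induced by that of the neighbour under some choice of
deletions and contractions. -/
def IsSimultaneousEmbedding {n : ℕ} (G : Fin n → Graph α β) (σ : Fin n → α → Equiv.Perm β) :
    Prop :=
  (∀ k, IsPlaneEmbedding (G k) (σ k)) ∧
    ∀ k l : Fin n, ((l : ℕ) = k + 1 ∨ (k : ℕ) = l + 1) → IsMinor (G k) (G l) →
      InducesForSomeChoice (G k) (σ k) (G l) (σ l)

/-- The size of a sequence of graphs: the total number of vertices and edges. -/
noncomputable def size {n : ℕ} (G : Fin n → Graph α β) : ℕ :=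
  ∑ k, (V(G k).ncard + E(G k).ncard)

end Basic

/-! ### Villages -/

/-- Vertex labels: the centre of the planet, the vertices `s_j` on its surface, the vertices
`v_2, …, v_6` of the `i`-th house, the centre `w` of the claw of the `i`-th house, and an unlimited
supply of further vertices. -/
inductive Vertex
  | centre
  | surface (j : ℕ)
  | house (i k : ℕ)
  | inhabitant (i : ℕ)
  | extra (n : ℕ)

/-- Edge labels: the spokes, the rim edges, the edges `v_k v_{k+1}` of the `i`-th house, the
edges `w v_{2k}` of its claw, and an unlimited supply of further edges. -/
inductive Edge
  | spoke (j : ℕ)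
  | rim (j : ℕ)
  | wall (i k : ℕ)
  | claw (i k : ℕ)
  | extra (n : ℕ)

/-- The vertex `v_k` (`1 ≤ k ≤ 7`) of the `i`-th house. Its ends `v_1` and `v_7` are the surface
vertices `s_{4i-3}` and `s_{4i-1}`. -/
def houseVertex (i k : ℕ) : Vertex :=
  if k = 1 then .surface (4 * i - 3) else if k = 7 then .surface (4 * i - 1) else .house i k

/-- The two ends of the edges of planets of equator `m` and of their houses (no meaning is attached
to the value at `extra`). -/
def ends (m : ℕ) : Edge → Vertex × Vertex
  | .spoke j => (.centre, .surface j)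
  | .rim j => (.surface j, .surface (if j = 4 * m then 1 else j + 1))
  | .wall i k => (houseVertex i k, houseVertex i (k + 1))
  | .claw i k => (.inhabitant i, houseVertex i (2 * k))
  | .extra _ => (.centre, .centre)

/-- The graph with vertex set `V` and those edges in `E` that have both ends in `V`. -/
def graphOfEnds (m : ℕ) (V : Set Vertex) (E : Set Edge) : Graph Vertex Edge where
  vertexSet := V
  IsLink e x y := e ∈ E ∧ x ∈ V ∧ y ∈ V ∧ (ends m e = (x, y) ∨ ends m e = (y, x))
  isLink_symm := fun _ _ => ⟨fun _ _ h => ⟨h.1, h.2.2.1, h.2.1, h.2.2.2.symm⟩⟩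
  eq_or_eq_of_isLink_of_isLink := by
    rintro e x y v w ⟨-, -, -, h | h⟩ ⟨-, -, -, h' | h'⟩ <;> simp_all
  left_mem_of_isLink := fun _ _ _ h => h.2.1

/-- The planet of equator `m`: a wheel with rim `s_1 … s_{4m}`. -/
def planet (m : ℕ) : Graph Vertex Edge :=
  graphOfEnds m ({.centre} ∪ {v | ∃ j ∈ Set.Icc 1 (4 * m), v = .surface j})
    {e | ∃ j ∈ Set.Icc 1 (4 * m), e = .spoke j ∨ e = .rim j}

/-- The village with index set `I` on a planet of equator `m`. -/
def village (m : ℕ) (I : Finset ℕ) : Graph Vertex Edge :=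
  graphOfEnds m
    (V(planet m) ∪ {v | ∃ i ∈ I, v = .inhabitant i ∨ ∃ k ∈ Set.Icc 2 6, v = .house i k})
    (E(planet m) ∪ {e | ∃ i ∈ I, (∃ k ∈ Set.Icc 1 6, e = .wall i k) ∨
      ∃ k ∈ Set.Icc 1 3, e = .claw i k})

/-- The edges of the bounding cycle of the `i`-th house: the path `v_1 … v_7` and the path
`s_{4i-3} s_{4i-2} s_{4i-1}`. -/
def boundingCycle (i : ℕ) : Set Edge :=
  {e | (∃ k ∈ Set.Icc 1 6, e = .wall i k) ∨ e = .rim (4 * i - 3) ∨ e = .rim (4 * i - 2)}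

/-- In the embedding `ρ` of `G`, the inhabitant of the `i`-th house is inside its house: the
bounding cycle separates it from the centre of the planet. -/
def IsInside (G : Graph Vertex Edge) (ρ : Vertex → Equiv.Perm Edge) (i : ℕ) : Prop :=
  ¬ SameSide G ρ (boundingCycle i) (.inhabitant i) .centre

/-! ### Semi housing sequences -/

/-- `G` is an indefinite semi `(I, m)`-housing sequence. (It starts with the village, and nothing is
required of its last graph that is not required of all its graphs.) -/
structure IsIndefiniteSemiHousingSequence (I : Finset ℕ) (m : ℕ) {n : ℕ} [NeZero n]
    (G : Fin n → Graph Vertex Edge) : Prop where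
  index_subset : I ⊆ Finset.Icc 1 m
  vertexSet_finite : ∀ k, V(G k).Finite
  edgeSet_finite : ∀ k, E(G k).Finite
  twoConnected : ∀ k, TwoConnected (G k)
  temporal : IsIndefiniteTemporalSequence G
  start : G 0 = village m I
  planet_le : ∀ k, planet m ≤ G k
  degree_lt : ∀ k, ∀ v ∈ V(G k), v ≠ .centre → degree (G k) v < degree (G k) .centre

/-- The set of allocation functions of the simultaneous embeddings of `G`, where the
allocation function has value `true` (i.e. 1) at `i` if and only if the inhabitant of the `i`-th
house is inside its house in the embedding of the first graph. -/
def allocationSet (I : Finset ℕ) {n : ℕ} [NeZero n] (G : Fin n → Graph Vertex Edge) :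
    Set (I → Bool) :=
  {f | ∃ σ : Fin n → Vertex → Equiv.Perm Edge, IsSimultaneousEmbedding G σ ∧
    ∀ i : I, f i = true ↔ IsInside (G 0) (σ 0) i}

/-- `OR(K)`: the functions `f` with `f(i) ∨ f(j) ∨ f(k) = 1` for all `(i, j, k)` in `K`. -/
def orSet (I : Finset ℕ) (K : Set (ℕ × ℕ × ℕ)) : Set (I → Bool) :=
  {f | ∀ i j k : I, ((i : ℕ), (j : ℕ), (k : ℕ)) ∈ K → (f i || f j || f k) = true}

/-- The foundation of the `i`-th house: the surface vertices `s_{4i-3}, …, s_{4i}`. -/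
def foundation (i : ℕ) : Set Vertex :=
  {v | ∃ j ∈ Set.Icc (4 * i - 3) (4 * i), v = .surface j}

/-- `(a, b)` is an arch of a graph `G` containing the planet: `G` has a path `x, p, y` from the
foundation of the `a`-th house to that of the `b`-th house that meets the planet only in its two
endvertices (so it uses no other vertices of the planet, and is not an edge of the planet). -/
def IsArch (m : ℕ) (G : Graph Vertex Edge) (a b : ℕ) : Prop :=
  ∃ x ∈ foundation a, ∃ y ∈ foundation b, ∃ p : List Vertex,
    (x :: (p ++ [y])).Nodup ∧ (∀ v ∈ p, v ∉ V(planet m)) ∧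
    (x :: (p ++ [y])).IsChain (fun u v => ∃ e, e ∉ E(planet m) ∧ G.IsLink e u v)

/-- The set of arches of a sequence of graphs, as unordered pairs of distinct indices in `I`. -/
def arches (I : Finset ℕ) (m : ℕ) {n : ℕ} (G : Fin n → Graph Vertex Edge) : Set (Sym2 ℕ) :=
  {q | ∃ a ∈ I, ∃ b ∈ I, a ≠ b ∧ q = s(a, b) ∧ ∃ k, IsArch m (G k) a b}

end TemporalGraph

open TemporalGraph

/-! Put a = 3i-2. The sequence forces all three inhabitants inside at its end and leaves room for at
most two of them to change sides on the way.

The nine graphs are built on one planet: the village; "bare" houses, whose inhabitants have lost the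
edge to v_4; bare houses in which a and a+1 are joined through one shared extra vertex; the "flat"
graph, in which each house has shrunk to two parallel edges; bare again; a+1 and a+2 joined; flat;
bare; and finally "spikes", whose inhabitants are attached to s_{4h-2} and so have to be inside.
Neighbours in the sequence are related by deletion down to the bare graph or by contraction down to
the flat graph.

The contraction is where sides can change. The surviving edges `claw h 1` and `wall h 2` share v_2,
so v_2 goes to one end of the foundation while v_3, ..., v_6 and w go to the other. In the straight
way (v_2 to s_{4h-3}) the side is kept, in the crossed way it is exchanged. A bare house has only
the straight way. In a joined pair g, g+1, crossing the left house forces the shared vertex onto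
s_{4g-1}, and crossing the right house forces it onto s_{4g+1}, so at most one of the two is crossed
(`not_swapped_both`). Hence two contractions allow at most two changes, and three inhabitants
outside are too many (`exists_isInside`). If somebody starts inside, the at most two others can be
distributed over the two pairs (`exists_isSimultaneousEmbedding`).

The side is tracked through arbitrary embeddings by a bit, computed from two-colourings of the faces
that change exactly across a given cycle. Such colourings exist in plane embeddings: over the field
with two elements, Euler's formula makes the face boundaries span the cycle space
(`IsPlaneEmbedding.exists_boundary_eq`). They are unique up to exchanging the colours and pass to
minors (`IsMinorVia.exists_isColoring`). The bit combines a colouring of the inner cycle of a house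
with one of a triangle of the planet, the latter to fix the orientation. On bare houses it tells
inside from outside (`Valid.hasBit_bare`), spikes force it (`Valid.ne_of_spike`), and contraction
changes it exactly in crossed houses (`hasBit_of_flat_minor`).

For the converse, embeddings are written down as lists. The same linear algebra bounds the number of
faces of every rotation system from above, so planarity only needs sufficiently many distinct face
labels (`isPlaneEmbedding_of_labels`). That contraction induces the intended rotators is a trace of
walks around contracted trees (`Valid.reach_flat_house`). -/

namespace TemporalGraph
open scoped Graph

/-! ### Face colourings of embedded multigraphs -/

section Planarity

variable {α β : Type*} {G H : Graph α β} {ρ ρ' : α → Equiv.Perm β}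

/-- A colouring of the faces of a rotation system (as a function of the darts) with two colours that
changes exactly across the edges in `K`. -/
structure IsColoring (G : Graph α β) (ρ : α → Equiv.Perm β) (K : Set β) (c : α × β → Bool) :
    Prop where
  face : ∀ e x y, G.IsLink e x y → c (x, e) = c (y, ρ y e)
  cross : ∀ e x y, G.IsLink e x y → (c (x, e) = c (y, e) ↔ e ∉ K)

/-- `l` is the list of edges of a walk from `x` to `y`. -/
def IsWalk (G : Graph α β) : α → List β → α → Prop
  | x, [], z => x = z
  | x, e :: l, z => ∃ y, G.IsLink e x y ∧ IsWalk G y l z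

/-- Reversing the dart (u, e) and taking a face step leads to (u, ρ u e). Passing e in the rotator
at u therefore amounts to crossing e exactly once. -/
theorem IsColoring.same {K : Set β} {c : α × β → Bool} (h : IsColoring G ρ K c) {e : β} {u : α}
    (he : G.Inc e u) (hK : e ∉ K) : c (u, ρ u e) = c (u, e) := by
  obtain ⟨y, hy⟩ := he
  rw [← h.face e y u hy.symm, (h.cross e y u hy.symm).2 hK]

theorem IsColoring.flip {K : Set β} {c : α × β → Bool} (h : IsColoring G ρ K c) {e : β} {u : α}
    (he : G.Inc e u) (hK : e ∈ K) : c (u, ρ u e) = !c (u, e) := by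
  obtain ⟨y, hy⟩ := he
  have h1 := (h.cross e y u hy.symm).not.2 (not_not.2 hK)
  rw [← h.face e y u hy.symm]
  revert h1
  cases c (y, e) <;> cases c (u, e) <;> simp

theorem rotation_invariant {γ : Type*} {s : Set β} {π : Equiv.Perm β} (hπ : π.IsCycleOn s)
    (c : β → γ) (hc : ∀ e ∈ s, c (π e) = c e) {e e' : β} (he : e ∈ s) (he' : e' ∈ s) :
    c e = c e' := by
  have key : ∀ n : ℕ, ∀ f ∈ s, (π ^ n) f ∈ s ∧ c ((π ^ n) f) = c f := by
    intro n
    induction n with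
    | zero => intro f hf; simp [hf]
    | succ n ih =>
      intro f hf
      have h1 := ih f hf
      rw [pow_succ', Equiv.Perm.mul_apply]
      exact ⟨hπ.1.mapsTo h1.1, (hc _ h1.1).trans h1.2⟩
  obtain ⟨n, hn⟩ := hπ.2 he he'
  -- `IsCycleOn` yields an integer power; a negative one is read as a natural power leading from
  -- `e'` back to `e`.
  obtain ⟨n, rfl | rfl⟩ := n.eq_nat_or_neg
  · rw [zpow_natCast] at hn
    rw [← hn, (key n e he).2]
  · rw [zpow_neg, zpow_natCast, Equiv.Perm.inv_eq_iff_eq] at hn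
    rw [hn, (key n e' he').2]

theorem IsColoring.const_at {K : Set β} {c : α × β → Bool} (h : IsColoring G ρ K c) {u : α}
    (hρ : (ρ u).IsCycleOn {e | G.Inc e u}) (hK : ∀ e ∈ K, ¬ G.Inc e u) {e e' : β}
    (he : G.Inc e u) (he' : G.Inc e' u) : c (u, e) = c (u, e') :=
  rotation_invariant hρ (fun e => c (u, e))
    (fun e he => h.same he fun heK => hK e heK he) he he'

/-- Face steps and reversals act transitively on the darts of a connected graph. This gives both the
uniqueness of colourings and the kernel of the boundary map. -/
theorem dart_invariant {γ : Type*} (hG : Connected G)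
    (hρ : ∀ v, (ρ v).IsCycleOn {e | G.Inc e v}) (c : α × β → γ)
    (face : ∀ e x y, G.IsLink e x y → c (x, e) = c (y, ρ y e))
    (rev : ∀ e x y, G.IsLink e x y → c (x, e) = c (y, e)) {x y : α} {e e' : β}
    (hx : G.Inc e x) (hy : G.Inc e' y) : c (x, e) = c (y, e') := by
  have loc : ∀ u f f', G.Inc f u → G.Inc f' u → c (u, f) = c (u, f') := by
    intro u f f' hf hf'
    refine rotation_invariant (hρ u) (fun e => c (u, e)) ?_ hf hf'
    rintro g ⟨z, hz⟩
    rw [← face g z u hz.symm, rev g z u hz.symm]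
  have key : ∀ z, Relation.ReflTransGen G.Adj x z → ∀ f, G.Inc f z → c (x, e) = c (z, f) := by
    intro z hz
    induction hz with
    | refl => exact fun f hf => loc _ _ _ hx hf
    | tail _ h ih =>
      obtain ⟨g, hg⟩ := h
      intro f hf
      rw [ih g hg.inc_left, rev _ _ _ hg]
      exact loc _ _ _ hg.inc_right hf
  exact key y (hG.2 x hx.vertex_mem y hy.vertex_mem) e' hy

/-- Colourings for the same set of edges are equal up to exchanging the colours. -/
theorem IsColoring.unique (hG : Connected G) (hρ : ∀ v, (ρ v).IsCycleOn {e | G.Inc e v})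
    {K : Set β} {c c' : α × β → Bool} (h : IsColoring G ρ K c) (h' : IsColoring G ρ K c')
    {x y : α} {e e' : β} (hx : G.Inc e x) (hy : G.Inc e' y) :
    (c (x, e) ^^ c (y, e')) = (c' (x, e) ^^ c' (y, e')) := by
  -- Both colourings change across the same edges, so their xor changes nowhere.
  have := dart_invariant hG hρ (fun d => c d ^^ c' d)
    (fun e x y hl => by simp only [h.face e x y hl, h'.face e x y hl])
    (fun e x y hl => by
      have h1 := h.cross e x y hl
      have h2 := h'.cross e x y hl
      rw [← h2] at h1
      revert h1
      cases c (x, e) <;> cases c (y, e) <;> cases c' (x, e) <;> cases c' (y, e) <;> simp) hx hy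
  revert this
  cases c (x, e) <;> cases c (y, e') <;> cases c' (x, e) <;> cases c' (y, e') <;> simp

/-! ### Cycle space and face boundaries modulo two -/

section LinearAlgebra

open Matrix

open scoped Classical in
/-- The incidence matrix modulo two. -/
noncomputable def incMatrix (G : Graph α β) : Matrix V(G) E(G) (ZMod 2) :=
  fun v e => if G.Inc e v then 1 else 0

/-- The dart `(x, e)` of an incident pair, as a face. -/
def faceOf (ρ : α → Equiv.Perm β) {x : α} {e : β} (h : G.Inc e x) : Faces G ρ :=
  Quot.mk _ ⟨(x, e), h⟩

/-- The boundary of a set of faces, modulo two. -/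
noncomputable def boundary (G : Graph α β) (ρ : α → Equiv.Perm β) :
    (Faces G ρ → ZMod 2) →ₗ[ZMod 2] (E(G) → ZMod 2) where
  toFun c e := c (faceOf ρ (G.exists_isLink_of_mem_edgeSet e.2).choose_spec.choose_spec.inc_left) +
    c (faceOf ρ (G.exists_isLink_of_mem_edgeSet e.2).choose_spec.choose_spec.inc_right)
  map_add' c c' := by ext e; simp only [Pi.add_apply]; ring
  map_smul' r c := by ext e; simp only [Pi.smul_apply, smul_eq_mul, RingHom.id_apply]; ring

theorem boundary_apply (c : Faces G ρ → ZMod 2) {e : β} {x y : α} (h : G.IsLink e x y) :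
    boundary G ρ c ⟨e, h.edge_mem⟩ = c (faceOf ρ h.inc_left) + c (faceOf ρ h.inc_right) := by
  have key : ∀ a b (h0 : G.IsLink e a b), c (faceOf ρ h0.inc_left) + c (faceOf ρ h0.inc_right) =
      c (faceOf ρ h.inc_left) + c (faceOf ρ h.inc_right) := by
    intro a b h0
    obtain ⟨h1, h2⟩ | ⟨h1, h2⟩ := h0.eq_and_eq_or_eq_and_eq h
    · subst h1 h2; rfl
    · subst h1 h2; exact add_comm _ _
  exact key _ _ (G.exists_isLink_of_mem_edgeSet h.edge_mem).choose_spec.choose_spec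

theorem faceOf_step {e : β} {x y : α} (h : G.IsLink e x y) (h' : G.Inc (ρ y e) y) :
    faceOf ρ h.inc_left = faceOf ρ h' :=
  Quot.sound ⟨h, rfl⟩

theorem inc_rotation (hρ : ∀ v, (ρ v).IsCycleOn {e | G.Inc e v}) {e : β} {x : α}
    (h : G.Inc e x) : G.Inc (ρ x e) x := (hρ x).1.mapsTo h

theorem sum_incMatrix_col [Fintype V(G)] (hl : G.Loopless) (y : V(G) → ZMod 2) {e : β}
    {a b : α} (h : G.IsLink e a b) :
    ((incMatrix G)ᵀ *ᵥ y) ⟨e, h.edge_mem⟩ = y ⟨a, h.left_mem⟩ + y ⟨b, h.right_mem⟩ := by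
  classical
  have hab : (⟨a, h.left_mem⟩ : V(G)) ≠ ⟨b, h.right_mem⟩ := by
    intro hab
    have hab' : a = b := congrArg Subtype.val hab
    subst hab'
    exact hl.not_isLoopAt e a h
  have : ∀ v : V(G), (incMatrix G)ᵀ ⟨e, h.edge_mem⟩ v =
      if v ∈ ({⟨a, h.left_mem⟩, ⟨b, h.right_mem⟩} : Finset V(G)) then 1 else 0 := by
    intro v
    have h1 : G.Inc e v ↔ v = ⟨a, h.left_mem⟩ ∨ v = ⟨b, h.right_mem⟩ := by
      simp only [Subtype.ext_iff]
      refine ⟨fun h' => h'.eq_or_eq_of_isLink h, ?_⟩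
      rintro (h' | h') <;> rw [h']
      exacts [h.inc_left, h.inc_right]
    simp [incMatrix, Matrix.transpose_apply, h1]
  simp only [Matrix.mulVec, dotProduct, this, ite_mul, one_mul, zero_mul, Finset.sum_ite_mem,
    Finset.univ_inter]
  rw [Finset.sum_pair hab]

/-- A vector in this kernel agrees at the two ends of every edge, hence is constant by
connectedness. -/
theorem finrank_ker_transpose_le [Fintype V(G)] [Fintype E(G)] (hG : Connected G)
    (hl : G.Loopless) :
    Module.finrank (ZMod 2) (LinearMap.ker (incMatrix G)ᵀ.mulVecLin) ≤ 1 := by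
  refine finrank_le_one (⟨fun _ => 1, ?_⟩ : LinearMap.ker (incMatrix G)ᵀ.mulVecLin) ?_
  · ext ⟨e, he⟩
    obtain ⟨a, b, h⟩ := G.exists_isLink_of_mem_edgeSet he
    rw [Matrix.mulVecLin_apply, sum_incMatrix_col hl _ h]
    exact CharTwo.add_self_eq_zero 1
  · rintro ⟨y, hy⟩
    obtain ⟨v₀, hv₀⟩ := hG.1
    refine ⟨y ⟨v₀, hv₀⟩, ?_⟩
    ext ⟨v, hv⟩
    have key : ∀ w, Relation.ReflTransGen G.Adj v₀ w → ∀ hw : w ∈ V(G), y ⟨v₀, hv₀⟩ = y ⟨w, hw⟩ := by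
      intro w hw
      induction hw with
      | refl => intro _; rfl
      | tail _ h ih =>
        intro hw
        obtain ⟨e, he⟩ := h
        rw [ih he.left_mem]
        have := congrFun hy ⟨e, he.edge_mem⟩
        rw [Matrix.mulVecLin_apply, sum_incMatrix_col hl _ he] at this
        exact CharTwo.add_eq_zero.1 this
    simpa using key v (hG.2 _ hv₀ _ hv) hv

/-- The dual statement: a vector in this kernel agrees on both sides of every edge, so it is
constant on darts. -/
theorem finrank_ker_boundary_le [Finite (Faces G ρ)] (hG : Connected G)
    (hρ : ∀ v, (ρ v).IsCycleOn {e | G.Inc e v}) (hE : E(G).Nonempty) :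
    Module.finrank (ZMod 2) (LinearMap.ker (boundary G ρ)) ≤ 1 := by
  classical
  refine finrank_le_one (⟨fun _ => 1, ?_⟩ : LinearMap.ker (boundary G ρ)) ?_
  · ext ⟨e, he⟩
    obtain ⟨a, b, h⟩ := G.exists_isLink_of_mem_edgeSet he
    rw [boundary_apply _ h]
    exact CharTwo.add_self_eq_zero 1
  · rintro ⟨c, hc⟩
    obtain ⟨e₀, he₀⟩ := hE
    obtain ⟨a, b, h⟩ := G.exists_isLink_of_mem_edgeSet he₀
    refine ⟨c (faceOf ρ h.inc_left), ?_⟩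
    ext F
    induction F using Quot.ind with
    | mk d =>
      obtain ⟨⟨x, e⟩, hd⟩ := d
      have := dart_invariant hG hρ
        (fun d => if h : G.Inc d.2 d.1 then c (faceOf ρ h) else 0)
        (fun e x y hl => by
          rw [dif_pos hl.inc_left, dif_pos (inc_rotation hρ hl.inc_right)]
          rw [faceOf_step hl (inc_rotation hρ hl.inc_right)])
        (fun e x y hl => by
          rw [dif_pos hl.inc_left, dif_pos hl.inc_right]
          have := congrFun hc ⟨e, hl.edge_mem⟩
          rw [boundary_apply _ hl] at this
          exact CharTwo.add_eq_zero.1 this) h.inc_left hd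
      rw [dif_pos h.inc_left, dif_pos hd] at this
      exact (mul_one _).trans this

open scoped Classical in
theorem incMatrix_mulVec [Fintype E(G)] (K : E(G) → ZMod 2) (v : V(G)) :
    (incMatrix G *ᵥ K) v = ∑ e : E(G), if G.Inc e v then K e else 0 := by
  simp [Matrix.mulVec, dotProduct, incMatrix]

/-- At a vertex v, an edge e contributes the values of the faces of the darts (v, e) and (v, ρ v e).
Since ρ v permutes the edges, each value occurs twice in the sum over e. -/
theorem boundary_mem_ker [Fintype E(G)] (hρ : ∀ v, (ρ v).IsCycleOn {e | G.Inc e v})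
    (hfix : ∀ v e, ¬ G.Inc e v → ρ v e = e) (c : Faces G ρ → ZMod 2) :
    (incMatrix G).mulVecLin (boundary G ρ c) = 0 := by
  classical
  ext v
  rw [Matrix.mulVecLin_apply, incMatrix_mulVec]
  let φ : E(G) → ZMod 2 := fun e => if h : G.Inc e v then c (faceOf ρ h) else 0
  let π : Equiv.Perm E(G) := (ρ v).subtypePerm (p := fun e => e ∈ E(G)) (by
    intro e
    by_cases he : G.Inc e v
    · exact iff_of_true (inc_rotation hρ he).edge_mem he.edge_mem
    · rw [hfix _ _ he])
  have h1 : ∀ e : E(G), (if G.Inc e v then boundary G ρ c e else 0) = φ e + φ (π e) := by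
    rintro ⟨e, he⟩
    by_cases h : G.Inc e v
    · obtain ⟨y, hl⟩ := h
      have h2 : G.Inc (π ⟨e, he⟩ : E(G)) v := inc_rotation hρ hl.inc_left
      simp only [φ]
      rw [if_pos hl.inc_left, dif_pos hl.inc_left, dif_pos h2, boundary_apply c hl,
        faceOf_step hl.symm h2]
      rfl
    · have h2 : π ⟨e, he⟩ = ⟨e, he⟩ := Subtype.ext (hfix _ _ h)
      simp only [φ]
      rw [h2, if_neg h, dif_neg h, add_zero]
  rw [Finset.sum_congr rfl fun e _ => h1 e, Finset.sum_add_distrib, Equiv.sum_comp π φ]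
  exact CharTwo.add_self_eq_zero _

theorem finite_faces (hV : V(G).Finite) (hE : E(G).Finite) : Finite (Faces G ρ) := by
  have : Finite {d : α × β // G.Inc d.2 d.1} :=
    ((hV.prod hE).subset fun d hd => ⟨hd.vertex_mem, hd.edge_mem⟩ :
      {d : α × β | G.Inc d.2 d.1}.Finite).to_subtype
  exact Quot.finite _

/-- Rank-nullity for the incidence matrix and for its transpose, which have the same rank; the
kernel of the transpose is at most one-dimensional. -/
theorem finrank_ker_incMatrix_le [Fintype V(G)] [Fintype E(G)] (hG : Connected G) (hl : G.Loopless) :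
    Module.finrank (ZMod 2) (LinearMap.ker (incMatrix G).mulVecLin) + Fintype.card V(G) ≤
      Fintype.card E(G) + 1 := by
  classical
  have h1 := (incMatrix G).mulVecLin.finrank_range_add_finrank_ker
  have h2 := (incMatrix G)ᵀ.mulVecLin.finrank_range_add_finrank_ker
  have h3 := finrank_ker_transpose_le hG hl
  have h4 : Module.finrank (ZMod 2) (LinearMap.range (incMatrix G)ᵀ.mulVecLin) =
    Module.finrank (ZMod 2) (LinearMap.range (incMatrix G).mulVecLin) := Matrix.rank_transpose _
  rw [Module.finrank_fintype_fun_eq_card] at h1 h2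
  omega

theorem card_faces_le_finrank_range [Fintype (Faces G ρ)] (hG : Connected G)
    (hρ : ∀ v, (ρ v).IsCycleOn {e | G.Inc e v}) (hE : E(G).Nonempty) :
    Fintype.card (Faces G ρ) ≤ Module.finrank (ZMod 2) (LinearMap.range (boundary G ρ)) + 1 := by
  have h1 := (boundary G ρ).finrank_range_add_finrank_ker
  have h2 := finrank_ker_boundary_le hG hρ hE
  rw [Module.finrank_fintype_fun_eq_card] at h1
  omega

theorem range_boundary_le_ker [Fintype E(G)] (hρ : ∀ v, (ρ v).IsCycleOn {e | G.Inc e v})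
    (hfix : ∀ v e, ¬ G.Inc e v → ρ v e = e) :
    LinearMap.range (boundary G ρ) ≤ LinearMap.ker (incMatrix G).mulVecLin := by
  rintro _ ⟨c, rfl⟩
  exact boundary_mem_ker hρ hfix c

/-- The number of faces is at most what Euler's formula says. -/
theorem card_vertices_add_card_faces_le (hV : V(G).Finite) (hE : E(G).Finite)
    (hne : E(G).Nonempty) (hG : Connected G) (hl : G.Loopless)
    (hρ : ∀ v, (ρ v).IsCycleOn {e | G.Inc e v}) (hfix : ∀ v e, ¬ G.Inc e v → ρ v e = e) :
    V(G).ncard + Nat.card (Faces G ρ) ≤ E(G).ncard + 2 := by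
  have := finite_faces (ρ := ρ) hV hE
  have := Fintype.ofFinite (Faces G ρ)
  have := hV.fintype
  have := hE.fintype
  -- The chain is F - 1 ≤ dim (boundaries) ≤ dim (cycle space) ≤ E - V + 1.
  have h1 := finrank_ker_incMatrix_le hG hl
  have h2 := card_faces_le_finrank_range hG hρ hne
  have h3 := Submodule.finrank_mono (range_boundary_le_ker (G := G) hρ hfix)
  rw [← Nat.card_coe_set_eq, ← Nat.card_coe_set_eq, Nat.card_eq_fintype_card,
    Nat.card_eq_fintype_card, Nat.card_eq_fintype_card]
  omega

/-- In a plane embedding, every element of the cycle space is a sum of face boundaries. -/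
theorem IsPlaneEmbedding.exists_boundary_eq (hV : V(G).Finite) (hE : E(G).Finite)
    (hne : E(G).Nonempty) (hG : Connected G) (hl : G.Loopless) (hρ : IsPlaneEmbedding G ρ)
    [Fintype E(G)] (K : E(G) → ZMod 2) (hK : (incMatrix G).mulVecLin K = 0) :
    ∃ c, boundary G ρ c = K := by
  have := finite_faces (ρ := ρ) hV hE
  have := Fintype.ofFinite (Faces G ρ)
  have := hV.fintype
  have h1 := finrank_ker_incMatrix_le hG hl
  have h2 := card_faces_le_finrank_range hG hρ.isCycleOn hne
  have h3 := hρ.euler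
  rw [← Nat.card_coe_set_eq, ← Nat.card_coe_set_eq, Nat.card_eq_fintype_card,
    Nat.card_eq_fintype_card, Nat.card_eq_fintype_card] at h3
  -- Euler's formula makes every inequality of that chain tight, so boundaries and cycle space
  -- coincide.
  have h4 := Submodule.eq_of_le_of_finrank_le
    (range_boundary_le_ker (G := G) hρ.isCycleOn hρ.fixes) (by omega)
  have h5 : K ∈ LinearMap.ker (incMatrix G).mulVecLin := hK
  rw [← h4] at h5
  exact h5

-- Every edge of the walk contributes its two ends, and the inner vertices cancel modulo two.
-- Without repeated edges, the indicator of the list counts each edge of the walk once.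
open scoped Classical in
theorem IsWalk.mulVec_eq [Fintype E(G)] (hl : G.Loopless) {l : List β} (hnd : l.Nodup) {x z : α}
    (hw : IsWalk G x l z) (v : V(G)) :
    (incMatrix G *ᵥ fun e => if e.1 ∈ l then 1 else 0) v =
      (if v.1 = x then 1 else 0) + (if v.1 = z then 1 else 0) := by
  induction l generalizing x with
  | nil =>
    obtain rfl : x = z := hw
    simp [incMatrix_mulVec, CharTwo.add_self_eq_zero]
  | cons e l ih =>
    obtain ⟨y, hxy, hw⟩ := hw
    obtain ⟨hel, hnd⟩ := List.nodup_cons.1 hnd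
    have h1 := ih hnd hw
    rw [incMatrix_mulVec] at h1 ⊢
    have h2 : ∀ f : E(G), (if G.Inc f v then (if f.1 ∈ e :: l then (1 : ZMod 2) else 0) else 0) =
        (if f = ⟨e, hxy.edge_mem⟩ then (if G.Inc e v then 1 else 0) else 0) +
        (if G.Inc f v then (if f.1 ∈ l then 1 else 0) else 0) := by
      rintro ⟨f, hf⟩
      by_cases hfe : f = e
      · subst hfe
        simp [hel]
      · simp [hfe]
    rw [Finset.sum_congr rfl fun f _ => h2 f, Finset.sum_add_distrib, h1, Finset.sum_ite_eq',
      if_pos (Finset.mem_univ _), ← add_assoc]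
    congr 1
    have hne : x ≠ y := by
      rintro rfl
      exact hl.not_isLoopAt e x hxy
    have h3 : G.Inc e v ↔ v.1 = x ∨ v.1 = y := by
      refine ⟨fun h' => h'.eq_or_eq_of_isLink hxy, ?_⟩
      rintro (h' | h') <;> rw [h']
      exacts [hxy.inc_left, hxy.inc_right]
    by_cases h4 : v.1 = x
    · have h5 : v.1 ≠ y := fun h => hne (h4.symm.trans h)
      simp only [h3]
      simp [h4, hne]
    · by_cases h5 : v.1 = y
      · simp only [h3]
        simp [h5, hne.symm, CharTwo.add_self_eq_zero]
      · simp [h3, h4, h5]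

/-- A closed walk in a plane graph bounds: the faces have a colouring that changes exactly across
the edges of the walk. -/
theorem IsPlaneEmbedding.exists_isColoring (hV : V(G).Finite) (hE : E(G).Finite)
    (hG : Connected G) (hl : G.Loopless) (hρ : IsPlaneEmbedding G ρ) {l : List β}
    (hnd : l.Nodup) (hne : l ≠ []) {x : α} (hw : IsWalk G x l x) :
    ∃ c, IsColoring G ρ {e | e ∈ l} c := by
  classical
  have := hE.fintype
  have hEne : E(G).Nonempty := by
    obtain ⟨e, l, rfl⟩ := List.exists_cons_of_ne_nil hne
    exact ⟨e, hw.choose_spec.1.edge_mem⟩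
  obtain ⟨c, hc⟩ := hρ.exists_boundary_eq hV hE hEne hG hl
    (fun e => if e.1 ∈ l then 1 else 0) (by
      ext v
      rw [Matrix.mulVecLin_apply, hw.mulVec_eq hl hnd]
      exact CharTwo.add_self_eq_zero _)
  -- The colour of a face is its coefficient in a face sum that bounds the walk; the value at pairs
  -- that are not darts plays no role.
  refine ⟨fun d => if h : G.Inc d.2 d.1 then decide (c (faceOf ρ h) = 0) else false, ?_, ?_⟩
  · intro e x y h
    simp only
    rw [dif_pos h.inc_left, dif_pos (inc_rotation hρ.isCycleOn h.inc_right),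
      faceOf_step h (inc_rotation hρ.isCycleOn h.inc_right)]
  · intro e x y h
    simp only
    rw [dif_pos h.inc_left, dif_pos h.inc_right]
    have h1 := congrFun hc ⟨e, h.edge_mem⟩
    rw [boundary_apply _ h] at h1
    have h2 : ∀ a b : ZMod 2, (decide (a = 0) = decide (b = 0)) ↔ a + b = 0 := by decide
    rw [h2, h1]
    simp

end LinearAlgebra
/-! ### Rotation systems given by lists -/

section Lists

variable [DecidableEq β]

/-- Replaces a statement about successors in a cyclic order by an equation of lists, which can be
checked entry by entry. -/
theorem map_formPerm {γ : Type*} {l : List β} (hl : l.Nodup) {g h : β → γ}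
    (hgh : (l.rotate 1).map g = l.map h) {e : β} (he : e ∈ l) : g (l.formPerm e) = h e := by
  obtain ⟨i, hi, rfl⟩ := List.getElem_of_mem he
  rw [List.formPerm_apply_getElem _ hl]
  have h1 : ((l.rotate 1).map g)[i]'(by simpa using hi) = (l.map h)[i]'(by simpa using hi) := by
    simp only [hgh]
  rw [List.getElem_map, List.getElem_map, List.getElem_rotate] at h1
  exact h1

/-- A rotation system given by lists is plane if its faces can be labelled with sufficiently
many labels. -/
theorem isPlaneEmbedding_of_labels {κ : Type*} {rot : α → List β} (hV : V(G).Finite)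
    (hE : E(G).Finite) (hne : E(G).Nonempty) (hG : Connected G) (hl : G.Loopless)
    (hnd : ∀ v, (rot v).Nodup) (hmem : ∀ v e, e ∈ rot v ↔ G.Inc e v)
    (lab labIn : α → β → κ) (hlabIn : ∀ e u v, G.IsLink e u v → labIn v e = lab u e)
    (hlab : ∀ v, ((rot v).rotate 1).map (lab v) = (rot v).map (labIn v))
    (S : Finset κ) (hS : ∀ k ∈ S, ∃ v e, G.Inc e v ∧ lab v e = k)
    (hcard : E(G).ncard + 2 ≤ V(G).ncard + S.card) :
    IsPlaneEmbedding G fun v => (rot v).formPerm := by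
  have hcyc : ∀ v, (rot v).formPerm.IsCycleOn {e | G.Inc e v} := by
    intro v
    have := (hnd v).isCycleOn_formPerm
    simpa only [hmem] using this
  have hfix : ∀ v e, ¬ G.Inc e v → (rot v).formPerm e = e := fun v e he =>
    List.formPerm_apply_of_notMem fun h => he ((hmem v e).1 h)
  -- One half of Euler's formula holds for every rotation system, so only a lower bound on the
  -- number of faces remains.
  refine ⟨hcyc, hfix, le_antisymm
    (card_vertices_add_card_faces_le hV hE hne hG hl hcyc hfix) (hcard.trans ?_)⟩
  have := finite_faces (ρ := fun v => (rot v).formPerm) hV hE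
  -- The labels are constant along face steps and hence factor through the faces, so darts with
  -- different labels lie on different faces.
  let φ : Faces G (fun v => (rot v).formPerm) → κ :=
    Quot.lift (fun d => lab d.1.1 d.1.2) (by
      rintro ⟨⟨u, e⟩, hd⟩ ⟨⟨v, e'⟩, hd'⟩ ⟨h1, h2⟩
      simp only at h1 h2
      subst h2
      simp only
      rw [map_formPerm (hnd v) (hlab v) ((hmem v e).2 h1.inc_right), hlabIn e u v h1])
  have h1 : S.card ≤ Nat.card (Faces G fun v => (rot v).formPerm) := by
    choose v e hinc hk using hS
    have h2 := Nat.card_le_card_of_injective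
      (fun k : S => faceOf (fun v => (rot v).formPerm) (hinc k.1 k.2)) (by
        intro k k' hkk
        have := congrArg φ hkk
        simp only [φ, faceOf] at this
        rw [hk, hk] at this
        exact Subtype.ext this)
    rwa [Nat.card_eq_fintype_card, Fintype.card_coe] at h2
  omega

end Lists

/-! ### Minors -/

namespace IsMinorVia

variable {C D : Set β} {f : α → α}

theorem isLink_iff (h : IsMinorVia H G C D f) {e : β} {u v : α} :
    H.IsLink e u v ↔ e ∉ C ∪ D ∧ ∃ x y, G.IsLink e x y ∧ f x = u ∧ f y = v := by
  obtain ⟨S, hS, rfl⟩ := h.eq_minor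
  rw [Graph.deleteVerts_isLink]
  constructor
  · rintro ⟨⟨x, y, hl, rfl, rfl⟩, -⟩
    rw [Graph.deleteEdges_isLink] at hl
    exact ⟨hl.2, x, y, hl.1, rfl, rfl⟩
  · rintro ⟨he, x, y, hl, rfl, rfl⟩
    have h1 : ((G.deleteEdges (C ∪ D)).map f).IsLink e (f x) (f y) :=
      Graph.IsLink.map f (by rw [Graph.deleteEdges_isLink]; exact ⟨hl, he⟩)
    exact ⟨h1, fun hx => hS _ hx _ h1.inc_left, fun hy => hS _ hy _ h1.inc_right⟩

theorem mem_edgeSet_iff (h : IsMinorVia H G C D f) {e : β} :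
    e ∈ E(H) ↔ e ∈ E(G) ∧ e ∉ C ∧ e ∉ D := by
  constructor
  · intro he
    obtain ⟨u, v, hl⟩ := H.exists_isLink_of_mem_edgeSet he
    obtain ⟨h1, x, y, h2, -⟩ := h.isLink_iff.1 hl
    exact ⟨h2.edge_mem, fun h => h1 (.inl h), fun h => h1 (.inr h)⟩
  · rintro ⟨he, hC, hD⟩
    obtain ⟨x, y, hl⟩ := G.exists_isLink_of_mem_edgeSet he
    exact (h.isLink_iff.2 ⟨by simp [hC, hD], x, y, hl, rfl, rfl⟩).edge_mem

theorem isLink_map (h : IsMinorVia H G C D f) {e : β} (he : e ∈ E(H)) {x y : α}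
    (hl : G.IsLink e x y) : H.IsLink e (f x) (f y) :=
  h.isLink_iff.2 ⟨by
    have := h.mem_edgeSet_iff.1 he
    simp [this], x, y, hl, rfl, rfl⟩

/-- Colourings of an embedded graph induce colourings of the minors in the induced embedding,
unless the colour changes at deleted edges. -/
theorem exists_isColoring (hm : IsMinorVia H G C D f) (hi : IsInducedVia H ρ' G ρ C D f)
    (hl : H.Loopless) (hρ : ∀ v, (ρ v).IsCycleOn {e | G.Inc e v}) {K : Set β}
    {c : α × β → Bool} (hc : IsColoring G ρ K c) (hK : ∀ e ∈ K, e ∉ D) :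
    ∃ c', IsColoring H ρ' K c' ∧ ∀ e ∈ E(H), ∀ y, G.Inc e y → c' (f y, e) = c (y, e) := by
  classical
  -- A dart of the minor gets the colour of a dart above it. Since `H` is loopless, the two ends of
  -- an edge of `H` have different images, so the choice does not matter.
  let c' : α × β → Bool := fun d =>
    if h : ∃ y, G.Inc d.2 y ∧ f y = d.1 then c (h.choose, d.2) else false
  have key : ∀ e ∈ E(H), ∀ y, G.Inc e y → c' (f y, e) = c (y, e) := by
    intro e he y hy
    have h : ∃ z, G.Inc e z ∧ f z = f y := ⟨y, hy, rfl⟩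
    simp only [c']
    rw [dif_pos h]
    have h1 := h.choose_spec
    by_cases h2 : h.choose = y
    · rw [h2]
    · obtain ⟨z, hz⟩ := hy
      have h3 := h1.1.eq_of_isLink_of_ne_left hz h2
      rw [h3] at h1
      have h4 := hm.isLink_map he hz
      rw [h1.2] at h4
      exact absurd h4 (hl.not_isLoopAt _ _)
  -- Skipping a deleted edge keeps the colour because that edge is not in `K`. Following a
  -- contracted edge is a face step, so contracted edges are allowed to be in `K`.
  have walk : ∀ d d', Relation.ReflTransGen (SkipStep G ρ C D) d d' → G.Inc d.2 d.1 →
      G.Inc d'.2 d'.1 ∧ f d'.1 = f d.1 ∧ c d' = c d := by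
    intro d d' h hd
    induction h with
    | refl => exact ⟨hd, rfl, rfl⟩
    | tail _ h ih =>
      obtain ⟨h1, h2, h3⟩ := ih
      cases h with
      | delete hD =>
        exact ⟨inc_rotation hρ h1, h2, (hc.same h1 fun hK' => hK _ hK' hD).trans h3⟩
      | contract hC hl =>
        refine ⟨inc_rotation hρ hl.inc_right, ?_, ?_⟩
        · rw [← h2]
          exact (hm.eq_iff _ hl.right_mem _ hl.left_mem).2 (.single ⟨_, hC, hl.symm⟩)
        · rw [← h3]
          exact (hc.face _ _ _ hl).symm
  refine ⟨c', ⟨?_, ?_⟩, key⟩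
  · intro e u v h
    obtain ⟨-, x, y, hxy, rfl, rfl⟩ := hm.isLink_iff.1 h
    obtain ⟨h1, z, hz⟩ := hi e h.edge_mem y hxy.inc_right
    obtain ⟨h2, h3, h4⟩ := walk _ _ hz (inc_rotation hρ hxy.inc_right)
    rw [key e h.edge_mem x hxy.inc_left, hc.face e x y hxy, ← h4]
    simp only at h3
    rw [← key _ h1 z h2]
    simp only [h3]
  · intro e u v h
    obtain ⟨-, x, y, hxy, rfl, rfl⟩ := hm.isLink_iff.1 h
    rw [key e h.edge_mem x hxy.inc_left, key e h.edge_mem y hxy.inc_right]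
    exact hc.cross e x y hxy

end IsMinorVia

theorem Joined.symm {C : Set β} {x y : α} (h : Joined G C x y) : Joined G C y x := by
  induction h with
  | refl => exact .refl
  | tail _ h ih =>
    obtain ⟨e, he, hl⟩ := h
    exact .head ⟨e, he, hl.symm⟩ ih

theorem Joined.mem_of_closed {C : Set β} {x y : α} (h : Joined G C x y) {S : Set α}
    (hS : ∀ e ∈ C, ∀ u v, G.IsLink e u v → u ∈ S → v ∈ S) (hx : x ∈ S) : y ∈ S := by
  induction h with
  | refl => exact hx
  | tail _ h ih =>
    obtain ⟨e, he, hl⟩ := h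
    exact hS e he _ _ hl ih

/-- Edges that join vertices to their parents form a forest. -/
theorem isForest_of_parent {C : Set β} (par : α → α) (rank : α → ℕ) (child : β → α)
    (hinj : Set.InjOn child C)
    (hC : ∀ e ∈ C, G.IsLink e (child e) (par (child e)))
    (hrank : ∀ e ∈ C, rank (par (child e)) < rank (child e)) (hle : ∀ x, rank (par x) ≤ rank x) :
    IsForest G C := by
  intro e he x y hxy hj
  -- The descendants of `child e`. Edges of `C` other than `e` do not leave this set, and by the
  -- rank it does not contain the parent of `child e`.
  let S : Set α := {x | ∃ n, par^[n] x = child e}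
  have hle' : ∀ n x, rank (par^[n] x) ≤ rank x := by
    intro n
    induction n with
    | zero => intro x; rfl
    | succ n ih => intro x; exact (ih (par x)).trans (hle x)
  have hS : ∀ e' ∈ C \ {e}, ∀ u v, G.IsLink e' u v → (u ∈ S ↔ v ∈ S) := by
    have h1 : ∀ e' ∈ C \ {e}, child e' ∈ S ↔ par (child e') ∈ S := by
      rintro e' ⟨he', hne⟩
      constructor
      · rintro ⟨n, hn⟩
        cases n with
        | zero => exact absurd (hinj he' he hn) hne
        | succ n => exact ⟨n, hn⟩
      · rintro ⟨n, hn⟩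
        exact ⟨n + 1, hn⟩
    intro e' he' u v huv
    obtain ⟨rfl, rfl⟩ | ⟨rfl, rfl⟩ := huv.eq_and_eq_or_eq_and_eq (hC e' he'.1)
    · exact h1 e' he'
    · exact (h1 e' he').symm
  have h1 : child e ∈ S := ⟨0, rfl⟩
  have h2 : par (child e) ∉ S := by
    rintro ⟨n, hn⟩
    have := hle' n (par (child e))
    rw [hn] at this
    exact absurd (hrank e he) (not_lt.2 this)
  obtain ⟨rfl, rfl⟩ | ⟨rfl, rfl⟩ := hxy.eq_and_eq_or_eq_and_eq (hC e he)
  · exact h2 (hj.mem_of_closed (fun e' he' u v huv => (hS e' he' u v huv).1) h1)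
  · exact h2 (hj.symm.mem_of_closed (fun e' he' u v huv => (hS e' he' u v huv).1) h1)

end Planarity
end TemporalGraph

/-! ### The family of graphs from which the sequence is taken -/

namespace TemporalGraph
open scoped Graph

/-- What stands on a foundation: only two parallel edges (`flat`), a house whose inhabitant is
not attached to `v_4` (`bare`), a house (`plain`), a house whose inhabitant is attached to the
planet instead of `v_4` (`spike`), or one of two neighbouring houses that share an extra vertex (`left`
and `right`). -/
inductive Role
  | flat
  | bare
  | plain
  | spike
  | left
  | right

/-- The first, second, and third house that is built upon, `a`, `a + 1` and `a + 2`. -/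
def IsSite (a h : ℕ) : Prop := a ≤ h ∧ h ≤ a + 2

/-- The flat role keeps the labels `wall h 2` and `claw h 1` because these are the edges of a house
that survive its contraction. -/
def Role.HasWall : Role → ℕ → Prop
  | flat, k => k = 2
  | _, k => 1 ≤ k ∧ k ≤ 6

def Role.HasClaw : Role → ℕ → Prop
  | flat, k => k = 1
  | plain, k => 1 ≤ k ∧ k ≤ 3
  | spike, k => 1 ≤ k ∧ k ≤ 3
  | _, k => k = 1 ∨ k = 3

def Role.HasExtra : Role → Prop
  | left => True
  | right => True
  | _ => False

def Role.HasHouse : Role → Prop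
  | flat => False
  | _ => True

/-- The vertices of the planet of equator `m` with structures of the given roles. -/
def IsVertex (m a : ℕ) (role : ℕ → Role) : Vertex → Prop
  | .centre => True
  | .surface j => 1 ≤ j ∧ j ≤ 4 * m
  | .house h k => IsSite a h ∧ (role h).HasHouse ∧ 2 ≤ k ∧ k ≤ 6
  | .inhabitant h => IsSite a h ∧ (role h).HasHouse
  | .extra h => IsSite a h ∧ role h = .left

def IsEdge (m a : ℕ) (role : ℕ → Role) : Edge → Prop
  | .spoke j => 1 ≤ j ∧ j ≤ 4 * m
  | .rim j => 1 ≤ j ∧ j ≤ 4 * m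
  | .wall h k => IsSite a h ∧ (role h).HasWall k
  | .claw h k => IsSite a h ∧ (role h).HasClaw k
  | .extra n => IsSite a (n / 3) ∧ (role (n / 3)).HasExtra

def Role.wallEnds (h k : ℕ) : Role → Vertex × Vertex
  | flat => (.surface (4 * h - 3), .surface (4 * h - 1))
  | _ => (houseVertex h k, houseVertex h (k + 1))

/-- The label `claw h 2` is reused for the attachment of a spike to s_{4h-2}. Bare houses, which
lack this label, lie between the two uses in the sequence. -/
def Role.clawEnds (h k : ℕ) : Role → Vertex × Vertex
  | flat => (.surface (4 * h - 3), .surface (4 * h - 1))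
  | spike => (.inhabitant h, if k = 2 then .surface (4 * h - 2) else houseVertex h (2 * k))
  | _ => (.inhabitant h, houseVertex h (2 * k))

/-- These edges provide the crossed contraction. On the left, v_6 gets an edge to s_{4h-3} and v_2 a
path through the shared vertex to s_{4h-1}. On the right, v_2 gets an edge to s_{4h-1} and v_6 a
path through the shared vertex to s_{4h-3}. Either crossing thus claims the shared vertex for a
different vertex of the rim. -/
def Role.extraEnds (h : ℕ) : Role → ℕ → Vertex × Vertex
  | left, 0 => (.house h 6, .surface (4 * h - 3))
  | left, 1 => (.house h 2, .extra h)
  | left, _ => (.surface (4 * h - 1), .extra h)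
  | right, 0 => (.house h 2, .surface (4 * h - 1))
  | right, 1 => (.house h 6, .extra (h - 1))
  | right, _ => (.surface (4 * h - 3), .extra (h - 1))
  | _, _ => (.centre, .centre)

def roleEnds (m : ℕ) (role : ℕ → Role) : Edge → Vertex × Vertex
  | .spoke j => (.centre, .surface j)
  | .rim j => (.surface j, .surface (if j = 4 * m then 1 else j + 1))
  | .wall h k => (role h).wallEnds h k
  | .claw h k => (role h).clawEnds h k
  | .extra n => (role (n / 3)).extraEnds (n / 3) (n % 3)

/-- The planet of equator `m` with structures of the given roles on three foundations. -/
def settlement (m a : ℕ) (role : ℕ → Role) : Graph Vertex Edge where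
  vertexSet := {v | IsVertex m a role v}
  IsLink e x y := IsEdge m a role e ∧ IsVertex m a role x ∧ IsVertex m a role y ∧
    (roleEnds m role e = (x, y) ∨ roleEnds m role e = (y, x))
  isLink_symm := fun _ _ => ⟨fun _ _ h => ⟨h.1, h.2.2.1, h.2.1, h.2.2.2.symm⟩⟩
  eq_or_eq_of_isLink_of_isLink := by
    rintro e x y v w ⟨-, -, -, h | h⟩ ⟨-, -, -, h' | h'⟩ <;> simp_all
  left_mem_of_isLink := fun _ _ _ h => h.2.1

/-- The shared vertex is counted with the left house of a pair, so the two halves of a pair may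
occur only together. -/
structure Valid (m a : ℕ) (role : ℕ → Role) : Prop where
  one_le : 1 ≤ a
  le : a + 2 ≤ m
  right_of_left : ∀ h, IsSite a h → role h = .left → IsSite a (h + 1) ∧ role (h + 1) = .right
  left_of_right : ∀ h, IsSite a h → role h = .right → IsSite a (h - 1) ∧ role (h - 1) = .left

/-- The index of the predecessor of a vertex on the rim. -/
def prev (m j : ℕ) : ℕ := if j = 1 then 4 * m else j - 1

/-! ### Rotation systems -/

/-- All rotators are anticlockwise in a drawing with the centre of the planet below the house and
indices increasing to the right. On a flat foundation the bit says that `claw h 1` runs below `wall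
h 2`. -/
def Role.upFirst (h : ℕ) (b : Bool) : Role → List Edge
  | flat => bif b then [.claw h 1, .wall h 2] else [.wall h 2, .claw h 1]
  | left => [.extra (3 * h), .wall h 1]
  | right => [.wall h 1, .extra (3 * h + 2)]
  | _ => [.wall h 1]

def Role.upSecond (h : ℕ) : Role → List Edge
  | spike => [.claw h 2]
  | _ => []

def Role.upThird (h : ℕ) (b : Bool) : Role → List Edge
  | flat => bif b then [.wall h 2, .claw h 1] else [.claw h 1, .wall h 2]
  | left => [.extra (3 * h + 2), .wall h 6]
  | right => [.wall h 6, .extra (3 * h)]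
  | _ => [.wall h 6]

open scoped Classical in
/-- The edges at `s_j` that leave the planet. -/
noncomputable def up (a : ℕ) (role : ℕ → Role) (b : ℕ → Bool) (j : ℕ) : List Edge :=
  if IsSite a ((j + 3) / 4) then
    if j % 4 = 1 then (role ((j + 3) / 4)).upFirst ((j + 3) / 4) (b ((j + 3) / 4))
    else if j % 4 = 2 then (role ((j + 3) / 4)).upSecond ((j + 3) / 4)
    else if j % 4 = 3 then (role ((j + 3) / 4)).upThird ((j + 3) / 4) (b ((j + 3) / 4))
    else []
  else []

/-- The bit decides whether claw edges leave below or above the walls. Extra edges keep their side: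
those to the rim run below the walls and those to the shared vertex above. -/
def Role.houseRot (h : ℕ) (b : Bool) : Role → ℕ → List Edge
  | flat, _ => []
  | left, 2 => bif b then [.wall h 2, .extra (3 * h + 1), .wall h 1, .claw h 1]
      else [.wall h 2, .claw h 1, .extra (3 * h + 1), .wall h 1]
  | right, 2 => bif b then [.wall h 2, .wall h 1, .extra (3 * h), .claw h 1]
      else [.wall h 2, .claw h 1, .wall h 1, .extra (3 * h)]
  | _, 2 => bif b then [.wall h 2, .wall h 1, .claw h 1] else [.wall h 2, .claw h 1, .wall h 1]
  | _, 3 => [.wall h 3, .wall h 2]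
  | plain, 4 => bif b then [.wall h 4, .wall h 3, .claw h 2] else [.wall h 4, .claw h 2, .wall h 3]
  | _, 4 => [.wall h 4, .wall h 3]
  | _, 5 => [.wall h 5, .wall h 4]
  | left, 6 => bif b then [.wall h 6, .wall h 5, .claw h 3, .extra (3 * h)]
      else [.wall h 6, .claw h 3, .wall h 5, .extra (3 * h)]
  | right, 6 => bif b then [.wall h 6, .extra (3 * h + 1), .wall h 5, .claw h 3]
      else [.wall h 6, .extra (3 * h + 1), .claw h 3, .wall h 5]
  | _, 6 => bif b then [.wall h 6, .wall h 5, .claw h 3] else [.wall h 6, .claw h 3, .wall h 5]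
  | _, _ => []

def Role.inhabitantRot (h : ℕ) (b : Bool) : Role → List Edge
  | flat => []
  | plain => bif b then [.claw h 3, .claw h 2, .claw h 1] else [.claw h 3, .claw h 1, .claw h 2]
  | spike => [.claw h 3, .claw h 1, .claw h 2]
  | _ => [.claw h 3, .claw h 1]

def Role.extraRot (h : ℕ) : Role → List Edge
  | left => [.extra (3 * h + 1), .extra (3 * h + 2), .extra (3 * (h + 1) + 2),
      .extra (3 * (h + 1) + 1)]
  | _ => []

open scoped Classical in
/-- The rotators of the embedding in which the bits `b` tell which inhabitants are inside. -/
noncomputable def rotator (m a : ℕ) (role : ℕ → Role) (b : ℕ → Bool) : Vertex → List Edge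
  | .centre => (List.range (4 * m)).reverse.map fun j => .spoke (j + 1)
  | .surface j => if 1 ≤ j ∧ j ≤ 4 * m then
      .spoke j :: .rim j :: (up a role b j ++ [.rim (prev m j)]) else []
  | .house h k => if IsSite a h then (role h).houseRot h (b h) k else []
  | .inhabitant h => if IsSite a h then (role h).inhabitantRot h (b h) else []
  | .extra h => if IsSite a h then (role h).extraRot h else []

variable {m a : ℕ} {role : ℕ → Role} {b : ℕ → Bool}

/-- The vertex s_j lies on the foundation with index `(j + 3) / 4`. The bound on `a` excludes h = 0,
where the subtractions would truncate. -/
theorem mem_up (ha : 1 ≤ a) {e : Edge} {j : ℕ} : e ∈ up a role b j ↔ ∃ h, IsSite a h ∧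
    ((j = 4 * h - 3 ∧ e ∈ (role h).upFirst h (b h)) ∨
      (j = 4 * h - 2 ∧ e ∈ (role h).upSecond h) ∨
      (j = 4 * h - 1 ∧ e ∈ (role h).upThird h (b h))) := by
  unfold up
  constructor
  · intro h
    split_ifs at h with h1 h2 h3 h4
    · exact ⟨_, h1, .inl ⟨by omega, h⟩⟩
    · exact ⟨_, h1, .inr (.inl ⟨by omega, h⟩)⟩
    · exact ⟨_, h1, .inr (.inr ⟨by omega, h⟩)⟩
    · simp at h
    · simp at h
  · rintro ⟨h, h1, h2⟩
    have h3 : 1 ≤ h := ha.trans h1.1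
    obtain ⟨h2, h4⟩ | ⟨h2, h4⟩ | ⟨h2, h4⟩ := h2
    · have h5 : (j + 3) / 4 = h := by omega
      have h6 : j % 4 = 1 := by omega
      simpa [h5, h6, h1] using h4
    · have h5 : (j + 3) / 4 = h := by omega
      have h6 : j % 4 = 2 := by omega
      simpa [h5, h6, h1] using h4
    · have h5 : (j + 3) / 4 = h := by omega
      have h6 : j % 4 = 3 := by omega
      simpa [h5, h6, h1] using h4

/-- Validity matters for the extra edges of a right house, which end at a vertex owned by the left
neighbour. -/
theorem Valid.isVertex_ends (hv : Valid m a role) {e : Edge} (he : IsEdge m a role e) :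
    IsVertex m a role (roleEnds m role e).1 ∧ IsVertex m a role (roleEnds m role e).2 ∧
      (roleEnds m role e).1 ≠ (roleEnds m role e).2 := by
  obtain ⟨h1, h2, hrl, hlr⟩ := hv
  cases e with
  | spoke j => simpa [IsVertex, roleEnds, IsEdge] using he
  | rim j =>
    simp only [IsVertex, roleEnds, IsEdge] at he ⊢
    split_ifs <;> simp <;> omega
  | wall h k =>
    obtain ⟨h3, h4⟩ := he
    have h3' := h3
    unfold IsSite at h3'
    cases hr : role h <;>
      simp [IsVertex, roleEnds, hr, Role.wallEnds, Role.HasWall, houseVertex] at h4 ⊢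
    all_goals first | omega | skip
    all_goals split_ifs <;> simp [IsVertex, h3, hr, Role.HasHouse] <;> omega
  | claw h k =>
    obtain ⟨h3, h4⟩ := he
    have h3' := h3
    unfold IsSite at h3'
    cases hr : role h <;>
      simp [IsVertex, roleEnds, hr, Role.clawEnds, Role.HasClaw, houseVertex] at h4 ⊢
    all_goals first | omega | skip
    all_goals split_ifs <;> simp [IsVertex, h3, hr, Role.HasHouse] <;> omega
  | extra n =>
    obtain ⟨h3, h4⟩ := he
    have h3' := h3
    unfold IsSite at h3'
    have hn : n % 3 = 0 ∨ n % 3 = 1 ∨ n % 3 = 2 := by omega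
    cases hr : role (n / 3) <;> rw [hr] at h4 <;> try exact h4.elim
    · obtain hn | hn | hn := hn <;>
      simp [IsVertex, roleEnds, hr, Role.extraEnds, Role.HasHouse, hn, h3] <;> omega
    · have := hlr _ h3 hr
      obtain hn | hn | hn := hn <;>
      simp [IsVertex, roleEnds, hr, Role.extraEnds, Role.HasHouse, hn, h3, this] <;> omega

theorem Valid.isLink_iff (hv : Valid m a role) {e : Edge} {x y : Vertex} :
    (settlement m a role).IsLink e x y ↔ IsEdge m a role e ∧
      (roleEnds m role e = (x, y) ∨ roleEnds m role e = (y, x)) := by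
  refine ⟨fun h => ⟨h.1, h.2.2.2⟩, fun h => ⟨h.1, ?_⟩⟩
  have h1 := hv.isVertex_ends h.1
  obtain ⟨-, h2 | h2⟩ := h <;> rw [h2] at h1
  · exact ⟨h1.1, h1.2.1, .inl h2⟩
  · exact ⟨h1.2.1, h1.1, .inr h2⟩

theorem Valid.inc_iff (hv : Valid m a role) {e : Edge} {x : Vertex} :
    (settlement m a role).Inc e x ↔ IsEdge m a role e ∧
      ((roleEnds m role e).1 = x ∨ (roleEnds m role e).2 = x) := by
  constructor
  · rintro ⟨y, h⟩
    rw [hv.isLink_iff] at h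
    obtain ⟨h1, h2 | h2⟩ := h <;> simp [h1, h2]
  · rintro ⟨h1, h2 | h2⟩
    · exact ⟨_, hv.isLink_iff.2 ⟨h1, .inl (Prod.ext h2 rfl)⟩⟩
    · exact ⟨_, hv.isLink_iff.2 ⟨h1, .inr (Prod.ext rfl h2)⟩⟩

theorem Valid.mem_edgeSet_iff (hv : Valid m a role) {e : Edge} :
    e ∈ E(settlement m a role) ↔ IsEdge m a role e := by
  constructor
  · intro h
    obtain ⟨x, y, h⟩ := Graph.exists_isLink_of_mem_edgeSet h
    exact (hv.isLink_iff.1 h).1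
  · intro h
    exact (hv.isLink_iff.2 ⟨h, .inl rfl⟩).edge_mem

theorem Valid.loopless (hv : Valid m a role) : (settlement m a role).Loopless where
  not_isLoopAt e x h := by
    obtain ⟨h1, h2 | h2⟩ := hv.isLink_iff.1 h
    all_goals
      have := (hv.isVertex_ends h1).2.2
      rw [h2] at this
      exact this rfl

theorem three_mul_div (h : ℕ) : 3 * h / 3 = h ∧ (3 * h + 1) / 3 = h ∧ (3 * h + 2) / 3 = h ∧
    3 * h % 3 = 0 ∧ (3 * h + 1) % 3 = 1 ∧ (3 * h + 2) % 3 = 2 := by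
  omega

theorem Valid.inc_of_mem_rotator (hv : Valid m a role) {e : Edge} {x : Vertex}
    (he : e ∈ rotator m a role b x) : IsEdge m a role e ∧
      ((roleEnds m role e).1 = x ∨ (roleEnds m role e).2 = x) := by
  have ha := hv.one_le
  have hm := hv.le
  cases x with
  | centre =>
    simp only [rotator, List.mem_map, List.mem_reverse, List.mem_range] at he
    obtain ⟨j, h1, rfl⟩ := he
    simp [IsEdge, roleEnds]
    omega
  | surface j =>
    simp only [rotator] at he
    split_ifs at he with hj
    · simp only [List.mem_cons, List.mem_append, List.not_mem_nil, or_false] at he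
      obtain rfl | rfl | he | rfl := he
      · simpa [IsEdge, roleEnds] using hj
      · simpa [IsEdge, roleEnds] using hj
      · rw [mem_up ha] at he
        obtain ⟨h, hs, ⟨rfl, h4⟩ | ⟨rfl, h4⟩ | ⟨rfl, h4⟩⟩ := he
        · cases hr : role h <;> cases hb : b h <;>
          simp [hr, hb, Role.upFirst] at h4 <;>
          (try obtain rfl | rfl := h4) <;> (try subst h4) <;>
          simp [IsEdge, roleEnds, hr, hs, three_mul_div, Role.HasWall, Role.HasClaw,
            Role.HasExtra, Role.wallEnds, Role.clawEnds, Role.extraEnds, houseVertex]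
        · cases hr : role h <;>
          simp [hr, Role.upSecond] at h4
          subst h4
          simp [IsEdge, roleEnds, hr, hs, Role.HasClaw, Role.clawEnds]
        · cases hr : role h <;> cases hb : b h <;>
          simp [hr, hb, Role.upThird] at h4 <;>
          (try obtain rfl | rfl := h4) <;> (try subst h4) <;>
          simp [IsEdge, roleEnds, hr, hs, three_mul_div, Role.HasWall, Role.HasClaw,
            Role.HasExtra, Role.wallEnds, Role.clawEnds, Role.extraEnds, houseVertex]
      · simp only [IsEdge, roleEnds, prev]
        split_ifs <;> simp <;> omega
    · simp at he
  | house h k =>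
    simp only [rotator] at he
    split_ifs at he with hs
    · have hk : k = 2 ∨ k = 3 ∨ k = 4 ∨ k = 5 ∨ k = 6 := by
        by_contra hk
        simp only [not_or] at hk
        cases hr : role h <;> simp [hr, Role.houseRot, hk] at he
      cases hr : role h <;> obtain rfl | rfl | rfl | rfl | rfl := hk <;> cases hb : b h <;>
      simp [hr, hb, Role.houseRot] at he <;> (try obtain rfl | rfl | rfl | rfl := he) <;>
      (try obtain rfl | rfl | rfl := he) <;> (try obtain rfl | rfl := he) <;>
      simp [IsEdge, roleEnds, hr, hs, three_mul_div, Role.HasWall, Role.HasClaw,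
            Role.HasExtra, Role.wallEnds, Role.clawEnds, Role.extraEnds, houseVertex]
    · simp at he
  | inhabitant h =>
    simp only [rotator] at he
    split_ifs at he with hs
    · cases hr : role h <;> cases hb : b h <;>
      simp [hr, hb, Role.inhabitantRot] at he <;>
      (try obtain rfl | rfl | rfl := he) <;> (try obtain rfl | rfl := he) <;>
      simp [IsEdge, roleEnds, hr, hs, three_mul_div, Role.HasWall, Role.HasClaw,
            Role.HasExtra, Role.wallEnds, Role.clawEnds, Role.extraEnds, houseVertex]
    · simp at he
  | extra h =>
    simp only [rotator] at he
    split_ifs at he with hs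
    · cases hr : role h <;>
      simp [hr, Role.extraRot] at he
      have h1 := hv.right_of_left h hs hr
      obtain rfl | rfl | rfl | rfl := he <;>
      simp [IsEdge, roleEnds, hr, hs, h1, three_mul_div,
            Role.HasExtra, Role.extraEnds]
    · simp at he

open scoped Classical in
theorem rotator_house {h k : ℕ} : rotator m a role b (.house h k) =
    if IsSite a h then (role h).houseRot h (b h) k else [] := rfl

open scoped Classical in
theorem rotator_inhabitant {h : ℕ} : rotator m a role b (.inhabitant h) =
    if IsSite a h then (role h).inhabitantRot h (b h) else [] := rfl

open scoped Classical in
theorem rotator_extra {h : ℕ} : rotator m a role b (.extra h) =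
    if IsSite a h then (role h).extraRot h else [] := rfl

theorem Valid.mem_rotator_of_isEdge (hv : Valid m a role) {e : Edge} (he : IsEdge m a role e) :
    e ∈ rotator m a role b (roleEnds m role e).1 ∧
      e ∈ rotator m a role b (roleEnds m role e).2 := by
  have ha := hv.one_le
  have hm := hv.le
  have hup : ∀ e j, (∃ h, IsSite a h ∧
    ((j = 4 * h - 3 ∧ e ∈ (role h).upFirst h (b h)) ∨
      (j = 4 * h - 2 ∧ e ∈ (role h).upSecond h) ∨
      (j = 4 * h - 1 ∧ e ∈ (role h).upThird h (b h)))) → e ∈ rotator m a role b (.surface j) := by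
    intro e j h
    have h' := (mem_up (b := b) ha).2 h
    obtain ⟨h, ⟨h1, h2⟩, h3⟩ := h
    have hj : 1 ≤ j ∧ j ≤ 4 * m := by omega
    simp [rotator, hj, h']
  have hup1 : ∀ e h, IsSite a h → e ∈ (role h).upFirst h (b h) →
      e ∈ rotator m a role b (.surface (4 * h - 3)) :=
    fun e h hs he => hup e _ ⟨h, hs, .inl ⟨rfl, he⟩⟩
  have hup2 : ∀ e h, IsSite a h → e ∈ (role h).upSecond h →
      e ∈ rotator m a role b (.surface (4 * h - 2)) :=
    fun e h hs he => hup e _ ⟨h, hs, .inr (.inl ⟨rfl, he⟩)⟩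
  have hup3 : ∀ e h, IsSite a h → e ∈ (role h).upThird h (b h) →
      e ∈ rotator m a role b (.surface (4 * h - 1)) :=
    fun e h hs he => hup e _ ⟨h, hs, .inr (.inr ⟨rfl, he⟩)⟩
  clear hup
  cases e with
  | spoke j =>
    simp only [IsEdge] at he
    simp [roleEnds, rotator, he]
    exact ⟨j - 1, by omega, by omega⟩
  | rim j =>
    simp only [IsEdge] at he
    simp only [roleEnds, rotator, he, and_self, if_true, prev]
    refine ⟨by simp, ?_⟩
    split_ifs with h1 h2 h2 <;> simp <;> omega
  | wall h k =>
    obtain ⟨hs, he⟩ := he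
    have h1 := hup1 (.wall h k) h hs
    have h3 := hup3 (.wall h k) h hs
    simp only [roleEnds]
    cases hr : role h <;> rw [hr] at he h1 h3 <;> simp only [Role.HasWall] at he
    · subst he
      exact ⟨h1 (by cases b h <;> simp [Role.upFirst]),
        h3 (by cases b h <;> simp [Role.upThird])⟩
    all_goals
      have hk : k = 1 ∨ k = 2 ∨ k = 3 ∨ k = 4 ∨ k = 5 ∨ k = 6 := by omega
      clear he
      obtain rfl | rfl | rfl | rfl | rfl | rfl := hk <;> cases hb : b h <;>
      simp [Role.upFirst, Role.upThird] at h1 h3 <;>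
      simp [Role.wallEnds, houseVertex, rotator_house, hs, hr, hb, Role.houseRot, h1, h3]
  | claw h k =>
    obtain ⟨hs, he⟩ := he
    have h1 := hup1 (.claw h k) h hs
    have h2 := hup2 (.claw h k) h hs
    have h3 := hup3 (.claw h k) h hs
    simp only [roleEnds]
    cases hr : role h <;> rw [hr] at he h1 h2 h3 <;> simp only [Role.HasClaw] at he
    · subst he
      exact ⟨h1 (by cases b h <;> simp [Role.upFirst]),
        h3 (by cases b h <;> simp [Role.upThird])⟩
    all_goals
      have hk : k = 1 ∨ k = 2 ∨ k = 3 := by omega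
      obtain rfl | rfl | rfl := hk <;> simp at he <;> cases hb : b h <;>
      simp [Role.upSecond] at h2 <;>
      simp [Role.clawEnds, houseVertex, rotator_house, rotator_inhabitant, hs, hr, hb,
        Role.houseRot, Role.inhabitantRot, h2]
  | extra n =>
    obtain ⟨hs, he⟩ := he
    obtain ⟨h, rfl | rfl | rfl⟩ : ∃ h, n = 3 * h ∨ n = 3 * h + 1 ∨ n = 3 * h + 2 :=
      ⟨n / 3, by omega⟩
    all_goals
      simp only [three_mul_div] at hs he
      simp only [roleEnds, three_mul_div]
      cases hr : role h <;> rw [hr] at he <;> (try exact he.elim)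
    · exact ⟨by cases hb : b h <;> simp [Role.extraEnds, rotator_house, hs, hr, hb, Role.houseRot],
        hup1 _ h hs (by simp [hr, Role.upFirst])⟩
    · exact ⟨by cases hb : b h <;> simp [Role.extraEnds, rotator_house, hs, hr, hb, Role.houseRot],
        hup3 _ h hs (by simp [hr, Role.upThird])⟩
    · exact ⟨by cases hb : b h <;> simp [Role.extraEnds, rotator_house, hs, hr, hb, Role.houseRot],
        by simp [Role.extraEnds, rotator_extra, hs, hr, Role.extraRot]⟩
    · obtain ⟨h1, h2⟩ := hv.left_of_right h hs hr
      have h3 : h - 1 + 1 = h := by have := hs.1; omega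
      exact ⟨by cases hb : b h <;> simp [Role.extraEnds, rotator_house, hs, hr, hb, Role.houseRot],
        by simp [Role.extraEnds, rotator_extra, h1, h2, h3, Role.extraRot]⟩
    · exact ⟨hup3 _ h hs (by simp [hr, Role.upThird]),
        by simp [Role.extraEnds, rotator_extra, hs, hr, Role.extraRot]⟩
    · obtain ⟨h1, h2⟩ := hv.left_of_right h hs hr
      have h3 : h - 1 + 1 = h := by have := hs.1; omega
      exact ⟨hup1 _ h hs (by simp [hr, Role.upFirst]),
        by simp [Role.extraEnds, rotator_extra, h1, h2, h3, Role.extraRot]⟩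

/-- Besides being needed for planarity, this turns incidence into membership in an explicit list,
from which degrees and the edges at a given vertex are read off. -/
theorem Valid.mem_rotator_iff (hv : Valid m a role) {e : Edge} {x : Vertex} :
    e ∈ rotator m a role b x ↔ (settlement m a role).Inc e x := by
  rw [hv.inc_iff]
  refine ⟨hv.inc_of_mem_rotator, ?_⟩
  rintro ⟨h1, rfl | rfl⟩
  · exact (hv.mem_rotator_of_isEdge h1).1
  · exact (hv.mem_rotator_of_isEdge h1).2

theorem up_planet (ha : 1 ≤ a) {j k : ℕ} :
    Edge.spoke k ∉ up a role b j ∧ Edge.rim k ∉ up a role b j := by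
  rw [mem_up ha, mem_up ha]
  constructor
  all_goals
    rintro ⟨h, hs, ⟨-, h4⟩ | ⟨-, h4⟩ | ⟨-, h4⟩⟩ <;> cases hr : role h <;> cases hb : b h <;>
    simp [hr, hb, Role.upFirst, Role.upSecond, Role.upThird] at h4

theorem nodup_up {j : ℕ} : (up a role b j).Nodup := by
  unfold up
  split_ifs with h1 h2 h3 h4
  all_goals
    cases hr : role ((j + 3) / 4) <;> cases hb : b ((j + 3) / 4) <;>
    simp [Role.upFirst, Role.upSecond, Role.upThird]

theorem Valid.nodup_rotator (hv : Valid m a role) (x : Vertex) : (rotator m a role b x).Nodup := by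
  have ha := hv.one_le
  have hm := hv.le
  cases x with
  | centre =>
    refine List.Nodup.map (fun x y h => by simpa using h) ?_
    exact List.nodup_reverse.2 List.nodup_range
  | surface j =>
    simp only [rotator]
    split_ifs with hj
    · have h1 : prev m j ≠ j := by unfold prev; split_ifs <;> omega
      simp [List.nodup_append, up_planet ha, nodup_up, h1.symm]
      rintro e he rfl
      exact (up_planet ha).2 he
    · simp
  | house h k =>
    simp only [rotator]
    split_ifs with hs
    · by_cases hk : k = 2 ∨ k = 3 ∨ k = 4 ∨ k = 5 ∨ k = 6
      · cases hr : role h <;> obtain rfl | rfl | rfl | rfl | rfl := hk <;> cases hb : b h <;>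
        simp [Role.houseRot]
      · simp only [not_or] at hk
        cases hr : role h <;> simp [Role.houseRot, hk]
    · simp
  | inhabitant h =>
    simp only [rotator]
    split_ifs with hs
    · cases hr : role h <;> cases hb : b h <;> simp [Role.inhabitantRot]
    · simp
  | extra h =>
    simp only [rotator]
    split_ifs with hs
    · cases hr : role h <;> simp [Role.extraRot]
      omega
    · simp

end TemporalGraph

namespace TemporalGraph
open scoped Graph

variable {m a : ℕ} {role : ℕ → Role} {b : ℕ → Bool}

/-! ### Faces -/

/-- Names of the faces: `tri j` is bounded by `rim j` and two spokes, `outer` is outside of all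
houses, and `loc h t` is at the `h`-th house. -/
inductive Face
  | tri (j : ℕ)
  | outer
  | loc (h t : ℕ)

namespace Role

/-- The face below the rim of a house. -/
def under (h : ℕ) : Role → Face
  | left => .loc h 3
  | right => .loc h 3
  | _ => .loc h 0

/-- The face above the roof. -/
def above (h : ℕ) : Role → Face
  | left => .loc h 4
  | right => .loc h 4
  | _ => .outer

/-- The edge `claw h 2` of a plain house divides the face between the inhabitant and the upper
walls; in the other roles both halves are one face. -/
def midSecond (h : ℕ) : Role → Face
  | plain => .loc h 2
  | _ => .loc h 1

/-- In the drawing above, the face of a dart lies on its right. The first component belongs to the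
dart leaving the first end of the edge, so here it is the face below the wall. -/
def wallFaces (h : ℕ) (b : Bool) : Role → ℕ → Face × Face
  | flat, _ => bif b then (.loc h 1, .outer) else (.loc h 0, .loc h 1)
  | left, 1 => (.loc h 3, .outer)
  | right, 1 => (.loc h 0, .loc h 4)
  | _, 1 => (.loc h 0, .outer)
  | left, 6 => (.loc h 0, .loc h 4)
  | right, 6 => (.loc h 3, .outer)
  | spike, 6 => (.loc h 3, .outer)
  | _, 6 => (.loc h 0, .outer)
  | r, k => if k ≤ 3 then bif b then (.loc h 1, r.above h) else (r.under h, .loc h 1)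
      else bif b then (r.midSecond h, r.above h) else (r.under h, r.midSecond h)

def clawFaces (h : ℕ) (b : Bool) : Role → ℕ → Face × Face
  | flat, _ => bif b then (.loc h 0, .loc h 1) else (.loc h 1, .outer)
  | r, 1 => bif b then (.loc h 1, r.under h) else (r.above h, .loc h 1)
  | spike, 2 => (.loc h 0, .loc h 3)
  | _, 2 => bif b then (.loc h 2, .loc h 1) else (.loc h 1, .loc h 2)
  | spike, _ => (.loc h 3, .loc h 1)
  | r, _ => bif b then (r.under h, r.midSecond h) else (r.midSecond h, r.above h)

def extraFaces (h : ℕ) : Role → ℕ → Face × Face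
  | left, 0 => (.loc h 3, .loc h 0)
  | left, 1 => (.loc h 4, .outer)
  | left, _ => (.loc h 5, .loc h 4)
  | _, 0 => (.loc h 0, .loc h 3)
  | _, 1 => (.outer, .loc h 4)
  | _, _ => (.loc h 4, .loc (h - 1) 5)

/-- For a spike, `claw h 2` separates the faces over the two rim edges below the house. For a left
house, the rim edges after it lie under the pocket between the pair and its shared vertex, which is
face 5. -/
def rimFace (h t : ℕ) : Role → Face
  | spike => if t = 2 then .loc h 3 else if t = 1 then .loc h 0 else .outer
  | left => if t = 1 ∨ t = 2 then .loc h 0 else .loc h 5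
  | _ => if t = 1 ∨ t = 2 then .loc h 0 else .outer

end Role

open scoped Classical in
/-- The face on the other side of `rim j` from the centre. -/
noncomputable def rimFace (a : ℕ) (role : ℕ → Role) (j : ℕ) : Face :=
  if IsSite a ((j + 3) / 4) then (role ((j + 3) / 4)).rimFace ((j + 3) / 4) (j % 4) else .outer

/-- The faces of the two darts of an edge. -/
noncomputable def edgeFaces (m a : ℕ) (role : ℕ → Role) (b : ℕ → Bool) : Edge → Face × Face
  | .spoke j => (.tri j, .tri (prev m j))
  | .rim j => (.tri j, rimFace a role j)
  | .wall h k => (role h).wallFaces h (b h) k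
  | .claw h k => (role h).clawFaces h (b h) k
  | .extra n => (role (n / 3)).extraFaces (n / 3) (n % 3)

open scoped Classical in
/-- The face of a dart. -/
noncomputable def dartFace (m a : ℕ) (role : ℕ → Role) (b : ℕ → Bool) (x : Vertex) (e : Edge) :
    Face :=
  if (roleEnds m role e).1 = x then (edgeFaces m a role b e).1 else (edgeFaces m a role b e).2

open scoped Classical in
/-- The face of the reversed dart. -/
noncomputable def dartFaceRev (m a : ℕ) (role : ℕ → Role) (b : ℕ → Bool) (x : Vertex) (e : Edge) :
    Face :=
  if (roleEnds m role e).1 = x then (edgeFaces m a role b e).2 else (edgeFaces m a role b e).1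

theorem Valid.dartFaceRev_eq (hv : Valid m a role) {e : Edge} {u v : Vertex}
    (h : (settlement m a role).IsLink e u v) :
    dartFaceRev m a role b v e = dartFace m a role b u e := by
  have h1 := hv.isLink_iff.1 h
  have h2 := (hv.isVertex_ends h1.1).2.2
  obtain ⟨-, h1 | h1⟩ := h1 <;> rw [h1] at h2 <;> simp [dartFace, dartFaceRev, h1, h2, h2.symm]

/-- The spokes are listed by decreasing index, so rotating the list by one leads from each spoke to
that of the predecessor on the rim. -/
theorem List.map_rotate_centre {γ : Type*} {m : ℕ} {f g : Edge → γ}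
    (h : ∀ j, 1 ≤ j → j ≤ 4 * m → f (.spoke (prev m j)) = g (.spoke j)) :
    ((((List.range (4 * m)).reverse.map fun j => Edge.spoke (j + 1)).rotate 1).map f) =
      ((List.range (4 * m)).reverse.map fun j => Edge.spoke (j + 1)).map g := by
  refine List.ext_getElem (by simp) ?_
  intro i h1 h2
  simp only [List.length_map, List.length_rotate, List.length_reverse, List.length_range] at h1
  simp only [List.getElem_map, List.getElem_rotate, List.getElem_reverse, List.length_map,
    List.length_reverse, List.length_range, List.getElem_range]
  rw [← h _ (by omega) (by omega)]
  congr 2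
  unfold prev
  by_cases h3 : i + 1 = 4 * m
  · rw [h3, Nat.mod_self, if_pos (by omega)]
    omega
  · rw [Nat.mod_eq_of_lt (by omega), if_neg (by omega)]
    omega

-- The rim edge in front of a foundation is under the outer face unless the house is the right half
-- of a pair. In that case the edge bounds the pocket labelled at the left half.
open scoped Classical in
theorem Valid.rimFace_prev (hv : Valid m a role) {h : ℕ} (hs : IsSite a h) :
    rimFace a role (prev m (4 * h - 3)) =
      if role h = .right then Face.loc (h - 1) 5 else .outer := by
  have ha := hv.one_le
  have hm := hv.le
  have hs' := hs
  unfold IsSite at hs'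
  by_cases hr : role h = .right
  · obtain ⟨h1, h2⟩ := hv.left_of_right h hs hr
    have h3 := h1.1
    have h4 : prev m (4 * h - 3) = 4 * (h - 1) := by unfold prev; split_ifs <;> omega
    have h5 : (4 * (h - 1) + 3) / 4 = h - 1 := by omega
    simp [rimFace, h4, h5, h1, h2, hr, Role.rimFace]
  · rw [if_neg hr]
    unfold rimFace
    split_ifs with h1
    · by_cases h2 : role ((prev m (4 * h - 3) + 3) / 4) = .left
      · obtain ⟨h3, h4⟩ := hv.right_of_left _ h1 h2
        refine absurd ?_ hr
        convert h4
        unfold IsSite at h3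
        unfold prev
        split_ifs with h5
        · simp [prev, h5] at h3
          omega
        · omega
      · have h5 : prev m (4 * h - 3) % 4 = 0 := by unfold prev; split_ifs <;> omega
        rw [h5]
        revert h2
        cases role ((prev m (4 * h - 3) + 3) / 4) <;> simp [Role.rimFace]
    · rfl

/-- The vertex-by-vertex check that labels are constant along faces. The assumption on the bits is
needed because a spike is labelled for an inhabitant inside only. -/
theorem Valid.map_dartFace (hv : Valid m a role)
    (hb : ∀ h, IsSite a h → role h = .spike → b h = true) (x : Vertex) :
    ((rotator m a role b x).rotate 1).map (dartFace m a role b x) =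
      (rotator m a role b x).map (dartFaceRev m a role b x) := by
  have ha := hv.one_le
  have hm := hv.le
  cases x with
  | centre =>
    refine List.map_rotate_centre fun j h1 h2 => ?_
    simp [dartFace, dartFaceRev, roleEnds, edgeFaces]
  | surface j =>
    simp only [rotator]
    split_ifs with hj
    · have h1 : (if prev m j = 4 * m then 1 else prev m j + 1) = j := by
        unfold prev; split_ifs <;> omega
      have h2 : prev m j ≠ j := by unfold prev; split_ifs <;> omega
      -- The faces of the spoke are the same for all roles; the rest runs from `rim j` through the
      -- edges leaving the planet to `rim (prev m j)`.
      suffices (up a role b j ++ [Edge.rim (prev m j)]).map (dartFace m a role b (.surface j)) =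
          (Edge.rim j :: up a role b j).map (dartFaceRev m a role b (.surface j)) by
        rw [List.rotate_cons_succ, List.rotate_zero]
        simp only [List.cons_append, List.append_assoc, List.map_cons, List.map_append,
          List.map_nil, List.append_nil] at this ⊢
        rw [List.nil_append, List.append_cons, this]
        simp [dartFace, dartFaceRev, roleEnds, edgeFaces, h2]
      have hr1 : dartFace m a role b (.surface j) (.rim (prev m j)) =
          rimFace a role (prev m j) := by
        simp [dartFace, roleEnds, edgeFaces, h2]
      have hr2 : dartFaceRev m a role b (.surface j) (.rim j) = rimFace a role j := by
        simp [dartFaceRev, roleEnds, edgeFaces]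
      simp only [List.map_append, List.map_cons, List.map_nil, hr1, hr2]
      by_cases hs : IsSite a ((j + 3) / 4)
      · obtain ⟨h, hh⟩ : ∃ h, h = (j + 3) / 4 := ⟨_, rfl⟩
        rw [← hh] at hs
        have hs' := hs.1
        obtain rfl | rfl | rfl | rfl :
          j = 4 * h - 3 ∨ j = 4 * h - 2 ∨ j = 4 * h - 1 ∨ j = 4 * h := by omega
        · have h4 : (4 * h - 3) % 4 = 1 := by omega
          rw [hv.rimFace_prev hs]
          simp only [rimFace, up, ← hh, hs, h4, if_true]
          cases hr : role h <;> cases hbb : b h <;>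
          simp [Role.upFirst, Role.rimFace, dartFace, dartFaceRev, roleEnds, hr, hbb,
            Role.wallEnds, houseVertex, edgeFaces, Role.wallFaces, Role.clawEnds,
            Role.clawFaces, three_mul_div, Role.extraEnds, Role.extraFaces]
        · have h4 : (4 * h - 2) % 4 = 2 := by omega
          have h5 : prev m (4 * h - 2) = 4 * h - 3 := by unfold prev; split_ifs <;> omega
          have h6 : (4 * h - 3 + 3) / 4 = h := by omega
          have h7 : (4 * h - 3) % 4 = 1 := by omega
          simp only [rimFace, up, ← hh, hs, h4, h5, h6, h7, if_true]
          cases hr : role h <;>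
          simp [Role.upSecond, Role.rimFace, dartFace, dartFaceRev, roleEnds, hr,
            edgeFaces, Role.clawEnds, Role.clawFaces]
        · have h4 : (4 * h - 1) % 4 = 3 := by omega
          have h5 : prev m (4 * h - 1) = 4 * h - 2 := by unfold prev; split_ifs <;> omega
          have h6 : (4 * h - 2 + 3) / 4 = h := by omega
          have h7 : (4 * h - 2) % 4 = 2 := by omega
          have h8 : 4 * h - 3 ≠ 4 * h - 1 := by omega
          simp only [rimFace, up, ← hh, hs, h4, h5, h6, h7, if_true]
          cases hr : role h <;> cases hbb : b h <;>
          simp [Role.upThird, Role.rimFace, dartFace, dartFaceRev, roleEnds, hr, hbb, h8,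
            Role.wallEnds, houseVertex, edgeFaces, Role.wallFaces, Role.clawEnds,
            Role.clawFaces, three_mul_div, Role.extraEnds, Role.extraFaces]
        · have h4 : (4 * h) % 4 = 0 := by omega
          have h5 : prev m (4 * h) = 4 * h - 1 := by unfold prev; split_ifs <;> omega
          have h6 : (4 * h - 1 + 3) / 4 = h := by omega
          have h7 : (4 * h - 1) % 4 = 3 := by omega
          simp only [rimFace, up, ← hh, hs, h4, h5, h6, h7, if_true]
          cases hr : role h <;> simp [Role.rimFace]
      · have h3 : rimFace a role (prev m j) = .outer := by
          unfold rimFace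
          split_ifs with h4
          · have h5 : ∀ h', h' = (prev m j + 3) / 4 →
                IsSite a (h' + 1) → IsSite a ((j + 3) / 4) := by
              intro h' hh' h6
              convert h6
              unfold IsSite at h4 h6
              unfold prev at hh' h4
              split_ifs at hh' h4 with h7
              · omega
              · by_contra h8
                have h9 : h' = (j + 3) / 4 := by omega
                have : ¬ IsSite a ((j + 3) / 4) := hs
                unfold IsSite at this
                omega
            have h6 : prev m j % 4 = 0 := by
              by_contra h6
              refine hs ?_
              convert h4 using 1
              unfold prev at h6 ⊢
              split_ifs at h6 ⊢ <;> omega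
            rw [h6]
            cases hr : role ((prev m j + 3) / 4) <;> simp [Role.rimFace]
            exact hs (h5 _ rfl (hv.right_of_left _ h4 hr).1)
          · rfl
        rw [h3]
        simp [up, rimFace, hs]
    · rfl
  | house h k =>
    simp only [rotator]
    split_ifs with hs
    · by_cases hk : k = 2 ∨ k = 3 ∨ k = 4 ∨ k = 5 ∨ k = 6
      · cases hr : role h <;> obtain rfl | rfl | rfl | rfl | rfl := hk <;> cases hbb : b h <;>
        simp [Role.houseRot, dartFace, dartFaceRev, roleEnds, hr, hbb,
            Role.wallEnds, houseVertex, edgeFaces, Role.wallFaces, Role.clawEnds, Role.above,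
            Role.under, Role.midSecond,
            Role.clawFaces, three_mul_div, Role.extraEnds, Role.extraFaces]
        all_goals
          have := hb h hs hr
          simp [this] at hbb
      · simp only [not_or] at hk
        cases hr : role h <;> simp [Role.houseRot, hk]
    · simp
  | inhabitant h =>
    simp only [rotator]
    split_ifs with hs
    · cases hr : role h <;> cases hbb : b h <;>
      simp [Role.inhabitantRot, dartFace, dartFaceRev, roleEnds, hr, hbb,
            houseVertex, edgeFaces, Role.clawEnds, Role.above,
            Role.under, Role.midSecond, Role.clawFaces]
      have := hb h hs hr
      simp [this] at hbb
    · simp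
  | extra h =>
    simp only [rotator]
    split_ifs with hs
    · cases hr : role h <;> simp [Role.extraRot]
      have h1 := hv.right_of_left h hs hr
      simp [dartFace, dartFaceRev, roleEnds, hr, h1, edgeFaces, three_mul_div, Role.extraEnds,
        Role.extraFaces]
    · simp

end TemporalGraph

namespace TemporalGraph
open scoped Graph

variable {m a : ℕ} {role : ℕ → Role} {b : ℕ → Bool}

/-! ### Connectivity -/

theorem Valid.adj_deleteVerts (hv : Valid m a role) {v : Vertex} {e : Edge}
    (he : IsEdge m a role e) (h1 : (roleEnds m role e).1 ≠ v) (h2 : (roleEnds m role e).2 ≠ v) :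
    ((settlement m a role).deleteVerts {v}).Adj (roleEnds m role e).1 (roleEnds m role e).2 :=
  ⟨e, by
    rw [Graph.deleteVerts_isLink]
    exact ⟨hv.isLink_iff.2 ⟨he, .inl rfl⟩, h1, h2⟩⟩

theorem reflTransGen_adj_symm {α β : Type*} {G : Graph α β} {x y : α}
    (h : Relation.ReflTransGen G.Adj x y) : Relation.ReflTransGen G.Adj y x := by
  induction h with
  | refl => exact .refl
  | tail _ h ih => exact .head h.symm ih

theorem houseVertex_injOn {h j k : ℕ} (hh : 1 ≤ h) (hj : 1 ≤ j ∧ j ≤ 7) (hk : 1 ≤ k ∧ k ≤ 7)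
    (hjk : houseVertex h j = houseVertex h k) : j = k := by
  unfold houseVertex at hjk
  split_ifs at hjk <;> simp at hjk <;> omega

theorem Role.HasHouse.hasWall {r : Role} (hr : r.HasHouse) {k : ℕ} :
    r.HasWall k ↔ 1 ≤ k ∧ k ≤ 6 := by
  cases r <;> simp_all [Role.HasHouse, Role.HasWall]

theorem Role.HasHouse.wallEnds {r : Role} (hr : r.HasHouse) (h k : ℕ) :
    r.wallEnds h k = (houseVertex h k, houseVertex h (k + 1)) := by
  cases r <;> simp_all [Role.HasHouse, Role.wallEnds]

theorem Role.HasHouse.hasClaw {r : Role} (hr : r.HasHouse) : r.HasClaw 1 ∧ r.HasClaw 3 := by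
  cases r <;> simp_all [Role.HasHouse, Role.HasClaw]

theorem Role.HasHouse.clawEnds {r : Role} (hr : r.HasHouse) (h : ℕ) :
    r.clawEnds h 1 = (.inhabitant h, houseVertex h 2) ∧
      r.clawEnds h 3 = (.inhabitant h, houseVertex h 6) := by
  cases r <;> simp_all [Role.HasHouse, Role.clawEnds]

/-- Everything hangs on the wheel at two places: the walls at both ends, an inhabitant at v_2 and
v_6, and a shared vertex at two vertices of the rim. One deleted vertex cannot destroy both. -/
theorem Valid.connected_deleteVerts (hv : Valid m a role) (v : Vertex) :
    Connected ((settlement m a role).deleteVerts {v}) := by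
  classical
  have ha := hv.one_le
  have hm := hv.le
  -- If the centre itself is deleted, the rim without its closing edge still connects the surface.
  let root : Vertex := if v = .centre then .surface 1 else .centre
  have hroot : IsVertex m a role root ∧ root ≠ v := by
    simp only [root]
    split_ifs with h <;> simp [IsVertex, h]
    · omega
    · exact fun h' => h h'.symm
  let R := Relation.ReflTransGen ((settlement m a role).deleteVerts {v}).Adj
  have surf : ∀ j, 1 ≤ j → j ≤ 4 * m → Vertex.surface j ≠ v → R (.surface j) root := by
    intro j h1 h2 h3
    simp only [root]
    split_ifs with h
    · subst h
      induction j, h1 using Nat.le_induction with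
      | base => exact .refl
      | succ j hj ih =>
        refine .head ?_ (ih (by omega) (by simp))
        have := hv.adj_deleteVerts (v := .centre) (e := .rim j) (by simp [IsEdge]; omega)
          (by simp [roleEnds]) (by simp [roleEnds])
        have h4 : j ≠ 4 * m := by omega
        simp only [roleEnds, h4, if_false] at this
        exact this.symm
    · have := hv.adj_deleteVerts (v := v) (e := .spoke j) (by simp [IsEdge]; omega)
        (Ne.symm h) h3
      exact .single this.symm
  have left : ∀ h, IsSite a h → (role h).HasHouse → ∀ k, 1 ≤ k → k ≤ 7 →
      (∀ k', 1 ≤ k' → k' ≤ k → houseVertex h k' ≠ v) → R (houseVertex h k) root := by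
    intro h hs hr k h1
    have hs' := hs
    unfold IsSite at hs'
    induction k, h1 using Nat.le_induction with
    | base =>
      intro _ h3
      have := h3 1 le_rfl le_rfl
      exact surf _ (by omega) (by omega) this
    | succ k hk ih =>
      intro h2 h3
      refine .head ?_ (ih (by omega) fun k' hk' hk'' => h3 k' hk' (by omega))
      have := hv.adj_deleteVerts (v := v) (e := .wall h k)
      simp only [IsEdge, roleEnds, hs, hr.wallEnds, hr.hasWall] at this
      exact (this (by simp; omega) (h3 _ (by omega) (by omega)) (h3 _ (by omega) (by omega))).symm
  have right : ∀ h, IsSite a h → (role h).HasHouse → ∀ k, k ≤ 6 →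
      (∀ k', 7 - k ≤ k' → k' ≤ 7 → houseVertex h k' ≠ v) → R (houseVertex h (7 - k)) root := by
    intro h hs hr k
    have hs' := hs
    unfold IsSite at hs'
    induction k with
    | zero =>
      intro _ h3
      have := h3 7 le_rfl le_rfl
      exact surf _ (by omega) (by omega) this
    | succ k ih =>
      intro h2 h3
      refine .head ?_ (ih (by omega) fun k' hk' hk'' => h3 k' (by omega) hk'')
      have := hv.adj_deleteVerts (v := v) (e := .wall h (7 - (k + 1)))
      simp only [IsEdge, roleEnds, hs, hr.wallEnds, hr.hasWall] at this
      rw [show 7 - (k + 1) + 1 = 7 - k by omega] at this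
      exact this (by simp; omega) (h3 _ (by omega) (by omega)) (h3 _ (by omega) (by omega))
  -- Either no deleted vertex occurs up to v_j, or none occurs from v_k onwards, unless j = k and
  -- this very vertex is deleted.
  have house : ∀ h, IsSite a h → (role h).HasHouse → ∀ j k, 1 ≤ j → j ≤ k → k ≤ 7 →
      (j = k → houseVertex h k ≠ v) →
      R (houseVertex h j) root ∧ houseVertex h j ≠ v ∨
      R (houseVertex h k) root ∧ houseVertex h k ≠ v := by
    intro h hs hr j k hj hjk hk hne
    have hs' := hs
    unfold IsSite at hs'
    by_cases h1 : ∀ k', 1 ≤ k' → k' ≤ j → houseVertex h k' ≠ v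
    · exact .inl ⟨left h hs hr j hj (by omega) h1, h1 j hj le_rfl⟩
    · by_cases h2 : ∀ k', k ≤ k' → k' ≤ 7 → houseVertex h k' ≠ v
      · have := right h hs hr (7 - k) (by omega)
        rw [show 7 - (7 - k) = k by omega] at this
        exact .inr ⟨this h2, h2 k le_rfl hk⟩
      · push Not at h1 h2
        obtain ⟨k1, h3, h4, h5⟩ := h1
        obtain ⟨k2, h6, h7, h8⟩ := h2
        have := houseVertex_injOn (h := h) (by omega) ⟨h3, by omega⟩ ⟨by omega, h7⟩ (h5.trans h8.symm)
        exact absurd ((by rw [show k = k1 by omega]; exact h5 : houseVertex h k = v)) (hne (by omega))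
  have all : ∀ x, IsVertex m a role x → x ≠ v → R x root := by
    intro x hx hxv
    cases x with
    | centre =>
      simp only [root]
      rw [if_neg (Ne.symm hxv)]
    | surface j => exact surf j hx.1 hx.2 hxv
    | house h k =>
      obtain ⟨hs, hr, h1, h2⟩ := hx
      have h3 : houseVertex h k = .house h k := by
        unfold houseVertex; rw [if_neg (by omega), if_neg (by omega)]
      rw [← h3] at hxv ⊢
      obtain h4 | h4 := house h hs hr k k (by omega) le_rfl (by omega) fun _ => hxv
      · exact h4.1
      · exact h4.1
    | inhabitant h =>
      obtain ⟨hs, hr⟩ := hx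
      have h1 := hv.adj_deleteVerts (v := v) (e := .claw h 1)
      have h2 := hv.adj_deleteVerts (v := v) (e := .claw h 3)
      simp only [IsEdge, roleEnds, hs, hr.hasClaw, hr.clawEnds] at h1 h2
      obtain h4 | h4 := house h hs hr 2 6 (by omega) (by omega) (by omega) (by omega)
      · exact .head (h1 (by simp) hxv h4.2) h4.1
      · exact .head (h2 (by simp) hxv h4.2) h4.1
    | extra h =>
      obtain ⟨hs, hr⟩ := hx
      obtain ⟨hs', hr'⟩ := hv.right_of_left h hs hr
      have hs1 := hs
      have hs2 := hs'
      unfold IsSite at hs1 hs2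
      have h1 := hv.adj_deleteVerts (v := v) (e := .extra (3 * h + 2))
      have h2 := hv.adj_deleteVerts (v := v) (e := .extra (3 * (h + 1) + 2))
      simp only [IsEdge, roleEnds, hs, hs', hr, hr', three_mul_div, Role.HasExtra,
        Role.extraEnds, Nat.add_sub_cancel] at h1 h2
      by_cases h3 : Vertex.surface (4 * h - 1) = v
      · have h4 : Vertex.surface (4 * (h + 1) - 3) ≠ v := by
          rw [← h3]; simp; omega
        exact .head (h2 (by simp) h4 hxv).symm (surf _ (by omega) (by omega) h4)
      · exact .head (h1 (by simp) h3 hxv).symm (surf _ (by omega) (by omega) h3)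
  refine ⟨⟨root, hroot.1, hroot.2⟩, ?_⟩
  rintro x ⟨hx, hxv⟩ y ⟨hy, hyv⟩
  exact (all x hx hxv).trans (reflTransGen_adj_symm (all y hy hyv))

theorem Valid.connected (hv : Valid m a role) : Connected (settlement m a role) := by
  have ha := hv.one_le
  -- `extra 0` is not a vertex because sites start at `a ≥ 1`, so nothing is deleted.
  have h1 := hv.connected_deleteVerts (.extra 0)
  have h2 : ∀ x, IsVertex m a role x → x ∈ V((settlement m a role).deleteVerts {.extra 0}) := by
    intro x hx
    refine ⟨hx, ?_⟩
    rintro rfl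
    have := hx.1.1
    omega
  refine ⟨⟨.centre, trivial⟩, fun x hx y hy => ?_⟩
  refine (h1.2 x (h2 x hx) y (h2 y hy)).lift id ?_
  rintro u v ⟨e, h⟩
  exact ⟨e, ((Graph.deleteVerts_isLink _ _).1 h).1⟩

theorem Valid.twoConnected (hv : Valid m a role) : TwoConnected (settlement m a role) where
  loopless := hv.loopless
  three_le := by
    have ha := hv.one_le
    have hm := hv.le
    have h1 : ({.centre, .surface 1, .surface 2} : Set Vertex) ⊆ V(settlement m a role) := by
      rintro x (rfl | rfl | rfl)
      · trivial
      · exact ⟨by omega, by omega⟩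
      · exact ⟨by omega, by omega⟩
    refine le_trans ?_ (Set.encard_le_encard h1)
    rw [Set.encard_insert_of_notMem (by simp), Set.encard_pair (by simp)]
    norm_num
  connected := hv.connected
  delete v _ := hv.connected_deleteVerts v

theorem Valid.degree_eq (hv : Valid m a role) (x : Vertex) :
    degree (settlement m a role) x = (rotator m a role (fun _ => true) x).length := by
  classical
  unfold degree
  rw [← List.toFinset_card_of_nodup (hv.nodup_rotator (b := fun _ => true) x),
    ← Set.ncard_coe_finset]
  congr 1
  ext e
  simp [hv.mem_rotator_iff]

theorem Valid.degree_lt (hv : Valid m a role) {x : Vertex} (hx : x ≠ .centre) :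
    degree (settlement m a role) x < degree (settlement m a role) .centre := by
  have ha := hv.one_le
  have hm := hv.le
  rw [hv.degree_eq, hv.degree_eq]
  have h1 : (rotator m a role (fun _ => true) .centre).length = 4 * m := by simp [rotator]
  -- The centre has degree 4m, and m ≥ 3.
  suffices (rotator m a role (fun _ => true) x).length ≤ 5 by omega
  cases x with
  | centre => exact absurd rfl hx
  | surface j =>
    have h2 : (up a role (fun _ => true) j).length ≤ 2 := by
      unfold up
      split_ifs <;> cases role ((j + 3) / 4) <;>
        simp [Role.upFirst, Role.upSecond, Role.upThird]
    simp only [rotator]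
    split_ifs <;> simp
    omega
  | house h k =>
    rw [rotator_house]
    split_ifs
    · by_cases hk : k = 2 ∨ k = 3 ∨ k = 4 ∨ k = 5 ∨ k = 6
      · cases hr : role h <;> obtain rfl | rfl | rfl | rfl | rfl := hk <;>
        simp [Role.houseRot]
      · simp only [not_or] at hk
        cases hr : role h <;> simp [Role.houseRot, hk]
    · simp
  | inhabitant h =>
    rw [rotator_inhabitant]
    split_ifs
    · cases role h <;> simp [Role.inhabitantRot]
    · simp
  | extra h =>
    rw [rotator_extra]
    split_ifs
    · cases role h <;> simp [Role.extraRot]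
    · simp

end TemporalGraph

namespace TemporalGraph
open scoped Graph

variable {m a : ℕ} {role : ℕ → Role} {b : ℕ → Bool}

/-! ### Counting -/

namespace Role

def edges (h : ℕ) (r : Role) : List Edge :=
  match r with
  | flat => [.claw h 1, .wall h 2]
  | _ => [.wall h 1, .wall h 2, .wall h 3, .wall h 4, .wall h 5, .wall h 6, .claw h 1, .claw h 3] ++
    match r with
    | plain => [.claw h 2]
    | spike => [.claw h 2]
    | left => [.extra (3 * h), .extra (3 * h + 1), .extra (3 * h + 2)]
    | right => [.extra (3 * h), .extra (3 * h + 1), .extra (3 * h + 2)]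
    | _ => []

def vertices (h : ℕ) (r : Role) : List Vertex :=
  match r with
  | flat => []
  | _ => [.house h 2, .house h 3, .house h 4, .house h 5, .house h 6, .inhabitant h] ++
    match r with
    | left => [.extra h]
    | _ => []

def faceNumbers : Role → List ℕ
  | plain => [0, 1, 2]
  | spike => [0, 1, 3]
  | left => [0, 1, 3, 4, 5]
  | right => [0, 1, 3, 4]
  | _ => [0, 1]

end Role

def edgeList (m a : ℕ) (role : ℕ → Role) : List Edge :=
  (List.range (4 * m)).map (fun j => .spoke (j + 1)) ++
    ((List.range (4 * m)).map (fun j => .rim (j + 1)) ++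
      ([a, a + 1, a + 2].flatMap fun h => (role h).edges h))

def vertexList (m a : ℕ) (role : ℕ → Role) : List Vertex :=
  .centre :: ((List.range (4 * m)).map (fun j => .surface (j + 1)) ++
    ([a, a + 1, a + 2].flatMap fun h => (role h).vertices h))

def faceList (m a : ℕ) (role : ℕ → Role) : List Face :=
  .outer :: ((List.range (4 * m)).map (fun j => .tri (j + 1)) ++
    ([a, a + 1, a + 2].flatMap fun h => (role h).faceNumbers.map fun t => .loc h t))

theorem isSite_iff_mem {h : ℕ} : IsSite a h ↔ h ∈ [a, a + 1, a + 2] := by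
  simp only [IsSite, List.mem_cons, List.not_mem_nil, or_false]
  omega

theorem mem_range_map {α : Type*} {n : ℕ} {f : ℕ → α} {j : ℕ} (h1 : 1 ≤ j) (h2 : j ≤ n) :
    f j ∈ (List.range n).map fun j => f (j + 1) := by
  rw [List.mem_map]
  exact ⟨j - 1, by rw [List.mem_range]; omega, by rw [Nat.sub_add_cancel h1]⟩

theorem mem_edgeList {e : Edge} (he : IsEdge m a role e) : e ∈ edgeList m a role := by
  simp only [edgeList, List.mem_append]
  have site : ∀ h, IsSite a h → e ∈ (role h).edges h →
      e ∈ [a, a + 1, a + 2].flatMap fun h => (role h).edges h := fun h hs hh =>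
    List.mem_flatMap.2 ⟨h, isSite_iff_mem.1 hs, hh⟩
  cases e with
  | spoke j => exact .inl (mem_range_map he.1 he.2)
  | rim j => exact .inr (.inl (mem_range_map he.1 he.2))
  | wall h k =>
    obtain ⟨hs, hk⟩ := he
    refine .inr (.inr (site h hs ?_))
    cases hr : role h <;> simp [hr, Role.HasWall] at hk <;> simp [Role.edges] <;> omega
  | claw h k =>
    obtain ⟨hs, hk⟩ := he
    refine .inr (.inr (site h hs ?_))
    cases hr : role h <;> simp [hr, Role.HasClaw] at hk <;> simp [Role.edges] <;> omega
  | extra n =>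
    obtain ⟨hs, hk⟩ := he
    refine .inr (.inr (site _ hs ?_))
    cases hr : role (n / 3) <;> simp [hr, Role.HasExtra] at hk <;> simp [Role.edges] <;> omega

theorem isVertex_of_mem_vertexList {x : Vertex} (hx : x ∈ vertexList m a role) :
    IsVertex m a role x := by
  simp only [vertexList, List.mem_cons, List.mem_append, List.mem_map, List.mem_range,
    List.mem_flatMap] at hx
  obtain rfl | ⟨j, hj, rfl⟩ | ⟨h, hs, hx⟩ := hx
  · trivial
  · exact ⟨by omega, by omega⟩
  · have hs' : IsSite a h := isSite_iff_mem.2 (by simpa using hs)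
    cases hr : role h <;> rw [hr] at hx <;> simp [Role.vertices] at hx <;>
    (try obtain rfl | rfl | rfl | rfl | rfl | rfl | rfl := hx) <;>
    (try obtain rfl | rfl | rfl | rfl | rfl | rfl := hx) <;>
    simp [IsVertex, hs', hr, Role.HasHouse]

theorem mem_vertexList {x : Vertex} (hx : IsVertex m a role x) : x ∈ vertexList m a role := by
  simp only [vertexList, List.mem_append, List.mem_cons (a := x)]
  have site : ∀ h, IsSite a h → x ∈ (role h).vertices h →
      x ∈ [a, a + 1, a + 2].flatMap fun h => (role h).vertices h := fun h hs hh =>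
    List.mem_flatMap.2 ⟨h, isSite_iff_mem.1 hs, hh⟩
  cases x with
  | centre => exact .inl rfl
  | surface j => exact .inr (.inl (mem_range_map hx.1 hx.2))
  | house h k =>
    obtain ⟨hs, hr, hk⟩ := hx
    refine .inr (.inr (site h hs ?_))
    cases hr' : role h <;> simp [hr', Role.HasHouse] at hr <;> simp [Role.vertices] <;> omega
  | inhabitant h =>
    obtain ⟨hs, hr⟩ := hx
    refine .inr (.inr (site h hs ?_))
    cases hr' : role h <;> simp [hr', Role.HasHouse] at hr <;> simp [Role.vertices]
  | extra h =>
    obtain ⟨hs, hr⟩ := hx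
    refine .inr (.inr (site h hs ?_))
    simp [Role.vertices, hr]

theorem nodup_vertexList : (vertexList m a role).Nodup := by
  have h1 : ([a, a + 1, a + 2].flatMap fun h => (role h).vertices h).Nodup := by
    rw [List.nodup_flatMap]
    refine ⟨fun h _ => by cases role h <;> simp [Role.vertices], ?_⟩
    have : ∀ h h', h ≠ h' → List.Disjoint ((role h).vertices h) ((role h').vertices h') := by
      intro h h' hne x hx hx'
      cases hr : role h <;> cases hr' : role h' <;> rw [hr] at hx <;> rw [hr'] at hx' <;>
      simp [Role.vertices] at hx hx' <;> grind
    simp [List.pairwise_cons, Function.onFun, this]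
  have h2 : ∀ x ∈ [a, a + 1, a + 2].flatMap fun h => (role h).vertices h,
      x ≠ .centre ∧ ∀ j, x ≠ .surface j := by
    intro x hx
    obtain ⟨h, -, hx⟩ := List.mem_flatMap.1 hx
    cases hr : role h <;> rw [hr] at hx <;> simp [Role.vertices] at hx <;> grind
  refine List.nodup_cons.2 ⟨?_, ?_⟩
  · intro h
    obtain h | h := List.mem_append.1 h
    · simp at h
    · exact (h2 _ h).1 rfl
  · refine List.nodup_append.2 ⟨List.nodup_range.map fun x y h => by simpa using h, h1, ?_⟩
    rintro x hx y hy rfl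
    obtain ⟨j, -, rfl⟩ := List.mem_map.1 hx
    exact (h2 _ hy).2 _ rfl

theorem nodup_faceList : (faceList m a role).Nodup := by
  have h1 : ([a, a + 1, a + 2].flatMap fun h =>
      (role h).faceNumbers.map fun t => Face.loc h t).Nodup := by
    rw [List.nodup_flatMap]
    refine ⟨fun h _ => List.Nodup.map (fun x y h => by simpa using h)
      (by cases role h <;> simp [Role.faceNumbers]), ?_⟩
    have : ∀ h h', h ≠ h' → List.Disjoint ((role h).faceNumbers.map fun t => Face.loc h t)
        ((role h').faceNumbers.map fun t => Face.loc h' t) := by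
      intro h h' hne x hx hx'
      obtain ⟨_, -, rfl⟩ := List.mem_map.1 hx
      obtain ⟨_, -, h2⟩ := List.mem_map.1 hx'
      simp only [Face.loc.injEq] at h2
      exact hne h2.1.symm
    simp [List.pairwise_cons, Function.onFun, this]
  refine List.nodup_cons.2 ⟨?_, ?_⟩
  · simp
  · refine List.nodup_append.2 ⟨List.nodup_range.map fun x y h => by simpa using h, h1, ?_⟩
    rintro x hx y hy rfl
    obtain ⟨j, -, rfl⟩ := List.mem_map.1 hx
    simp at hy

theorem edgeSet_finite (hv : Valid m a role) : E(settlement m a role).Finite :=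
  (List.finite_toSet (edgeList m a role)).subset fun _ he => mem_edgeList (hv.mem_edgeSet_iff.1 he)

theorem vertexSet_finite : V(settlement m a role).Finite :=
  (List.finite_toSet (vertexList m a role)).subset fun _ => mem_vertexList

/-- For the edges an upper bound suffices, since the lower bound implicit in Euler's formula holds
for every rotation system. -/
theorem ncard_edgeSet_le (hv : Valid m a role) :
    E(settlement m a role).ncard ≤ (edgeList m a role).length := by
  classical
  refine le_trans (Set.ncard_le_ncard (t := ((edgeList m a role).toFinset : Set Edge)) ?_ ?_) ?_
  · intro e he
    simpa using mem_edgeList (hv.mem_edgeSet_iff.1 he)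
  · exact Finset.finite_toSet _
  · rw [Set.ncard_coe_finset]
    exact List.toFinset_card_le _

theorem ncard_vertexSet : V(settlement m a role).ncard = (vertexList m a role).length := by
  classical
  rw [← List.toFinset_card_of_nodup nodup_vertexList, ← Set.ncard_coe_finset]
  congr 1
  ext x
  simp only [List.coe_toFinset, Set.mem_ofPred_eq]
  exact ⟨mem_vertexList, isVertex_of_mem_vertexList⟩

/-- The excess of a role in the count of edges, vertices and faces. -/
def Role.excess : Role → ℤ
  | left => -1
  | right => 1
  | _ => 0

/-- Euler's formula is checked house by house: the planet alone satisfies it, and every role adds as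
many edges as vertices and faces, up to an excess that cancels within a pair. -/
theorem Role.length_edges (h : ℕ) (r : Role) : ((r.edges h).length : ℤ) =
    (r.vertices h).length + r.faceNumbers.length + r.excess := by
  cases r <;> simp [Role.edges, Role.vertices, Role.faceNumbers, Role.excess]

theorem Valid.excess_le (hv : Valid m a role) :
    (role a).excess + (role (a + 1)).excess + (role (a + 2)).excess ≤ 0 := by
  have ha := hv.one_le
  have h1 : role a = .left → role (a + 1) = .right := fun h =>
    (hv.right_of_left a ⟨by omega, by omega⟩ h).2
  have h3 : role a ≠ .right := fun h => by
    have := (hv.left_of_right a ⟨by omega, by omega⟩ h).1.1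
    omega
  have h4 : role (a + 1) = .right → role a = .left := fun h =>
    (hv.left_of_right (a + 1) ⟨by omega, by omega⟩ h).2
  have h5 : role (a + 2) = .right → role (a + 1) = .left := fun h =>
    (hv.left_of_right (a + 2) ⟨by omega, by omega⟩ h).2
  generalize role a = r1 at *
  generalize role (a + 1) = r2 at *
  generalize role (a + 2) = r3 at *
  clear hv ha
  revert h1 h3 h4 h5
  cases r1 <;> cases r2 <;> cases r3 <;> simp [Role.excess]

theorem Valid.length_le (hv : Valid m a role) :
    (edgeList m a role).length + 2 ≤
      (vertexList m a role).length + (faceList m a role).length := by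
  have h1 := hv.excess_le
  have h2 := (role a).length_edges a
  have h3 := (role (a + 1)).length_edges (a + 1)
  have h4 := (role (a + 2)).length_edges (a + 2)
  simp only [edgeList, vertexList, faceList, List.length_append, List.length_cons,
    List.length_map, List.length_range, List.flatMap_cons, List.flatMap_nil, List.length_nil]
  omega

theorem Valid.size_le (hv : Valid m a role) :
    V(settlement m a role).ncard + E(settlement m a role).ncard ≤ 12 * m + 55 := by
  have h1 : ∀ h, ((role h).edges h).length ≤ 11 ∧ ((role h).vertices h).length ≤ 7 := by
    intro h
    cases role h <;> simp [Role.edges, Role.vertices]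
  have h2 := h1 a
  have h3 := h1 (a + 1)
  have h4 := h1 (a + 2)
  refine (Nat.add_le_add ncard_vertexSet.le (ncard_edgeSet_le hv)).trans ?_
  simp only [edgeList, vertexList, List.length_append, List.length_cons,
    List.length_map, List.length_range, List.flatMap_cons, List.flatMap_nil, List.length_nil]
  omega

/-! ### Planarity -/

/-- The embedding in which the bits `b` tell which inhabitants are inside. -/
noncomputable def embedding (m a : ℕ) (role : ℕ → Role) (b : ℕ → Bool) (x : Vertex) :
    Equiv.Perm Edge :=
  open scoped Classical in (rotator m a role b x).formPerm

theorem Valid.exists_dart (hv : Valid m a role)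
    (hb : ∀ h, IsSite a h → role h = .spike → b h = true) {k : Face}
    (hk : k ∈ faceList m a role) :
    ∃ x e, (settlement m a role).Inc e x ∧ dartFace m a role b x e = k := by
  have ha := hv.one_le
  have hm := hv.le
  have key : ∀ e, IsEdge m a role e → (edgeFaces m a role b e).1 = k ∨
      (edgeFaces m a role b e).2 = k →
      ∃ x e, (settlement m a role).Inc e x ∧ dartFace m a role b x e = k := by
    rintro e he (h | h)
    · exact ⟨_, e, hv.inc_iff.2 ⟨he, .inl rfl⟩, by simp [dartFace, h]⟩
    · exact ⟨_, e, hv.inc_iff.2 ⟨he, .inr rfl⟩, by simp [dartFace, h, (hv.isVertex_ends he).2.2]⟩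
  simp only [faceList, List.mem_cons (a := k), List.mem_append, List.mem_map, List.mem_range,
    List.mem_flatMap] at hk
  obtain rfl | ⟨j, hj, rfl⟩ | ⟨h, hs, t, ht, rfl⟩ := hk
  · have hs : IsSite a a := ⟨le_rfl, by omega⟩
    -- Candidates for an edge on the outer face; which of them works depends on the role and the
    -- bit.
    have h1 := key (.claw a 1)
    have h2 := key (.wall a 1)
    have h3 := key (.wall a 2)
    have h4 := key (.extra (3 * a + 1))
    have h5 := key (.wall a 6)
    simp only [IsEdge, hs, edgeFaces, three_mul_div] at h1 h2 h3 h4 h5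
    cases hr : role a <;> cases hbb : b a <;>
      simp [hr, hbb, Role.HasClaw, Role.HasWall, Role.HasExtra, Role.wallFaces, Role.clawFaces,
        Role.extraFaces] at h1 h2 h3 h4 h5 <;> assumption
  · exact key (.rim (j + 1)) ⟨by omega, by omega⟩ (by simp [edgeFaces])
  · have hs' : IsSite a h := isSite_iff_mem.2 (by simpa using hs)
    have hb' := hb h hs'
    have h1 := key (.claw h 1)
    have h2 := key (.wall h 1)
    have h3 := key (.wall h 2)
    have h4 := key (.extra (3 * h + 1))
    have h5 := key (.wall h 6)
    have h6 := key (.claw h 2)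
    have h7 := key (.extra (3 * h + 2))
    have h8 := key (.rim (4 * h - 2))
    have h9 : (4 * h - 2 + 3) / 4 = h := by have := hs'.1; omega
    have h10 : (4 * h - 2) % 4 = 2 := by have := hs'.1; omega
    have h11 : 1 ≤ 4 * h - 2 ∧ 4 * h - 2 ≤ 4 * m := by have := hs'.1; have := hs'.2; omega
    simp only [IsEdge, hs', edgeFaces, three_mul_div, rimFace, h9, h10, h11] at h1 h2 h3 h4 h5 h6 h7 h8
    clear key hb hs h9 h10
    cases hr : role h <;> rw [hr] at ht hb' <;> simp [Role.faceNumbers] at ht <;>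
      cases hbb : b h <;> (try simp [hbb] at hb') <;>
      simp [hr, hbb, Role.HasClaw, Role.HasWall, Role.HasExtra, Role.wallFaces, Role.clawFaces,
        Role.extraFaces, Role.under, Role.above, Role.rimFace, Role.midSecond]
        at h1 h2 h3 h4 h5 h6 h7 h8 <;>
      (try obtain rfl | rfl | rfl | rfl | rfl := ht) <;>
      (try obtain rfl | rfl | rfl | rfl := ht) <;>
      (try obtain rfl | rfl | rfl := ht) <;> (try obtain rfl | rfl := ht) <;>
      simp at h1 h2 h3 h4 h5 h6 h7 h8 <;> assumption

theorem Valid.isPlaneEmbedding (hv : Valid m a role)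
    (hb : ∀ h, IsSite a h → role h = .spike → b h = true) :
    IsPlaneEmbedding (settlement m a role) (embedding m a role b) := by
  classical
  have ha := hv.one_le
  have hm := hv.le
  refine isPlaneEmbedding_of_labels vertexSet_finite (edgeSet_finite hv)
    ⟨.spoke 1, hv.mem_edgeSet_iff.2 ⟨le_rfl, by omega⟩⟩ hv.connected hv.loopless hv.nodup_rotator
    (fun v e => hv.mem_rotator_iff) (dartFace m a role b) (dartFaceRev m a role b)
    (fun e u v h => hv.dartFaceRev_eq h) (hv.map_dartFace hb) (faceList m a role).toFinset
    (fun k hk => hv.exists_dart hb (List.mem_toFinset.1 hk)) ?_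
  rw [List.toFinset_card_of_nodup nodup_faceList, ncard_vertexSet]
  exact (Nat.add_le_add_right (ncard_edgeSet_le hv) 2).trans hv.length_le

end TemporalGraph

namespace TemporalGraph
open scoped Graph

variable {m a : ℕ} {role : ℕ → Role} {b : ℕ → Bool}

/-! ### Planets, villages and arches -/

theorem isEdge_of_mem_planet {e : Edge} (he : e ∈ E(planet m)) :
    ∃ j ∈ Set.Icc 1 (4 * m), e = .spoke j ∨ e = .rim j := by
  obtain ⟨x, y, h⟩ := Graph.exists_isLink_of_mem_edgeSet he
  exact h.1

theorem planet_le_settlement : planet m ≤ settlement m a role where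
  vertexSet_mono := by
    rintro x (rfl | ⟨j, hj, rfl⟩)
    · trivial
    · exact hj
  isLink_mono := by
    rintro e x y ⟨⟨j, hj, he⟩, hx, hy, hl⟩
    have hV : ∀ x ∈ V(planet m), IsVertex m a role x := by
      rintro x (rfl | ⟨j, hj, rfl⟩)
      · trivial
      · exact hj
    refine ⟨?_, hV x hx, hV y hy, ?_⟩
    · obtain rfl | rfl := he <;> exact hj
    · obtain rfl | rfl := he <;> exact hl

theorem mem_planet_iff {e : Edge} : e ∈ E(planet m) ↔
    ∃ j ∈ Set.Icc 1 (4 * m), e = .spoke j ∨ e = .rim j := by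
  refine ⟨isEdge_of_mem_planet, ?_⟩
  rintro ⟨j, hj, h⟩
  have h2 : Vertex.surface (if j = 4 * m then 1 else j + 1) ∈ V(planet m) := by
    refine .inr ⟨_, ?_, rfl⟩
    simp only [Set.mem_Icc] at hj ⊢
    split_ifs <;> omega
  obtain rfl | rfl := h
  · exact (show (planet m).IsLink (.spoke j) .centre (.surface j) from
      ⟨⟨j, hj, .inl rfl⟩, .inl rfl, .inr ⟨j, hj, rfl⟩, .inl rfl⟩).edge_mem
  · exact (show (planet m).IsLink (.rim j) (.surface j)
      (.surface (if j = 4 * m then 1 else j + 1)) from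
      ⟨⟨j, hj, .inr rfl⟩, .inr ⟨j, hj, rfl⟩, h2, .inl rfl⟩).edge_mem

theorem valid_const (ha : 1 ≤ a) (hm : a + 2 ≤ m) {r : Role} (hl : r ≠ .left) (hr : r ≠ .right) :
    Valid m a fun _ => r where
  one_le := ha
  le := hm
  right_of_left _ _ h := absurd h hl
  left_of_right _ _ h := absurd h hr

theorem village_eq (hm : a + 2 ≤ m) :
    village m {a, a + 1, a + 2} = settlement m a fun _ => .plain := by
  have hI : ∀ h, h ∈ ({a, a + 1, a + 2} : Finset ℕ) ↔ IsSite a h := by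
    intro h
    simp only [IsSite, Finset.mem_insert, Finset.mem_singleton]
    omega
  have hV : ∀ x, x ∈ V(village m {a, a + 1, a + 2}) ↔ IsVertex m a (fun _ => .plain) x := by
    intro x
    change ((x = _ ∨ _) ∨ _) ↔ _
    simp only [Set.mem_ofPred_eq, hI]
    cases x <;> simp [IsVertex, Role.HasHouse]
  have hE : ∀ e, (e ∈ (E(planet m) ∪ {e | ∃ i ∈ ({a, a + 1, a + 2} : Finset ℕ),
      (∃ k ∈ Set.Icc 1 6, e = .wall i k) ∨ ∃ k ∈ Set.Icc 1 3, e = .claw i k})) ↔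
      IsEdge m a (fun _ => .plain) e := by
    intro e
    rw [Set.mem_union, mem_planet_iff, Set.mem_ofPred_eq]
    simp only [hI]
    cases e <;> simp [IsEdge, Role.HasWall, Role.HasClaw, Role.HasExtra]
  refine Graph.ext (Set.ext hV) ?_
  intro e x y
  change (_ ∧ x ∈ V(village m {a, a + 1, a + 2}) ∧ y ∈ V(village m {a, a + 1, a + 2}) ∧ _) ↔
    (_ ∧ _)
  rw [hE, hV, hV]
  refine and_congr_right fun he => ?_
  have : ends m e = roleEnds m (fun _ => .plain) e := by
    cases e <;> simp [IsEdge, Role.HasExtra] at he <;> rfl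
  rw [this]

/-- The first house of the block of houses that contains the `h`-th one. -/
def blockOf (role : ℕ → Role) (h : ℕ) : ℕ := match role h with
  | .right => h - 1
  | _ => h

/-- The vertices of a block of houses. -/
def InBlock (a : ℕ) (role : ℕ → Role) (β : ℕ) : Vertex → Prop
  | .centre => False
  | .surface j => IsSite a ((j + 3) / 4) ∧ blockOf role ((j + 3) / 4) = β
  | .house h _ => blockOf role h = β
  | .inhabitant h => blockOf role h = β
  | .extra h => h = β

theorem InBlock.unique {β β' : ℕ} {x : Vertex} (h : InBlock a role β x)
    (h' : InBlock a role β' x) : β = β' := by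
  cases x
  · exact h.elim
  · exact h.2.symm.trans h'.2
  all_goals exact Eq.trans (Eq.symm h) h'

/-- Blocks are chosen so that only planet edges can leave them: a right house is put into the block
of its left neighbour, together with the shared vertex. -/
theorem Valid.exists_inBlock (hv : Valid m a role) {e : Edge} {x y : Vertex}
    (he : e ∉ E(planet m)) (hl : (settlement m a role).IsLink e x y) :
    ∃ β, InBlock a role β x ∧ InBlock a role β y := by
  have ha := hv.one_le
  suffices h1 : ∃ β, InBlock a role β (roleEnds m role e).1 ∧
      InBlock a role β (roleEnds m role e).2 by
    obtain ⟨-, h2 | h2⟩ := hv.isLink_iff.1 hl <;> rw [h2] at h1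
    · exact h1
    · exact h1.imp fun _ => And.symm
  have h1 := (hv.isLink_iff.1 hl).1
  rw [mem_planet_iff] at he
  have h5 : ∀ h, 1 ≤ h → (4 * h - 3 + 3) / 4 = h ∧ (4 * h - 2 + 3) / 4 = h ∧
      (4 * h - 1 + 3) / 4 = h := by omega
  cases e with
  | spoke j => exact absurd ⟨j, h1, .inl rfl⟩ he
  | rim j => exact absurd ⟨j, h1, .inr rfl⟩ he
  | wall h k =>
    have hs := h1.1
    have h6 := h5 h (ha.trans hs.1)
    refine ⟨blockOf role h, ?_⟩
    cases hr : role h <;> simp [roleEnds, hr, Role.wallEnds, houseVertex] <;> (try split_ifs) <;>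
      simp [InBlock, hs, h6]
  | claw h k =>
    have hs := h1.1
    have h6 := h5 h (ha.trans hs.1)
    refine ⟨blockOf role h, ?_⟩
    cases hr : role h <;> simp [roleEnds, hr, Role.clawEnds, houseVertex] <;> (try split_ifs) <;>
      simp [InBlock, hs, h6]
  | extra n =>
    have hs := h1.1
    have h6 := h5 _ (ha.trans hs.1)
    refine ⟨blockOf role (n / 3), ?_⟩
    have hn : n % 3 = 0 ∨ n % 3 = 1 ∨ n % 3 = 2 := by omega
    have h7 := h1.2
    cases hr : role (n / 3) <;> rw [hr] at h7 <;> (try exact h7.elim) <;>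
      obtain hn | hn | hn := hn <;>
      simp [roleEnds, hr, Role.extraEnds, InBlock, hs, h6, hn] <;> simp [blockOf, hr]

/-- A path without planet edges stays within one block, and two foundations are in the same block
only if they carry the two halves of a pair. -/
theorem Valid.isArch_imp (hv : Valid m a role) {h h' : ℕ} (hh : h ≠ h')
    (hs : IsSite a h) (hs' : IsSite a h') (hA : IsArch m (settlement m a role) h h') :
    ∃ g, IsSite a g ∧ role g = .left ∧ s(h, h') = s(g, g + 1) := by
  have ha := hv.one_le
  obtain ⟨_, ⟨j, hj, rfl⟩, _, ⟨j', hj', rfl⟩, p, -, -, hc⟩ := hA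
  simp only [Set.mem_Icc] at hj hj'
  have h1 : (j + 3) / 4 = h := by have := hs.1; omega
  have h1' : (j' + 3) / 4 = h' := by have := hs'.1; omega
  have key : ∀ (l : List Vertex) (x : Vertex), (x :: l).IsChain
      (fun u v => ∃ e, e ∉ E(planet m) ∧ (settlement m a role).IsLink e u v) →
      ∀ β, InBlock a role β x → ∀ y ∈ l, InBlock a role β y := by
    intro l
    induction l with
    | nil => simp
    | cons z l ih =>
      intro x hc β hx
      rw [List.isChain_cons_cons] at hc
      obtain ⟨⟨e, he, hl⟩, hc⟩ := hc
      obtain ⟨β', h2, h3⟩ := hv.exists_inBlock he hl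
      obtain rfl := hx.unique h2
      rintro y (_ | ⟨_, hy⟩)
      · exact h3
      · exact ih z hc β h3 y hy
  have h2 := key _ _ hc (blockOf role h) (by simp [InBlock, h1, hs]) (.surface j') (by simp)
  have h3 : blockOf role h' = blockOf role h := by simpa [InBlock, h1', hs'] using h2
  have h4 := hs.1
  have h5 := hs'.1
  unfold blockOf at h3
  by_cases hr : role h = .right
  · have h6 := hv.left_of_right h hs hr
    refine ⟨h - 1, h6.1, h6.2, ?_⟩
    have : h' = h - 1 := by
      rw [hr] at h3
      revert h3
      cases hr' : role h' <;> simp only <;> intros <;> first | assumption | omega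
    rw [this, Sym2.eq_swap, Nat.sub_add_cancel (by omega)]
  · have hr' : role h' = .right := by
      revert h3 hr
      cases role h <;> cases role h' <;> simp <;> omega
    have h6 := hv.left_of_right h' hs' hr'
    refine ⟨h' - 1, h6.1, h6.2, ?_⟩
    have : h = h' - 1 := by
      rw [hr'] at h3
      revert h3 hr
      cases role h <;> simp <;> omega
    rw [this, Nat.sub_add_cancel (by omega)]

/-- The path goes through the shared vertex, using its two edges to the rim. -/
theorem Valid.isArch (hv : Valid m a role) {g : ℕ} (hs : IsSite a g) (hr : role g = .left) :
    IsArch m (settlement m a role) g (g + 1) := by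
  have ha := hv.one_le
  obtain ⟨hs', hr'⟩ := hv.right_of_left g hs hr
  have h1 := hs.1
  refine ⟨.surface (4 * g - 1), ⟨_, ⟨by omega, by omega⟩, rfl⟩, .surface (4 * (g + 1) - 3),
    ⟨_, ⟨by omega, by omega⟩, rfl⟩, [.extra g], ?_, ?_, ?_⟩
  · simp
    omega
  · rintro v hv
    rw [List.mem_singleton] at hv
    subst hv
    rintro (h | ⟨j, -, h⟩) <;> simp at h
  · simp only [List.cons_append, List.nil_append, List.isChain_cons_cons, List.isChain_singleton,
      and_true]
    refine ⟨⟨.extra (3 * g + 2), ?_, hv.isLink_iff.2 ⟨?_, .inl ?_⟩⟩,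
      ⟨.extra (3 * (g + 1) + 2), ?_, hv.isLink_iff.2 ⟨?_, .inr ?_⟩⟩⟩
    · simp [mem_planet_iff]
    · simp [IsEdge, three_mul_div, hs, hr, Role.HasExtra]
    · simp [roleEnds, three_mul_div, hr, Role.extraEnds]
    · simp [mem_planet_iff]
    · simp [IsEdge, three_mul_div, hs', hr', Role.HasExtra]
    · simp [roleEnds, three_mul_div, hr', Role.extraEnds]

open scoped Classical in
/-- Two neighbouring houses share an extra vertex, and the others are bare. -/
def pairRole (g h : ℕ) : Role := if h = g then .left else if h = g + 1 then .right else .bare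

theorem pairRole_left {g h : ℕ} : pairRole g h = .left ↔ h = g := by
  unfold pairRole
  split_ifs <;> simp_all

theorem pairRole_right {g h : ℕ} : pairRole g h = .right ↔ h = g + 1 := by
  unfold pairRole
  split_ifs <;> simp_all

theorem valid_pairRole (ha : 1 ≤ a) (hm : a + 2 ≤ m) {g : ℕ} (h1 : a ≤ g) (h2 : g ≤ a + 1) :
    Valid m a (pairRole g) where
  one_le := ha
  le := hm
  right_of_left h hs hl := by
    rw [pairRole_left] at hl
    rw [pairRole_right]
    unfold IsSite at *
    omega
  left_of_right h hs hl := by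
    rw [pairRole_right] at hl
    rw [pairRole_left]
    unfold IsSite at *
    omega

/-- The roles in the graphs of the sequence. -/
noncomputable def stage (a : ℕ) : Fin 9 → ℕ → Role :=
  ![fun _ => .plain, fun _ => .bare, pairRole a, fun _ => .flat, fun _ => .bare, pairRole (a + 1),
    fun _ => .flat, fun _ => .bare, fun _ => .spike]

theorem valid_stage (ha : 1 ≤ a) (hm : a + 2 ≤ m) (k : Fin 9) : Valid m a (stage a k) := by
  match k with
  | 2 => exact valid_pairRole ha hm le_rfl (by omega)
  | 5 => exact valid_pairRole ha hm (by omega) le_rfl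
  | 0 | 1 | 3 | 4 | 6 | 7 | 8 => exact valid_const ha hm (by simp) (by simp)

theorem arches_settlement (ha : 1 ≤ a) (hm : a + 2 ≤ m) :
    arches {a, a + 1, a + 2} m (fun k => settlement m a (stage a k)) =
      {s(a, a + 1), s(a + 1, a + 2)} := by
  have hI : ∀ h, h ∈ ({a, a + 1, a + 2} : Finset ℕ) ↔ IsSite a h := by
    intro h
    simp only [IsSite, Finset.mem_insert, Finset.mem_singleton]
    omega
  ext q
  constructor
  · rintro ⟨h, hs, h', hs', hne, rfl, k, hA⟩
    obtain ⟨g, hg, hr, h1⟩ := (valid_stage ha hm k).isArch_imp hne ((hI h).1 hs) ((hI h').1 hs') hA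
    rw [h1]
    have : g = a ∨ g = a + 1 := by
      obtain ⟨h2, -⟩ := ((valid_stage ha hm k).right_of_left g hg hr)
      unfold IsSite at *
      omega
    obtain rfl | rfl := this
    · exact .inl rfl
    · exact .inr rfl
  · have h1 := (valid_stage ha hm 2).isArch (g := a) ⟨le_rfl, by omega⟩ (pairRole_left.2 rfl)
    have h2 := (valid_stage ha hm 5).isArch (g := a + 1) ⟨by omega, by omega⟩ (pairRole_left.2 rfl)
    rintro (rfl | rfl)
    · exact ⟨a, by simp, a + 1, by simp, by omega, rfl, 2, h1⟩
    · exact ⟨a + 1, by simp, a + 2, by simp, by omega, rfl, 5, h2⟩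

theorem size_settlement_le (ha : 1 ≤ a) (hm : a + 2 ≤ m) :
    size (fun k => settlement m a (stage a k)) ≤ 300 * m := by
  unfold size
  -- Nine graphs of size at most 12m + 55 give 108m + 495, which is at most 300m because m ≥ 3.
  refine (Finset.sum_le_sum fun k _ => (valid_stage ha hm k).size_le).trans ?_
  simp
  omega

end TemporalGraph

namespace TemporalGraph
open scoped Graph

section Deletion

variable {α β : Type*} {G H : Graph α β}

/-! ### Constructing minors and induced embeddings -/

/-- Contracting edges that join vertices to their parents. -/
theorem isMinorVia_of_parent [Nonempty α] {C : Set β} {f par : α → α} {rank : α → ℕ} {edge : α → β}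
    (hE : E(H) ⊆ E(G)) (hCH : Disjoint C E(H))
    (hC : ∀ e ∈ C, ∃ x ∈ V(G), par x ≠ x ∧ edge x = e)
    (hpar : ∀ x ∈ V(G), par x ≠ x →
      edge x ∈ C ∧ G.IsLink (edge x) x (par x) ∧ rank (par x) < rank x)
    (hle : ∀ x, rank (par x) ≤ rank x)
    (hf : ∀ x ∈ V(G), f (par x) = f x) (hroot : ∀ x ∈ V(G), par x = x → f x = x)
    (hlink : ∀ e ∈ E(H), ∀ x y, G.IsLink e x y → H.IsLink e (f x) (f y))
    (hV : V(H) ⊆ f '' V(G)) : IsMinorVia H G C (E(G) \ (C ∪ E(H))) f := by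
  classical
  have hCE : C ⊆ E(G) := by
    intro e he
    obtain ⟨x, hx, h1, rfl⟩ := hC e he
    exact (hpar x hx h1).2.1.edge_mem
  have hdel : ∀ e x y, (G.deleteEdges (C ∪ (E(G) \ (C ∪ E(H))))).IsLink e x y ↔
      G.IsLink e x y ∧ e ∈ E(H) := by
    intro e x y
    rw [Graph.deleteEdges_isLink]
    refine and_congr_right fun h => ?_
    have h1 := h.edge_mem
    have h2 : e ∈ C → e ∉ E(H) := fun h h' => Set.disjoint_left.1 hCH h h'
    simp only [Set.mem_union, Set.mem_sdiff, h1, true_and, not_or, not_and, not_not]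
    tauto
  have hmap : ∀ e u v, ((G.deleteEdges (C ∪ (E(G) \ (C ∪ E(H))))).map f).IsLink e u v ↔
      H.IsLink e u v := by
    intro e u v
    constructor
    · rintro ⟨x, y, h, rfl, rfl⟩
      obtain ⟨h1, h2⟩ := (hdel e x y).1 h
      exact hlink e h2 x y h1
    · intro h
      obtain ⟨x, y, h1⟩ := G.exists_isLink_of_mem_edgeSet (hE h.edge_mem)
      have h2 := hlink e h.edge_mem x y h1
      have h3 := Graph.IsLink.map f ((hdel e x y).2 ⟨h1, h.edge_mem⟩)
      obtain ⟨rfl, rfl⟩ | ⟨rfl, rfl⟩ := h.eq_and_eq_or_eq_and_eq h2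
      · exact h3
      · exact h3.symm
  have hCf : ∀ e ∈ C, ∀ x y, G.IsLink e x y → f x = f y := by
    intro e he x y h
    obtain ⟨z, hz, h1, rfl⟩ := hC e he
    have h2 := hf z hz
    obtain ⟨rfl, rfl⟩ | ⟨rfl, rfl⟩ := h.eq_and_eq_or_eq_and_eq (hpar z hz h1).2.1
    · exact h2.symm
    · exact h2
  -- The map `f` sends a vertex to the root of its tree, so climbing along parents joins each vertex
  -- to its image.
  have hj : ∀ n, ∀ x ∈ V(G), rank x = n → Joined G C x (f x) := by
    intro n
    induction n using Nat.strong_induction_on with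
    | _ n ih =>
      intro x hx hn
      by_cases h : par x = x
      · rw [hroot x hx h]; exact .refl
      · obtain ⟨h1, h2, h3⟩ := hpar x hx h
        have := ih _ (hn ▸ h3) (par x) h2.right_mem rfl
        rw [hf x hx] at this
        exact .head ⟨_, h1, h2⟩ this
  -- Every surviving edge is an edge of `H`, so all vertices outside `H` are isolated and can be
  -- dropped.
  refine ⟨hCE, Set.sdiff_subset, ?_, ?_, ?_, V(H)ᶜ, ?_, ?_⟩
  · exact Set.disjoint_left.2 fun e he h => h.2 (.inl he)
  · choose! child hc1 hc2 hc3 using hC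
    refine isForest_of_parent par rank child ?_ ?_ ?_ hle
    · intro e he e' he' h
      rw [← hc3 e he, ← hc3 e' he', h]
    · intro e he
      have := (hpar _ (hc1 e he) (hc2 e he)).2.1
      rwa [hc3 e he] at this
    · intro e he
      exact (hpar _ (hc1 e he) (hc2 e he)).2.2
  · intro x hx y hy
    constructor
    · intro h
      have h1 := hj _ x hx rfl
      rw [h] at h1
      exact h1.trans (hj _ y hy rfl).symm
    · intro h
      exact (h.mem_of_closed (S := {z | f x = f z})
        (fun e he u v huv hu => Eq.trans hu (hCf e he u v huv)) rfl)
  · rintro v hv e ⟨w, h⟩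
    exact hv ((hmap e v w).1 h).left_mem
  · refine Graph.ext ?_ ?_
    · ext v
      simp only [Graph.vertexSet_deleteVerts, Graph.vertexSet_map, Graph.vertexSet_deleteEdges,
        Set.mem_sdiff, Set.mem_compl_iff, not_not]
      exact ⟨fun h => ⟨hV h, h⟩, fun h => h.2⟩
    · intro e u v
      rw [Graph.deleteVerts_isLink, hmap]
      simp only [Set.mem_compl_iff, not_not]
      exact ⟨fun h => ⟨h, h.left_mem, h.right_mem⟩, fun h => h.1⟩

theorem isMinorVia_of_le [Nonempty α] [Nonempty β] (h : H ≤ G) :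
    IsMinorVia H G ∅ (E(G) \ E(H)) id := by
  have := isMinorVia_of_parent (H := H) (G := G) (C := ∅) (f := id) (par := id)
    (rank := fun _ => 0) (edge := fun _ => Classical.arbitrary β) h.edgeSet_mono (by simp)
    (by simp) (by simp) (by simp) (by simp) (by simp)
    (fun e he x y hl => (h.isLink_iff he).2 hl) (by simpa using h.vertexSet_mono)
  simpa using this

/-- Successors in a thinned-out cyclic order are found by walking past the removed entries; `R`
stands for one such skip. -/
theorem reflTransGen_formPerm_filter [DecidableEq β] {l : List β} (hl : l.Nodup) {p : β → Bool}
    {e : β} (he : e ∈ l) (hp : p e) {R : β → β → Prop}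
    (hR : ∀ x ∈ l, ¬ p x → R x (l.formPerm x)) :
    Relation.ReflTransGen R (l.formPerm e) ((l.filter p).formPerm e) := by
  have rot : ∀ (s : List β) (x : β) (t : List β), l = s ++ x :: t →
      l.formPerm = (x :: (t ++ s)).formPerm ∧ (x :: (t ++ s)).Nodup := by
    intro s x t h
    have h1 : l ~r (x :: t ++ s) := h ▸ List.isRotated_append
    exact ⟨List.formPerm_eq_of_isRotated hl h1, h1.nodup_iff.1 hl⟩
  obtain ⟨s, t, hst⟩ := List.append_of_mem he
  obtain ⟨h1, h2⟩ := rot s e t hst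
  have h3 : (l.filter p).formPerm = (e :: (t ++ s).filter p).formPerm := by
    have : l.filter p ~r (e :: t).filter p ++ s.filter p := by
      rw [hst, List.filter_append]
      exact List.isRotated_append
    rw [List.formPerm_eq_of_isRotated (hl.filter _) this, List.filter_append,
      List.filter_cons_of_pos hp, List.cons_append]
  have h4 : (l.filter p).formPerm e = ((t ++ s).filter p).headD e := by
    rw [h3]
    have h5 : (e :: (t ++ s).filter p).Nodup := by
      rw [← List.filter_cons_of_pos hp]
      exact h2.filter _
    revert h5
    generalize (t ++ s).filter p = u
    intro h5
    cases u with
    | nil => simp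
    | cons y u =>
      simpa using List.formPerm_apply_head _ _ _ h5
  rw [h4]
  -- With `e` rotated to the front, the walk proceeds along the remaining list `u`. If nothing in
  -- `u` survives, it wraps around to `e`, which is the default of `headD`.
  have key : ∀ (u s' : List β) (c : β), e :: (t ++ s) = s' ++ c :: u →
      Relation.ReflTransGen R ((e :: (t ++ s)).formPerm c)
        ((u.filter p).headD e) := by
    intro u
    induction u with
    | nil =>
      intro s' c h
      have h5 : (e :: (t ++ s)) ~r (c :: s') := h ▸ (List.isRotated_append (l := s') (l' := [c]))
      have h6 := List.formPerm_eq_of_isRotated h2 h5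
      rw [h6]
      cases s' with
      | nil =>
        simp only [List.nil_append, List.cons.injEq] at h
        simp [h.1]
        exact .refl
      | cons y s' =>
        simp only [List.cons_append, List.cons.injEq] at h
        rw [← h.1] at h5 ⊢
        rw [List.formPerm_apply_head _ _ _ (h5.nodup_iff.1 h2)]
        exact .refl
    | cons y u ih =>
      intro s' c h
      have h5 : (e :: (t ++ s)) ~r (c :: y :: u ++ s') := h ▸ List.isRotated_append
      have h6 := List.formPerm_eq_of_isRotated h2 h5
      have h7 : (e :: (t ++ s)).formPerm c = y := by
        rw [h6]
        exact List.formPerm_apply_head _ _ _ (h5.nodup_iff.1 h2)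
      rw [h7]
      by_cases hy : p y
      · simp only [List.filter_cons_of_pos hy]
        exact .refl
      · simp only [List.filter_cons_of_neg hy]
        refine .head ?_ (ih (s' ++ [c]) y (by simpa using h))
        have h8 : y ∈ l := by
          have : y ∈ e :: (t ++ s) := by rw [h]; simp
          rw [hst]
          simp only [List.mem_cons, List.mem_append] at this ⊢
          tauto
        rw [← h1]
        exact hR y h8 hy
  rw [h1]
  exact key (t ++ s) [] e rfl

-- With nothing contracted, the walk around a contracted tree stays at one vertex and only skips
-- deleted edges.
open scoped Classical in
theorem isInducedVia_of_filter (hHG : H ≤ G) {rot rot' : α → List β}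
    (hnd : ∀ v, (rot v).Nodup) (hmem : ∀ v e, e ∈ rot v ↔ G.Inc e v)
    (hmem' : ∀ v e, e ∈ rot' v ↔ H.Inc e v)
    (hfilter : ∀ v ∈ V(H), rot' v = (rot v).filter (· ∈ E(H))) :
    IsInducedVia H (fun v => (rot' v).formPerm) G (fun v => (rot v).formPerm) ∅ (E(G) \ E(H))
      id := by
  intro e he x hx
  have hx' : H.Inc e x := by
    obtain ⟨y, hy⟩ := hx
    exact ⟨y, (hHG.isLink_iff he).2 hy⟩
  have h1 := (hmem' x e).2 hx'
  refine ⟨((hmem' x _).1 (List.formPerm_apply_mem_of_mem h1)).edge_mem, x, ?_⟩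
  have h2 := reflTransGen_formPerm_filter (hnd x) ((hmem x e).2 hx) (p := (· ∈ E(H)))
    (by simpa using he)
    (R := fun f f' => f ∈ E(G) \ E(H) ∧ f' = (rot x).formPerm f) (by
      intro f hf hp
      exact ⟨⟨((hmem x f).1 hf).edge_mem, by simpa using hp⟩, rfl⟩)
  simp only [id]
  rw [hfilter x hx'.vertex_mem]
  refine h2.lift (fun f => (x, f)) ?_
  rintro f f' ⟨h3, rfl⟩
  exact .delete h3

end Deletion

end TemporalGraph

namespace TemporalGraph
open scoped Graph

variable {m a : ℕ} {role : ℕ → Role} {b : ℕ → Bool}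

/-! ### Deleting everything but bare houses -/

theorem Valid.bare (hv : Valid m a role) : Valid m a fun _ => .bare :=
  valid_const hv.one_le hv.le (by simp) (by simp)

theorem Valid.bare_le (hv : Valid m a role) (hr : ∀ h, IsSite a h → (role h).HasHouse) :
    settlement m a (fun _ => .bare) ≤ settlement m a role where
  vertexSet_mono := by
    intro x hx
    cases x with
    | centre => trivial
    | surface j => exact hx
    | house h k => exact ⟨hx.1, hr h hx.1, hx.2.2⟩
    | inhabitant h => exact ⟨hx.1, hr h hx.1⟩
    | extra h => exact absurd hx.2 (by simp)
  isLink_mono := by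
    intro e x y h
    rw [hv.bare.isLink_iff] at h
    rw [hv.isLink_iff]
    obtain ⟨h1, h2⟩ := h
    cases e with
    | spoke j => exact ⟨h1, h2⟩
    | rim j => exact ⟨h1, h2⟩
    | wall h k =>
      have h3 := hr h h1.1
      refine ⟨⟨h1.1, h3.hasWall.2 h1.2⟩, ?_⟩
      simp only [roleEnds, h3.wallEnds]
      exact h2
    | claw h k =>
      have h3 := hr h h1.1
      obtain ⟨hs, rfl | rfl⟩ := h1
      · refine ⟨⟨hs, h3.hasClaw.1⟩, ?_⟩
        simp only [roleEnds, h3.clawEnds]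
        exact h2
      · refine ⟨⟨hs, h3.hasClaw.2⟩, ?_⟩
        simp only [roleEnds, h3.clawEnds]
        exact h2
    | extra n => exact h1.2.elim

open scoped Classical in
theorem filter_up (hr : ∀ h, IsSite a h → (role h).HasHouse) (j : ℕ) :
    (up a role b j).filter (IsEdge m a (fun _ => .bare) ·) = up a (fun _ => .bare) b j := by
  unfold up
  split_ifs with h1 h2 h3 h4
  all_goals
    try have h5 := hr _ h1
    try
      cases h6 : role ((j + 3) / 4) <;> rw [h6] at h5 <;> (try exact h5.elim) <;>
      simp [Role.upFirst, Role.upSecond, Role.upThird, IsEdge, h1, Role.HasWall, Role.HasClaw,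
        Role.HasExtra, List.filter_cons]
  rfl

open scoped Classical in
theorem filter_rotator (hr : ∀ h, IsSite a h → (role h).HasHouse) (x : Vertex)
    (hx : IsVertex m a (fun _ => .bare) x) :
    rotator m a (fun _ => .bare) b x =
      (rotator m a role b x).filter (IsEdge m a (fun _ => .bare) ·) := by
  cases x with
  | centre =>
    rw [rotator, rotator, List.filter_eq_self.2]
    intro e he
    simp only [List.mem_map, List.mem_reverse, List.mem_range] at he
    obtain ⟨j, hj, rfl⟩ := he
    simp [IsEdge]
    omega
  | surface j =>
    have h1 : 1 ≤ prev m j ∧ prev m j ≤ 4 * m := by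
      unfold IsVertex at hx
      unfold prev
      split_ifs <;> omega
    unfold IsVertex at hx
    simp only [rotator, if_pos hx, List.filter_cons, List.filter_append, filter_up hr]
    simp [IsEdge, hx, h1]
  | house h k =>
    obtain ⟨hs, -, h1, h2⟩ := hx
    have h3 := hr h hs
    have hk : k = 2 ∨ k = 3 ∨ k = 4 ∨ k = 5 ∨ k = 6 := by omega
    simp only [rotator_house, if_pos hs]
    clear hr
    cases hr : role h <;> rw [hr] at h3 <;> (try exact h3.elim) <;>
      obtain rfl | rfl | rfl | rfl | rfl := hk <;> cases b h <;>
      simp [Role.houseRot, IsEdge, hs, Role.HasWall, Role.HasClaw,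
        Role.HasExtra, List.filter_cons]
  | inhabitant h =>
    obtain ⟨hs, -⟩ := hx
    have h3 := hr h hs
    simp only [rotator_inhabitant, if_pos hs]
    clear hr
    cases hr : role h <;> rw [hr] at h3 <;> (try exact h3.elim) <;> cases b h <;>
      simp [Role.inhabitantRot, IsEdge, hs, Role.HasClaw, List.filter_cons]
  | extra h => exact absurd hx.2 (by simp)

instance : Nonempty Vertex := ⟨.centre⟩
instance : Nonempty Edge := ⟨.spoke 0⟩

/-- The same bits appear on both sides because the deletion does not move any inhabitant across a
wall. -/
theorem Valid.induces_bare (hv : Valid m a role) (hr : ∀ h, IsSite a h → (role h).HasHouse) :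
    InducesForSomeChoice (settlement m a fun _ => .bare) (embedding m a (fun _ => .bare) b)
      (settlement m a role) (embedding m a role b) := by
  classical
  refine ⟨_, _, _, isMinorVia_of_le (hv.bare_le hr), ?_⟩
  refine isInducedVia_of_filter (hv.bare_le hr) hv.nodup_rotator (fun v e => hv.mem_rotator_iff)
    (fun v e => hv.bare.mem_rotator_iff) ?_
  intro v hx
  rw [filter_rotator hr v hx]
  congr 1
  ext e
  simp only [hv.bare.mem_edgeSet_iff]

end TemporalGraph

namespace TemporalGraph
open scoped Graph

variable {m a : ℕ} {role : ℕ → Role} {b swap : ℕ → Bool}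

/-! ### Contracting houses -/

/-- Which houses can be contracted in the swapped way, `v_2` to the right and `v_6` to the left. -/
structure ValidSwap (a : ℕ) (role : ℕ → Role) (swap : ℕ → Bool) : Prop where
  mem_roles : ∀ h, IsSite a h → role h = .bare ∨ role h = .left ∨ role h = .right
  not_bare : ∀ h, IsSite a h → role h = .bare → swap h = false
  left : ∀ h, IsSite a h → role h = .left → swap h = true → swap (h + 1) = false
  right : ∀ h, IsSite a h → role h = .right → swap h = true → swap (h - 1) = false

/-- The contracted edges. -/
def IsContracted (a : ℕ) (swap : ℕ → Bool) : Edge → Prop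
  | .spoke _ => False
  | .rim _ => False
  | .wall h k => IsSite a h ∧ (k = 3 ∨ k = 4 ∨ k = 5 ∨ (k = 1 ∨ k = 6) ∧ swap h = false)
  | .claw h k => IsSite a h ∧ k = 3
  | .extra n => IsSite a (n / 3) ∧ swap (n / 3) = true

/-- The vertices to which the vertices of houses are contracted. -/
def contractTo (swap : ℕ → Bool) : Vertex → Vertex
  | .house h 2 => bif swap h then .surface (4 * h - 1) else .surface (4 * h - 3)
  | .house h _ => bif swap h then .surface (4 * h - 3) else .surface (4 * h - 1)
  | .inhabitant h => bif swap h then .surface (4 * h - 3) else .surface (4 * h - 1)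
  | .extra h => bif swap h then .surface (4 * h - 1) else
      bif swap (h + 1) then .surface (4 * (h + 1) - 3) else .extra h
  | x => x

/-- One step towards the root in the contracted forest. A crossed left house sends v_2 through the
shared vertex, a crossed right house sends v_6 through it. A shared vertex that nobody uses is its
own root. -/
def contractParent (role : ℕ → Role) (swap : ℕ → Bool) : Vertex → Vertex
  | .house h 2 => bif swap h then (match role h with
      | .left => .extra h
      | _ => .surface (4 * h - 1)) else .surface (4 * h - 3)
  | .house h 3 => .house h 4
  | .house h 4 => .house h 5
  | .house h 5 => .house h 6
  | .house h 6 => bif swap h then (match role h with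
      | .right => .extra (h - 1)
      | _ => .surface (4 * h - 3)) else .surface (4 * h - 1)
  | .inhabitant h => .house h 6
  | .extra h => bif swap h then .surface (4 * h - 1) else
      bif swap (h + 1) then .surface (4 * (h + 1) - 3) else .extra h
  | x => x

/-- A potential that decreases along proper parents; the shared vertex ranks between the house
vertices and the rim. -/
def contractRank : Vertex → ℕ
  | .house _ 2 => 2
  | .house _ 3 => 5
  | .house _ 4 => 4
  | .house _ 5 => 3
  | .house _ 6 => 2
  | .inhabitant _ => 3
  | .extra _ => 1
  | _ => 0

/-- The edge to the parent. Values at roots are never used. -/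
def contractEdge (role : ℕ → Role) (swap : ℕ → Bool) : Vertex → Edge
  | .house h 2 => bif swap h then (match role h with
      | .left => .extra (3 * h + 1)
      | _ => .extra (3 * h)) else .wall h 1
  | .house h 3 => .wall h 3
  | .house h 4 => .wall h 4
  | .house h 5 => .wall h 5
  | .house h 6 => bif swap h then (match role h with
      | .right => .extra (3 * h + 1)
      | _ => .extra (3 * h)) else .wall h 6
  | .inhabitant h => .claw h 3
  | .extra h => bif swap h then .extra (3 * h + 2) else .extra (3 * (h + 1) + 2)
  | _ => .spoke 0

theorem Valid.flat (hv : Valid m a role) : Valid m a fun _ => .flat :=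
  valid_const hv.one_le hv.le (by simp) (by simp)

/-- The conditions on `swap` ensure that the shared vertex of a pair is claimed at most once, so
that every tree has a single root. If both houses are straight, the shared vertex loses all its
edges and disappears. -/
theorem Valid.isMinorVia_flat (hv : Valid m a role) (hs : ValidSwap a role swap) :
    IsMinorVia (settlement m a fun _ => .flat) (settlement m a role) {e | IsContracted a swap e}
      (E(settlement m a role) \ ({e | IsContracted a swap e} ∪ E(settlement m a fun _ => .flat)))
      (contractTo swap) := by
  have ha := hv.one_le
  refine isMinorVia_of_parent (par := contractParent role swap) (rank := contractRank)
    (edge := contractEdge role swap) ?_ ?_ ?_ ?_ ?_ ?_ ?_ ?_ ?_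
  · intro e he
    rw [hv.flat.mem_edgeSet_iff] at he
    rw [hv.mem_edgeSet_iff]
    cases e with
    | spoke j => exact he
    | rim j => exact he
    | wall h k =>
      obtain ⟨h1, rfl⟩ := he
      obtain h2 | h2 | h2 := hs.mem_roles h h1 <;> simp [IsEdge, h1, h2, Role.HasWall]
    | claw h k =>
      obtain ⟨h1, rfl⟩ := he
      obtain h2 | h2 | h2 := hs.mem_roles h h1 <;> simp [IsEdge, h1, h2, Role.HasClaw]
    | extra n => exact he.2.elim
  · rw [Set.disjoint_left]
    intro e he h
    rw [hv.flat.mem_edgeSet_iff] at h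
    cases e with
    | spoke j => exact he
    | rim j => exact he
    | wall h' k =>
      obtain ⟨h1, rfl⟩ := h
      simp [IsContracted] at he
    | claw h' k =>
      obtain ⟨h1, rfl⟩ := h
      simp [IsContracted] at he
    | extra n => exact h.2.elim
  · intro e he
    cases e with
    | spoke j => exact he.elim
    | rim j => exact he.elim
    | wall h k =>
      obtain ⟨h1, h2⟩ := he
      have h3 : (role h).HasHouse := by
        obtain h3 | h3 | h3 := hs.mem_roles h h1 <;> simp [h3, Role.HasHouse]
      obtain rfl | rfl | rfl | ⟨rfl | rfl, h4⟩ := h2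
      · exact ⟨.house h 3, by simp [settlement, IsVertex, h1, h3], by simp [contractParent], rfl⟩
      · exact ⟨.house h 4, by simp [settlement, IsVertex, h1, h3], by simp [contractParent], rfl⟩
      · exact ⟨.house h 5, by simp [settlement, IsVertex, h1, h3], by simp [contractParent], rfl⟩
      · exact ⟨.house h 2, by simp [settlement, IsVertex, h1, h3], by simp [contractParent, h4],
          by simp [contractEdge, h4]⟩
      · exact ⟨.house h 6, by simp [settlement, IsVertex, h1, h3], by simp [contractParent, h4],
          by simp [contractEdge, h4]⟩
    | claw h k =>
      obtain ⟨h1, rfl⟩ := he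
      have h3 : (role h).HasHouse := by
        obtain h3 | h3 | h3 := hs.mem_roles h h1 <;> simp [h3, Role.HasHouse]
      exact ⟨.inhabitant h, by simp [settlement, IsVertex, h1, h3], by simp [contractParent], rfl⟩
    | extra n =>
      obtain ⟨h, hn⟩ : ∃ h, n = 3 * h ∨ n = 3 * h + 1 ∨ n = 3 * h + 2 := ⟨n / 3, by omega⟩
      have h0 : n / 3 = h := by omega
      obtain ⟨h1, h2⟩ := he
      rw [h0] at h1 h2
      obtain h3 | h3 | h3 := hs.mem_roles h h1
      · simp [hs.not_bare h h1 h3] at h2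
      · obtain rfl | rfl | rfl := hn
        · exact ⟨.house h 6, by simp [settlement, IsVertex, h1, h3, Role.HasHouse],
            by simp [contractParent, h2, h3], by simp [contractEdge, h2, h3]⟩
        · exact ⟨.house h 2, by simp [settlement, IsVertex, h1, h3, Role.HasHouse],
            by simp [contractParent, h2, h3], by simp [contractEdge, h2, h3]⟩
        · exact ⟨.extra h, by simp [settlement, IsVertex, h1, h3],
            by simp [contractParent, h2], by simp [contractEdge, h2]⟩
      · have h4 := hv.left_of_right h h1 h3
        have h5 : h - 1 + 1 = h := by have := h1.1; omega
        have h6 := hs.right h h1 h3 h2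
        obtain rfl | rfl | rfl := hn
        · exact ⟨.house h 2, by simp [settlement, IsVertex, h1, h3, Role.HasHouse],
            by simp [contractParent, h2, h3], by simp [contractEdge, h2, h3]⟩
        · exact ⟨.house h 6, by simp [settlement, IsVertex, h1, h3, Role.HasHouse],
            by simp [contractParent, h2, h3], by simp [contractEdge, h2, h3]⟩
        · exact ⟨.extra (h - 1), by simp [settlement, IsVertex, h4],
            by simp [contractParent, h2, h5, h6], by simp [contractEdge, h5, h6]⟩
  · intro x hx hne
    cases x with
    | centre => exact absurd rfl hne
    | surface j => exact absurd rfl hne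
    | house h k =>
      obtain ⟨h1, -, hk⟩ := hx
      have hk : k = 2 ∨ k = 3 ∨ k = 4 ∨ k = 5 ∨ k = 6 := by omega
      rw [hv.isLink_iff]
      have h4 := hs.not_bare h h1
      obtain h3 | h3 | h3 := hs.mem_roles h h1 <;> rw [h3] at h4 <;> cases h2 : swap h <;>
        (try simp [h2] at h4) <;>
        obtain rfl | rfl | rfl | rfl | rfl := hk <;>
        simp [contractEdge, contractParent, h2, h3, IsContracted, h1, IsEdge, Role.HasWall,
          Role.HasClaw, Role.HasExtra, three_mul_div, roleEnds, Role.wallEnds, houseVertex,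
          Role.extraEnds, contractRank]
    | inhabitant h =>
      obtain ⟨h1, -⟩ := hx
      rw [hv.isLink_iff]
      obtain h3 | h3 | h3 := hs.mem_roles h h1 <;>
        simp [contractEdge, contractParent, h3, IsContracted, h1, IsEdge,
          Role.HasClaw, roleEnds, Role.clawEnds, houseVertex, contractRank]
    | extra h =>
      obtain ⟨h1, h3⟩ := hx
      have h4 := hv.right_of_left h h1 h3
      rw [hv.isLink_iff]
      cases h2 : swap h <;> cases h5 : swap (h + 1) <;>
        simp [contractEdge, contractParent, h2, h3, IsContracted, h1, h4, h5, IsEdge, Role.HasExtra,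
          three_mul_div, roleEnds, Role.extraEnds, contractRank] at hne ⊢
  · intro x
    cases x with
    | centre => rfl
    | surface j => rfl
    | house h k =>
      by_cases hk : k = 2 ∨ k = 3 ∨ k = 4 ∨ k = 5 ∨ k = 6
      · obtain rfl | rfl | rfl | rfl | rfl := hk <;> cases h2 : swap h <;> cases hr : role h <;>
        simp [contractParent, contractRank, h2, hr]
      · simp only [not_or] at hk
        simp [contractParent, contractRank, hk]
    | inhabitant h => simp [contractParent, contractRank]
    | extra h =>
      cases h2 : swap h <;> cases h5 : swap (h + 1) <;>
      simp [contractParent, contractRank, h2, h5]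
  · intro x hx
    cases x with
    | centre => rfl
    | surface j => rfl
    | house h k =>
      obtain ⟨h1, -, hk⟩ := hx
      have hk : k = 2 ∨ k = 3 ∨ k = 4 ∨ k = 5 ∨ k = 6 := by omega
      have h4 := hs.not_bare h h1
      have h5 := hs.right h h1
      have h6 : h - 1 + 1 = h := by have := h1.1; omega
      obtain h3 | h3 | h3 := hs.mem_roles h h1 <;> rw [h3] at h4 h5 <;> cases h2 : swap h <;>
        (try simp [h2] at h4) <;> (try simp [h2] at h5) <;>
        obtain rfl | rfl | rfl | rfl | rfl := hk <;>
        simp [contractTo, contractParent, h2, h3, h5, h6]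
    | inhabitant h => cases h2 : swap h <;> simp [contractTo, contractParent, h2]
    | extra h =>
      cases h2 : swap h <;> cases h5 : swap (h + 1) <;>
      simp [contractParent, contractTo, h2, h5]
  · intro x hx hp
    cases x with
    | centre => rfl
    | surface j => rfl
    | house h k =>
      obtain ⟨h1, -, hk⟩ := hx
      have hk : k = 2 ∨ k = 3 ∨ k = 4 ∨ k = 5 ∨ k = 6 := by omega
      obtain rfl | rfl | rfl | rfl | rfl := hk <;> cases h2 : swap h <;> cases h3 : role h <;>
        simp [contractParent, h2, h3] at hp
    | inhabitant h => simp [contractParent] at hp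
    | extra h => exact hp
  · intro e he x y hl
    rw [hv.flat.mem_edgeSet_iff] at he
    rw [hv.isLink_iff] at hl
    rw [hv.flat.isLink_iff]
    refine ⟨he, ?_⟩
    have key : roleEnds m (fun _ => .flat) e = (contractTo swap (roleEnds m role e).1,
        contractTo swap (roleEnds m role e).2) ∨ roleEnds m (fun _ => .flat) e =
        (contractTo swap (roleEnds m role e).2,
        contractTo swap (roleEnds m role e).1) := by
      cases e with
      | spoke j => exact .inl rfl
      | rim j => exact .inl rfl
      | wall h k =>
        obtain ⟨h1, rfl⟩ := he
        obtain h3 | h3 | h3 := hs.mem_roles h h1 <;> cases h2 : swap h <;>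
          simp [roleEnds, h3, h2, Role.wallEnds, houseVertex, contractTo]
      | claw h k =>
        obtain ⟨h1, rfl⟩ := he
        obtain h3 | h3 | h3 := hs.mem_roles h h1 <;> cases h2 : swap h <;>
          simp [roleEnds, h3, h2, Role.clawEnds, houseVertex, contractTo]
      | extra n => exact he.2.elim
    obtain ⟨-, h | h⟩ := hl <;> rw [h] at key
    · exact key
    · exact key.symm
  · intro x hx
    cases x with
    | centre => exact ⟨.centre, trivial, rfl⟩
    | surface j => exact ⟨.surface j, hx, rfl⟩
    | house h k => exact hx.2.1.elim
    | inhabitant h => exact hx.2.elim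
    | extra h => exact absurd hx.2 (by simp)

end TemporalGraph

/-! ### Rotators induced by contracting houses -/

namespace TemporalGraph
open scoped Graph

variable {m a : ℕ} {role : ℕ → Role} {b swap : ℕ → Bool}

/-- The deleted edges when houses are contracted. -/
def flatDeleted (m a : ℕ) (role : ℕ → Role) (swap : ℕ → Bool) : Set Edge :=
  E(settlement m a role) \ ({e | IsContracted a swap e} ∪ E(settlement m a fun _ => .flat))

theorem Valid.mem_flatDeleted (hv : Valid m a role) {e : Edge} :
    e ∈ flatDeleted m a role swap ↔
      IsEdge m a role e ∧ ¬ IsContracted a swap e ∧ ¬ IsEdge m a (fun _ => .flat) e := by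
  simp only [flatDeleted, Set.mem_sdiff, Set.mem_union, hv.mem_edgeSet_iff, not_or,
    hv.flat.mem_edgeSet_iff, Set.mem_ofPred_eq]

/-- The walk around a contracted tree from a dart reaches an edge. -/
def Reach (m a : ℕ) (role : ℕ → Role) (b swap : ℕ → Bool) (d : Vertex × Edge) (e : Edge) : Prop :=
  ∃ y, Relation.ReflTransGen (SkipStep (settlement m a role) (embedding m a role b)
    {e | IsContracted a swap e} (flatDeleted m a role swap)) d (y, e)

theorem Reach.refl {x : Vertex} {e : Edge} : Reach m a role b swap (x, e) e := ⟨x, .refl⟩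

theorem Valid.reach_delete (hv : Valid m a role) {x : Vertex} {e e' : Edge}
    (he : IsEdge m a role e ∧ ¬ IsContracted a swap e ∧ ¬ IsEdge m a (fun _ => .flat) e)
    (h : Reach m a role b swap (x, embedding m a role b x e) e') :
    Reach m a role b swap (x, e) e' := by
  obtain ⟨y, h⟩ := h
  exact ⟨y, .head (.delete (hv.mem_flatDeleted.2 he)) h⟩

theorem Valid.reach_contract_left (hv : Valid m a role) {x : Vertex} {e e' : Edge}
    (he : IsContracted a swap e ∧ IsEdge m a role e ∧ (roleEnds m role e).1 = x)
    (h : Reach m a role b swap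
      ((roleEnds m role e).2, embedding m a role b (roleEnds m role e).2 e) e') :
    Reach m a role b swap (x, e) e' := by
  obtain ⟨y, h⟩ := h
  obtain ⟨h1, h2, rfl⟩ := he
  exact ⟨y, .head (.contract h1 (hv.isLink_iff.2 ⟨h2, .inl rfl⟩)) h⟩

theorem Valid.reach_contract_right (hv : Valid m a role) {x : Vertex} {e e' : Edge}
    (he : IsContracted a swap e ∧ IsEdge m a role e ∧ (roleEnds m role e).2 = x)
    (h : Reach m a role b swap
      ((roleEnds m role e).1, embedding m a role b (roleEnds m role e).1 e) e') :
    Reach m a role b swap (x, e) e' := by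
  obtain ⟨y, h⟩ := h
  obtain ⟨h1, h2, rfl⟩ := he
  exact ⟨y, .head (.contract h1 (hv.isLink_iff.2 ⟨h2, .inr rfl⟩)) h⟩

open scoped Classical in
theorem embedding_house {h k : ℕ} (hs : IsSite a h) : embedding m a role b (.house h k) =
    ((role h).houseRot h (b h) k).formPerm := by
  simp [embedding, rotator_house, hs]

open scoped Classical in
theorem embedding_inhabitant {h : ℕ} (hs : IsSite a h) : embedding m a role b (.inhabitant h) =
    ((role h).inhabitantRot h (b h)).formPerm := by
  simp [embedding, rotator_inhabitant, hs]

open scoped Classical in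
theorem embedding_extra {h : ℕ} (hs : IsSite a h) : embedding m a role b (.extra h) =
    ((role h).extraRot h).formPerm := by
  simp [embedding, rotator_extra, hs]

theorem formPerm_four {β : Type*} [DecidableEq β] {w x y z : β} (h : [w, x, y, z].Nodup) :
    [w, x, y, z].formPerm w = x ∧ [w, x, y, z].formPerm x = y ∧ [w, x, y, z].formPerm y = z ∧
      [w, x, y, z].formPerm z = w := by
  simp only [List.nodup_cons, List.mem_cons, List.not_mem_nil, or_false, not_or] at h
  obtain ⟨⟨h1, h2, h3⟩, ⟨h4, h5⟩, h6, -⟩ := h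
  simp [List.formPerm_cons_cons, Equiv.swap_apply_def, h1, h2, h3, h4, h5, h6, Ne.symm h1,
    Ne.symm h2, Ne.symm h3, Ne.symm h4, Ne.symm h5, Ne.symm h6]

theorem embedding_extra_apply {h : ℕ} (hs : IsSite a h) (hr : role h = .left) :
    embedding m a role b (.extra h) (.extra (3 * h + 1)) = .extra (3 * h + 2) ∧
    embedding m a role b (.extra h) (.extra (3 * h + 2)) = .extra (3 * (h + 1) + 2) ∧
    embedding m a role b (.extra h) (.extra (3 * (h + 1) + 2)) = .extra (3 * (h + 1) + 1) ∧
    embedding m a role b (.extra h) (.extra (3 * (h + 1) + 1)) = .extra (3 * h + 1) := by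
  classical
  rw [embedding_extra hs, hr]
  exact formPerm_four (by simp; omega)

open scoped Classical in
theorem embedding_first {h : ℕ} (ha : 1 ≤ a) (hm : a + 2 ≤ m) (hs : IsSite a h) :
    embedding m a role b (.surface (4 * h - 3)) =
    (Edge.spoke (4 * h - 3) :: Edge.rim (4 * h - 3) ::
      ((role h).upFirst h (b h) ++ [.rim (prev m (4 * h - 3))])).formPerm := by
  have h0 := hs
  unfold IsSite at h0
  have h1 : 1 ≤ 4 * h - 3 ∧ 4 * h - 3 ≤ 4 * m := by omega
  have h2 : (4 * h - 3 + 3) / 4 = h := by omega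
  have h3 : (4 * h - 3) % 4 = 1 := by omega
  simp only [embedding, rotator, up, if_pos h1, h2, h3, if_pos hs, if_true]

open scoped Classical in
theorem embedding_third {h : ℕ} (ha : 1 ≤ a) (hm : a + 2 ≤ m) (hs : IsSite a h) :
    embedding m a role b (.surface (4 * h - 1)) =
    (Edge.spoke (4 * h - 1) :: Edge.rim (4 * h - 1) ::
      ((role h).upThird h (b h) ++ [.rim (4 * h - 2)])).formPerm := by
  have h0 := hs
  unfold IsSite at h0
  have h1 : 1 ≤ 4 * h - 1 ∧ 4 * h - 1 ≤ 4 * m := by omega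
  have h2 : (4 * h - 1 + 3) / 4 = h := by omega
  have h3 : (4 * h - 1) % 4 = 3 := by omega
  have h4 : prev m (4 * h - 1) = 4 * h - 2 := by unfold prev; split_ifs <;> omega
  simp only [embedding, rotator, up, if_pos h1, h2, h3, h4, if_pos hs]
  rfl

-- These are the darts near a house at which the rotator changes. A crossed contraction exchanges
-- the ends of the two parallel edges relative to the drawing and thereby reverses which of them
-- runs below; this is the xor with `swap`.
set_option maxHeartbeats 1000000 in
theorem Valid.reach_flat_house (hv : Valid m a role) (hsw : ValidSwap a role swap)
    {h : ℕ} (hs : IsSite a h) {e : Edge} {x : Vertex}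
    (he : (e = .rim (4 * h - 3) ∧ x = .surface (4 * h - 3)) ∨
      (e = .rim (4 * h - 1) ∧ x = .surface (4 * h - 1)) ∨
      (e = .wall h 2 ∧ (x = .house h 2 ∨ x = .house h 3)) ∨
      (e = .claw h 1 ∧ (x = .inhabitant h ∨ x = .house h 2))) :
    Reach m a role b swap (x, embedding m a role b x e)
      (embedding m a (fun _ => .flat) (fun h => b h ^^ swap h) (contractTo swap x) e) := by
  have ha := hv.one_le
  have hm := hv.le
  have hs' := hs
  unfold IsSite at hs'
  have hp : prev m (4 * h - 3) ≠ 4 * h - 3 := by unfold prev; split_ifs <;> omega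
  have hq : 4 * h - 2 ≠ 4 * h - 1 := by omega
  have hsb := hsw.not_bare h hs
  have hle := hsw.left h hs
  have hri := hsw.right h hs
  have hvl := hv.right_of_left h hs
  have hvr := hv.left_of_right h hs
  have h1 : h - 1 + 1 = h := by omega
  have hL := fun hr => embedding_extra_apply (m := m) (role := role) (b := b) hs hr
  have hR := fun hr => embedding_extra_apply (m := m) (role := role) (b := b) (hvr hr).1 (hvr hr).2
  rw [h1] at hR
  obtain hr | hr | hr := hsw.mem_roles h hs <;> rw [hr] at hsb hle hri hvl hvr hL hR <;>
    cases h2 : swap h <;> (try simp [h2] at hsb) <;> cases hb : b h <;>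
    simp [h2] at hle hri hvl hvr hL hR <;>
    obtain ⟨rfl, rfl⟩ | ⟨rfl, rfl⟩ | ⟨rfl, rfl | rfl⟩ | ⟨rfl, rfl | rfl⟩ := he <;>
    simp [contractTo, h2, hb, hr, embedding_first ha hm hs, embedding_third ha hm hs,
      embedding_house hs, embedding_inhabitant hs, Role.upFirst, Role.upThird, Role.houseRot,
      Role.inhabitantRot, List.formPerm_cons_cons, Equiv.swap_apply_def, hp, hp.symm, hq, hq.symm]
  all_goals
    -- The walk is deterministic: stop when the current edge is the target, otherwise skip a deleted
    -- edge or follow a contracted edge to its other end. Each case ends after finitely many such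
    -- moves.
    repeat' first
      | exact Reach.refl
      | (refine hv.reach_delete ?_ ?_
         focus (simp [IsEdge, hs, hr, h2, hle, hri, hvl, hvr, three_mul_div, IsContracted, Role.HasWall,
            Role.HasClaw, Role.HasExtra]; done)
         simp [hb, hr, embedding_first ha hm hs, embedding_third ha hm hs,
          embedding_house hs, embedding_inhabitant hs, Role.upFirst, Role.upThird, Role.houseRot,
          Role.inhabitantRot, List.formPerm_cons_cons, Equiv.swap_apply_def, hp, hp.symm, hq,
          hq.symm, hL, hR, hvl, hvr, hs, h1])
      | (refine hv.reach_contract_left ?_ ?_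
         focus (simp [IsEdge, hs, hr, h2, hle, hri, hvl, hvr, three_mul_div, IsContracted, Role.HasWall,
            Role.HasClaw, Role.HasExtra, roleEnds, Role.wallEnds, houseVertex, Role.clawEnds,
            Role.extraEnds]; done)
         simp [hb, hr, embedding_first ha hm hs, embedding_third ha hm hs,
          embedding_house hs, embedding_inhabitant hs, Role.upFirst, Role.upThird, Role.houseRot,
          Role.inhabitantRot, List.formPerm_cons_cons, Equiv.swap_apply_def, hp, hp.symm, hq,
          hq.symm, hL, hR, hvl, hvr, hs, h1, roleEnds, Role.wallEnds,
          houseVertex, Role.clawEnds, Role.extraEnds, three_mul_div])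
      | (refine hv.reach_contract_right ?_ ?_
         focus (simp [IsEdge, hs, hr, h2, hle, hri, hvl, hvr, three_mul_div, IsContracted, Role.HasWall,
            Role.HasClaw, Role.HasExtra, roleEnds, Role.wallEnds, houseVertex, Role.clawEnds,
            Role.extraEnds]; done)
         simp [hb, hr, embedding_first ha hm hs, embedding_third ha hm hs,
          embedding_house hs, embedding_inhabitant hs, Role.upFirst, Role.upThird, Role.houseRot,
          Role.inhabitantRot, List.formPerm_cons_cons, Equiv.swap_apply_def, hp, hp.symm, hq,
          hq.symm, hL, hR, hvl, hvr, hs, h1, roleEnds, Role.wallEnds,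
          houseVertex, Role.clawEnds, Role.extraEnds, three_mul_div])

theorem Valid.embedding_spoke (hv : Valid m a role) {j : ℕ} (hj : 1 ≤ j ∧ j ≤ 4 * m) :
    embedding m a role b (.surface j) (.spoke j) = .rim j := by
  classical
  have h1 := hv.nodup_rotator (b := b) (.surface j)
  simp only [embedding, rotator] at h1 ⊢
  rw [if_pos hj] at h1 ⊢
  exact List.formPerm_apply_head _ _ _ h1

theorem embedding_rim_prev {j : ℕ} (hj : 1 ≤ j ∧ j ≤ 4 * m) :
    embedding m a role b (.surface j) (.rim (prev m j)) = .spoke j := by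
  classical
  simp only [embedding, rotator]
  rw [if_pos hj]
  simp

theorem Valid.induces_flat (hv : Valid m a role) (hsw : ValidSwap a role swap) :
    InducesForSomeChoice (settlement m a fun _ => .flat)
      (embedding m a (fun _ => .flat) (fun h => b h ^^ swap h))
      (settlement m a role) (embedding m a role b) := by
  classical
  have ha := hv.one_le
  have hm := hv.le
  have hmin := hv.isMinorVia_flat hsw
  refine ⟨_, _, _, hmin, ?_⟩
  have hcyc := (hv.flat.isPlaneEmbedding (b := fun h => b h ^^ swap h) (by simp)).isCycleOn
  intro e he x hx
  obtain ⟨y, hl⟩ := hx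
  have hl' := hmin.isLink_map he hl
  refine ⟨(inc_rotation hcyc hl'.inc_left).edge_mem, ?_⟩
  change Reach m a role b swap (x, embedding m a role b x e) _
  have hroles : ∀ h, IsSite a h → (role h).upSecond h = [] := by
    intro h hs
    obtain hr | hr | hr := hsw.mem_roles h hs <;> simp [hr, Role.upSecond]
  have surf : ∀ j, 1 ≤ j → j ≤ 4 * m → Reach m a role b swap
      (.surface j, embedding m a role b (.surface j) (.rim j))
      (embedding m a (fun _ => .flat) (fun h => b h ^^ swap h) (.surface j) (.rim j)) := by
    intro j h1 h2
    by_cases h3 : ∃ h, IsSite a h ∧ (j = 4 * h - 3 ∨ j = 4 * h - 1)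
    · obtain ⟨h, hs, rfl | rfl⟩ := h3
      · exact hv.reach_flat_house hsw hs (.inl ⟨rfl, rfl⟩)
      · exact hv.reach_flat_house hsw hs (.inr (.inl ⟨rfl, rfl⟩))
    · have h4 : ∀ role b, (∀ h, IsSite a h → (role h).upSecond h = []) →
          up a role b j = [] := by
        intro role b hroles
        rw [List.eq_nil_iff_forall_not_mem]
        intro e he
        obtain ⟨h, hs, ⟨h5, -⟩ | ⟨-, h5⟩ | ⟨h5, -⟩⟩ := (mem_up ha).1 he
        · exact h3 ⟨h, hs, .inl h5⟩
        · simp [hroles h hs] at h5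
        · exact h3 ⟨h, hs, .inr h5⟩
      simp only [embedding, rotator, h4 role b hroles, h4 (fun _ => .flat) _ (fun _ _ => rfl)]
      exact Reach.refl
  rw [hv.flat.mem_edgeSet_iff] at he
  cases e with
  | spoke j =>
    obtain ⟨-, rfl | rfl⟩ := hv.inc_iff.1 hl.inc_left
    · exact Reach.refl
    · simp only [roleEnds, contractTo]
      rw [hv.embedding_spoke he, hv.flat.embedding_spoke he]
      exact Reach.refl
  | rim j =>
    obtain ⟨-, rfl | rfl⟩ := hv.inc_iff.1 hl.inc_left
    · exact surf j he.1 he.2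
    · have key : ∀ role b, embedding m a role b
          (.surface (if j = 4 * m then 1 else j + 1)) (.rim j) =
            .spoke (if j = 4 * m then 1 else j + 1) := by
        intro role b
        have h1 : 1 ≤ (if j = 4 * m then 1 else j + 1) ∧
            (if j = 4 * m then 1 else j + 1) ≤ 4 * m := by
          unfold IsEdge at he
          split_ifs <;> omega
        have h2 : prev m (if j = 4 * m then 1 else j + 1) = j := by
          unfold IsEdge at he
          unfold prev
          split_ifs <;> omega
        have h3 := embedding_rim_prev (a := a) (role := role) (b := b) h1
        rwa [h2] at h3
      simp only [roleEnds, contractTo]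
      rw [key, key]
      exact Reach.refl
  | wall h k =>
    obtain ⟨hs, rfl⟩ := he
    obtain ⟨-, h1⟩ := hv.inc_iff.1 hl.inc_left
    refine hv.reach_flat_house hsw hs (.inr (.inr (.inl ⟨rfl, ?_⟩)))
    obtain hr | hr | hr := hsw.mem_roles h hs <;>
      simpa [roleEnds, hr, Role.wallEnds, houseVertex, eq_comm] using h1
  | claw h k =>
    obtain ⟨hs, rfl⟩ := he
    obtain ⟨-, h1⟩ := hv.inc_iff.1 hl.inc_left
    refine hv.reach_flat_house hsw hs (.inr (.inr (.inr ⟨rfl, ?_⟩)))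
    obtain hr | hr | hr := hsw.mem_roles h hs <;>
      simpa [roleEnds, hr, Role.clawEnds, houseVertex, eq_comm] using h1
  | extra n => exact he.2.elim

end TemporalGraph

namespace TemporalGraph
open scoped Graph

variable {m a : ℕ} {role : ℕ → Role} {b swap : ℕ → Bool}

/-! ### Villages with prescribed allocations -/

theorem Valid.dartFace_step (hv : Valid m a role)
    (hb : ∀ h, IsSite a h → role h = .spike → b h = true) {d d' : Vertex × Edge}
    (h : FaceStep (settlement m a role) (embedding m a role b) d d') :
    dartFace m a role b d.1 d.2 = dartFace m a role b d'.1 d'.2 := by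
  classical
  obtain ⟨h1, h2⟩ := h
  rw [h2, ← hv.dartFaceRev_eq h1]
  exact (map_formPerm (hv.nodup_rotator _) (hv.map_dartFace hb _)
    (hv.mem_rotator_iff.2 h1.inc_right)).symm

/-- The face is at the `h`-th house. -/
def Face.IsLoc (h : ℕ) : Face → Prop
  | .loc h' _ => h' = h
  | _ => False

theorem rimFace_isLoc {h j : ℕ} (hr : rimFace a (fun _ => .plain) j |>.IsLoc h) :
    j = 4 * h - 3 ∨ j = 4 * h - 2 := by
  unfold rimFace Role.rimFace at hr
  simp only at hr
  split_ifs at hr with h1 h2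
  · simp only [Face.IsLoc] at hr
    have := h1.1
    omega
  · exact hr.elim
  · exact hr.elim

/-- With the inhabitant inside, the faces labelled at house h are exactly the interior of the house,
which can be left only across its bounding cycle. -/
theorem plain_isLoc_iff (hv : Valid m a fun _ => .plain) {h : ℕ} (hb : b h = true) {e : Edge}
    (he : IsEdge m a (fun _ => .plain) e) (hC : e ∉ boundingCycle h) :
    (edgeFaces m a (fun _ => .plain) b e).1.IsLoc h ↔
      (edgeFaces m a (fun _ => .plain) b e).2.IsLoc h := by
  cases e with
  | spoke j => simp [edgeFaces, Face.IsLoc]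
  | rim j =>
    simp only [edgeFaces, Face.IsLoc, false_iff]
    intro h1
    refine hC (.inr ?_)
    simpa using rimFace_isLoc h1
  | wall h' k =>
    have hk := he.2
    simp only [Role.HasWall] at hk
    have h1 : h' ≠ h := by
      rintro rfl
      exact hC (.inl ⟨k, hk, rfl⟩)
    have hk : k = 1 ∨ k = 2 ∨ k = 3 ∨ k = 4 ∨ k = 5 ∨ k = 6 := by omega
    obtain rfl | rfl | rfl | rfl | rfl | rfl := hk <;> cases hb' : b h' <;>
      simp [edgeFaces, Role.wallFaces, hb', Face.IsLoc, h1, Role.under, Role.midSecond, Role.above]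
  | claw h' k =>
    have hk := he.2
    simp only [Role.HasClaw] at hk
    have hk : k = 1 ∨ k = 2 ∨ k = 3 := by omega
    by_cases h1 : h' = h
    · subst h1
      obtain rfl | rfl | rfl := hk <;>
      simp [edgeFaces, Role.clawFaces, hb, Face.IsLoc, Role.under, Role.midSecond, Role.above]
    · obtain rfl | rfl | rfl := hk <;> cases hb' : b h' <;>
      simp [edgeFaces, Role.clawFaces, hb', Face.IsLoc, h1, Role.under, Role.midSecond, Role.above]
  | extra n => exact he.2.elim

/-- Lying on a face labelled at house h is invariant under region steps. It holds for the darts at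
the inhabitant and fails for those at the centre. -/
theorem Valid.not_sameSide (hv : Valid m a fun _ => .plain) {h : ℕ} (hb : b h = true) :
    ¬ SameSide (settlement m a fun _ => .plain) (embedding m a (fun _ => .plain) b)
      (boundingCycle h) (.inhabitant h) .centre := by
  rintro ⟨e, e', he, he', hR⟩
  have key : ∀ d d', Relation.EqvGen (RegionStep (settlement m a fun _ => .plain)
      (embedding m a (fun _ => .plain) b) (boundingCycle h)) d d' →
      ((dartFace m a (fun _ => .plain) b d.1 d.2).IsLoc h ↔
        (dartFace m a (fun _ => .plain) b d'.1 d'.2).IsLoc h) := by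
    intro d d' hd
    induction hd with
    | rel d d' hd =>
      obtain hd | ⟨hl, h1, h2⟩ := hd
      · rw [hv.dartFace_step (by simp) hd]
      · have h3 := hv.isLink_iff.1 hl
        have h4 := plain_isLoc_iff hv hb h3.1 h2
        have h5 := (hv.isVertex_ends h3.1).2.2
        rw [h1]
        obtain ⟨-, h3 | h3⟩ := h3 <;> rw [h3] at h5
        · simp [dartFace, h3, h5, h4]
        · simp [dartFace, h3, h5, h4]
    | refl => rfl
    | symm _ _ _ ih => exact ih.symm
    | trans _ _ _ _ _ ih ih' => exact ih.trans ih'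
  have h1 := key _ _ hR
  obtain ⟨h2, h3⟩ := hv.inc_iff.1 he
  obtain ⟨h2', h3'⟩ := hv.inc_iff.1 he'
  have h4 : (dartFace m a (fun _ => .plain) b (.inhabitant h) e).IsLoc h := by
    cases e with
    | spoke j => simp [roleEnds] at h3
    | rim j => simp [roleEnds] at h3
    | wall h' k =>
      simp only [roleEnds, Role.wallEnds, houseVertex] at h3
      split_ifs at h3 <;> simp at h3
    | claw h' k =>
      have h5 : h' = h := by
        simp only [roleEnds, Role.clawEnds, houseVertex] at h3
        split_ifs at h3 <;> simpa using h3
      subst h5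
      have hk := h2.2
      simp only [Role.HasClaw] at hk
      have hk : k = 1 ∨ k = 2 ∨ k = 3 := by omega
      obtain rfl | rfl | rfl := hk <;>
      simp [dartFace, roleEnds, Role.clawEnds, edgeFaces, Role.clawFaces, hb, Face.IsLoc,
        Role.under, Role.midSecond, Role.above]
    | extra n => exact h2.2.elim
  have h5 : ¬ (dartFace m a (fun _ => .plain) b .centre e').IsLoc h := by
    cases e' with
    | spoke j => simp [dartFace, roleEnds, edgeFaces, Face.IsLoc]
    | rim j => simp [roleEnds] at h3'
    | wall h' k =>
      simp only [roleEnds, Role.wallEnds, houseVertex] at h3'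
      split_ifs at h3' <;> simp at h3'
    | claw h' k =>
      simp only [roleEnds, Role.clawEnds, houseVertex] at h3'
      split_ifs at h3' <;> simp at h3'
    | extra n => exact h2'.2.elim
  exact h5 (h1.1 h4)

theorem Valid.sameSide (hv : Valid m a fun _ => .plain) {h : ℕ} (hs : IsSite a h)
    (hb : b h = false) :
    SameSide (settlement m a fun _ => .plain) (embedding m a (fun _ => .plain) b)
      (boundingCycle h) (.inhabitant h) .centre := by
  classical
  have ha := hv.one_le
  have hm := hv.le
  have hs' := hs
  unfold IsSite at hs'
  have hp : 1 ≤ 4 * h - 3 ∧ 4 * h - 3 ≤ 4 * m := by omega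
  have hp' : 1 ≤ prev m (4 * h - 3) ∧ prev m (4 * h - 3) ≤ 4 * m := by
    unfold prev; split_ifs <;> omega
  have hp2 : prev m (4 * h - 3) ≠ 4 * h - 3 ∧ prev m (4 * h - 3) ≠ 4 * h - 2 := by
    unfold prev; split_ifs <;> omega
  have l1 : (settlement m a fun _ => .plain).IsLink (.claw h 1) (.inhabitant h) (.house h 2) :=
    hv.isLink_iff.2 ⟨⟨hs, by simp [Role.HasClaw]⟩, .inl rfl⟩
  have l2 : (settlement m a fun _ => .plain).IsLink (.wall h 1) (.house h 2)
      (.surface (4 * h - 3)) :=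
    hv.isLink_iff.2 ⟨⟨hs, by simp [Role.HasWall]⟩, .inr rfl⟩
  have l3 : (settlement m a fun _ => .plain).IsLink (.rim (prev m (4 * h - 3)))
      (.surface (4 * h - 3)) (.surface (prev m (4 * h - 3))) :=
    hv.isLink_iff.2 ⟨hp', .inr (by
      simp only [roleEnds, Prod.mk.injEq, Vertex.surface.injEq, true_and]
      unfold prev
      split_ifs <;> omega)⟩
  have l4 : (settlement m a fun _ => .plain).IsLink (.spoke (4 * h - 3)) (.surface (4 * h - 3))
      .centre := hv.isLink_iff.2 ⟨hp, .inr rfl⟩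
  have hcyc := (hv.isPlaneEmbedding (b := b) (by simp)).isCycleOn
  -- The route from an inhabitant outside: along the claw to v_2, down the first wall to s_{4h-3},
  -- across the rim edge before it, which is not on the bounding cycle, and along the spoke to the
  -- centre.
  refine ⟨.claw h 1, embedding m a (fun _ => .plain) b .centre (.spoke (4 * h - 3)),
    l1.inc_left, inc_rotation hcyc l4.inc_right, ?_⟩
  have r1 : embedding m a (fun _ => .plain) b (.house h 2) (.claw h 1) = .wall h 1 := by
    rw [embedding_house hs]
    simp [Role.houseRot, hb, List.formPerm_cons_cons, Equiv.swap_apply_def]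
  have r2 : embedding m a (fun _ => .plain) b (.surface (4 * h - 3)) (.wall h 1) =
      .rim (prev m (4 * h - 3)) := by
    rw [embedding_first ha hm hs]
    simp [Role.upFirst, List.formPerm_cons_cons, Equiv.swap_apply_def, hp2]
  refine .trans _ _ _ (.rel _ (.house h 2, .wall h 1) (.inl ⟨l1, r1.symm⟩)) ?_
  refine .trans _ _ _ (.rel _ (.surface (4 * h - 3), .rim (prev m (4 * h - 3)))
    (.inl ⟨l2, r2.symm⟩)) ?_
  refine .trans _ _ _ (.rel _ (.surface (prev m (4 * h - 3)), .rim (prev m (4 * h - 3)))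
    (.inr ⟨l3, rfl, by simp [boundingCycle, hp2]⟩)) ?_
  refine .trans _ _ _ (.rel _ (.surface (4 * h - 3), .spoke (4 * h - 3))
    (.inl ⟨l3.symm, (embedding_rim_prev hp).symm⟩)) ?_
  exact .rel _ _ (.inl ⟨l4, rfl⟩)

theorem Valid.isInside_iff (hv : Valid m a fun _ => .plain) {h : ℕ} (hs : IsSite a h) :
    IsInside (settlement m a fun _ => .plain) (embedding m a (fun _ => .plain) b) h ↔
      b h = true := by
  constructor
  · intro h1
    by_contra h2
    exact h1 (hv.sameSide hs (by simpa using h2))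
  · exact hv.not_sameSide

/-! ### The temporal sequence -/

theorem IsMinor.edgeSet_subset {α β : Type*} {G H : Graph α β} (h : IsMinor H G) :
    E(H) ⊆ E(G) := by
  obtain ⟨C, D, f, h⟩ := h
  exact fun e he => (h.mem_edgeSet_iff.1 he).1

/-- Two houses of neighbouring foundations can be swapped, but not both. -/
theorem validSwap_pairRole {g : ℕ} (h1 : ∀ h, swap h = true → h = g ∨ h = g + 1)
    (h2 : swap g = true → swap (g + 1) = false) : ValidSwap a (pairRole g) swap where
  mem_roles h _ := by
    unfold pairRole
    split_ifs <;> simp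
  not_bare h _ hr := by
    by_contra h3
    obtain rfl | rfl := h1 h (by simpa using h3)
    · simp [pairRole_left.2] at hr
    · simp [pairRole_right.2] at hr
  left h _ hr := by
    rw [pairRole_left] at hr
    subst hr
    exact h2
  right h _ hr := by
    rw [pairRole_right] at hr
    subst hr
    intro h3
    by_contra h4
    rw [Nat.add_sub_cancel, Bool.not_eq_false] at h4
    rw [h2 h4] at h3
    exact absurd h3 (by simp)

theorem validSwap_bare : ValidSwap a (fun _ => .bare) fun _ => false where
  mem_roles h _ := by simp
  not_bare h _ _ := rfl
  left h _ _ _ := rfl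
  right h _ _ _ := rfl

end TemporalGraph

/-! ### The nine graphs and their simultaneous embeddings -/

namespace TemporalGraph
open scoped Graph

variable {m a : ℕ} {role : ℕ → Role} {b swap : ℕ → Bool}

theorem Valid.not_isMinor {role' : ℕ → Role} (hv : Valid m a role) (hv' : Valid m a role')
    {e : Edge} (he : IsEdge m a role e) (he' : ¬ IsEdge m a role' e) :
    ¬ IsMinor (settlement m a role) (settlement m a role') := fun h =>
  he' (hv'.mem_edgeSet_iff.1 (h.edgeSet_subset (hv.mem_edgeSet_iff.2 he)))

/-- The graphs of the sequence. -/
noncomputable def stageGraph (m a : ℕ) (k : Fin 9) : Graph Vertex Edge :=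
  settlement m a (stage a k)

/-- A simultaneous embedding has to respect every minor relation between neighbours. Minors keep
edge labels, so one missing label rules out each relation in the unintended direction. -/
theorem stageGraph_not_isMinor (ha : 1 ≤ a) (hm : a + 2 ≤ m) :
    ¬ IsMinor (stageGraph m a 0) (stageGraph m a 1) ∧
    ¬ IsMinor (stageGraph m a 2) (stageGraph m a 1) ∧
    ¬ IsMinor (stageGraph m a 2) (stageGraph m a 3) ∧
    ¬ IsMinor (stageGraph m a 4) (stageGraph m a 3) ∧
    ¬ IsMinor (stageGraph m a 5) (stageGraph m a 4) ∧
    ¬ IsMinor (stageGraph m a 5) (stageGraph m a 6) ∧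
    ¬ IsMinor (stageGraph m a 7) (stageGraph m a 6) ∧
    ¬ IsMinor (stageGraph m a 8) (stageGraph m a 7) := by
  have hv := valid_stage ha hm
  have hs : IsSite a a := ⟨le_rfl, by omega⟩
  have hs' : IsSite a (a + 1) := ⟨by omega, by omega⟩
  have h1 := pairRole_left.2 (rfl : a = a)
  have h2 := pairRole_left.2 (rfl : a + 1 = a + 1)
  refine ⟨(hv 0).not_isMinor (hv 1) (e := .claw a 2) ?_ ?_,
    (hv 2).not_isMinor (hv 1) (e := .extra (3 * a)) ?_ ?_,
    (hv 2).not_isMinor (hv 3) (e := .extra (3 * a)) ?_ ?_,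
    (hv 4).not_isMinor (hv 3) (e := .wall a 1) ?_ ?_,
    (hv 5).not_isMinor (hv 4) (e := .extra (3 * (a + 1))) ?_ ?_,
    (hv 5).not_isMinor (hv 6) (e := .extra (3 * (a + 1))) ?_ ?_,
    (hv 7).not_isMinor (hv 6) (e := .wall a 1) ?_ ?_,
    (hv 8).not_isMinor (hv 7) (e := .claw a 2) ?_ ?_⟩ <;>
  simp [stage, IsEdge, hs, hs', Role.HasClaw, Role.HasWall, Role.HasExtra, three_mul_div, h1, h2]

/-- The consecutive pairs of graphs in the sequence, minors first. -/
def IsStep (k l : Fin 9) : Prop :=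
  (k = 1 ∧ l = 0) ∨ (k = 1 ∧ l = 2) ∨ (k = 3 ∧ l = 2) ∨ (k = 3 ∧ l = 4) ∨ (k = 4 ∧ l = 5) ∨
    (k = 6 ∧ l = 5) ∨ (k = 6 ∧ l = 7) ∨ (k = 7 ∧ l = 8)

theorem isStep_or {k l : Fin 9} (h : (l : ℕ) = k + 1) : IsStep k l ∨ IsStep l k := by
  revert h
  unfold IsStep
  revert k l
  decide

theorem isStep_of_isMinor (ha : 1 ≤ a) (hm : a + 2 ≤ m) {k l : Fin 9}
    (h : (l : ℕ) = k + 1 ∨ (k : ℕ) = l + 1) (hM : IsMinor (stageGraph m a k) (stageGraph m a l)) :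
    IsStep k l := by
  obtain ⟨h1, h2, h3, h4, h5, h6, h7, h8⟩ := stageGraph_not_isMinor ha hm
  have key : IsStep k l ∨ IsStep l k := by
    obtain h | h := h
    · exact isStep_or h
    · exact (isStep_or h).symm
  obtain h | h := key
  · exact h
  · exfalso
    obtain ⟨rfl, rfl⟩ | ⟨rfl, rfl⟩ | ⟨rfl, rfl⟩ | ⟨rfl, rfl⟩ | ⟨rfl, rfl⟩ | ⟨rfl, rfl⟩ |
      ⟨rfl, rfl⟩ | ⟨rfl, rfl⟩ := h <;> contradiction

/-- The embeddings of the sequence with given initial bits, and swaps at the contractions. -/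
noncomputable def stageEmbedding (m a : ℕ) (b swap swap' : ℕ → Bool) (k : Fin 9) :
    Vertex → Equiv.Perm Edge :=
  embedding m a (stage a k) (if k < 3 then b else if k < 6 then fun h => b h ^^ swap h
    else fun h => (b h ^^ swap h) ^^ swap' h)

theorem stage_hasHouse (k : Fin 9) (h3 : k ≠ 3) (h6 : k ≠ 6) (h : ℕ) :
    (stage a k h).HasHouse := by
  have key : ∀ g, (pairRole g h).HasHouse := by
    intro g
    unfold pairRole
    split_ifs <;> simp [Role.HasHouse]
  match k with
  | 2 => exact key a
  | 3 => exact absurd rfl h3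
  | 5 => exact key (a + 1)
  | 6 => exact absurd rfl h6
  | 0 | 1 | 4 | 7 | 8 => trivial

theorem induces_stage (ha : 1 ≤ a) (hm : a + 2 ≤ m) {swap' : ℕ → Bool}
    (hsw : ValidSwap a (pairRole a) swap) (hsw' : ValidSwap a (pairRole (a + 1)) swap')
    {k l : Fin 9} (h : IsStep k l) :
    InducesForSomeChoice (stageGraph m a k) (stageEmbedding m a b swap swap' k)
      (stageGraph m a l) (stageEmbedding m a b swap swap' l) := by
  have hv := valid_stage ha hm
  have hH := fun k h3 h6 h (_ : IsSite a h) => stage_hasHouse (a := a) k h3 h6 h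
  obtain ⟨rfl, rfl⟩ | ⟨rfl, rfl⟩ | ⟨rfl, rfl⟩ | ⟨rfl, rfl⟩ | ⟨rfl, rfl⟩ | ⟨rfl, rfl⟩ |
      ⟨rfl, rfl⟩ | ⟨rfl, rfl⟩ := h
  · exact (hv 0).induces_bare (hH 0 (by decide) (by decide))
  · exact (hv 2).induces_bare (hH 2 (by decide) (by decide))
  · exact (hv 2).induces_flat hsw
  · have := (hv 4).induces_flat (b := fun h => b h ^^ swap h) validSwap_bare
    simp only [Bool.xor_false] at this
    exact this
  · exact (hv 5).induces_bare (hH 5 (by decide) (by decide))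
  · exact (hv 5).induces_flat (b := fun h => b h ^^ swap h) hsw'
  · have := (hv 7).induces_flat (b := fun h => (b h ^^ swap h) ^^ swap' h) validSwap_bare
    simp only [Bool.xor_false] at this
    exact this
  · exact (hv 8).induces_bare (hH 8 (by decide) (by decide))

/-- The condition on the final bits is required by the last graph alone, whose spikes must be drawn
inside. -/
theorem isSimultaneousEmbedding_stage (ha : 1 ≤ a) (hm : a + 2 ≤ m) {swap' : ℕ → Bool}
    (hsw : ValidSwap a (pairRole a) swap) (hsw' : ValidSwap a (pairRole (a + 1)) swap')
    (hb : ∀ h, IsSite a h → ((b h ^^ swap h) ^^ swap' h) = true) :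
    IsSimultaneousEmbedding (stageGraph m a) (stageEmbedding m a b swap swap') := by
  refine ⟨fun k => (valid_stage ha hm k).isPlaneEmbedding ?_, fun k l h hM =>
    induces_stage ha hm hsw hsw' (isStep_of_isMinor ha hm h hM)⟩
  have key : ∀ g h, pairRole g h ≠ .spike := by
    intro g h
    unfold pairRole
    split_ifs <;> simp
  intro h hs hr
  match k with
  | 2 | 5 => exact absurd hr (key _ _)
  | 8 => exact hb h hs
  | 0 | 1 | 3 | 4 | 6 | 7 => simp [stage] at hr

theorem IsStep.isMinor (ha : 1 ≤ a) (hm : a + 2 ≤ m) {k l : Fin 9} (h : IsStep k l) :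
    IsMinor (stageGraph m a k) (stageGraph m a l) := by
  -- The minor relation itself is witnessed by straight contractions.
  have hsw : ∀ g, ValidSwap a (pairRole g) fun _ => false := fun g =>
    validSwap_pairRole (by simp) (by simp)
  obtain ⟨C, D, f, h, -⟩ := induces_stage (b := fun _ => true) ha hm (hsw _) (hsw _) h
  exact ⟨C, D, f, h⟩

theorem isIndefiniteTemporalSequence_stage (ha : 1 ≤ a) (hm : a + 2 ≤ m) :
    IsIndefiniteTemporalSequence (stageGraph m a) :=
  fun _ _ h => (isStep_or h).imp (IsStep.isMinor ha hm) (IsStep.isMinor ha hm)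

theorem IsSimultaneousEmbedding.induces (ha : 1 ≤ a) (hm : a + 2 ≤ m)
    {σ : Fin 9 → Vertex → Equiv.Perm Edge} (hσ : IsSimultaneousEmbedding (stageGraph m a) σ)
    {k l : Fin 9} (h : IsStep k l) :
    InducesForSomeChoice (stageGraph m a k) (σ k) (stageGraph m a l) (σ l) := by
  refine hσ.2 k l ?_ (h.isMinor ha hm)
  obtain ⟨rfl, rfl⟩ | ⟨rfl, rfl⟩ | ⟨rfl, rfl⟩ | ⟨rfl, rfl⟩ | ⟨rfl, rfl⟩ | ⟨rfl, rfl⟩ |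
      ⟨rfl, rfl⟩ | ⟨rfl, rfl⟩ := h <;> decide

theorem isIndefiniteSemiHousingSequence_stage (ha : 1 ≤ a) (hm : a + 2 ≤ m) :
    IsIndefiniteSemiHousingSequence {a, a + 1, a + 2} m (stageGraph m a) where
  index_subset := by
    intro h hh
    simp only [Finset.mem_insert, Finset.mem_singleton, Finset.mem_Icc] at hh ⊢
    omega
  vertexSet_finite _ := vertexSet_finite
  edgeSet_finite k := edgeSet_finite (valid_stage ha hm k)
  twoConnected k := (valid_stage ha hm k).twoConnected
  temporal := isIndefiniteTemporalSequence_stage ha hm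
  start := (village_eq hm).symm
  planet_le _ := planet_le_settlement
  degree_lt k _ _ hx := (valid_stage ha hm k).degree_lt hx

/-- Every allocation with an inhabitant inside is realised. -/
theorem exists_isSimultaneousEmbedding (ha : 1 ≤ a) (hm : a + 2 ≤ m)
    (hb : (b a || b (a + 1) || b (a + 2)) = true) :
    ∃ σ, IsSimultaneousEmbedding (stageGraph m a) σ ∧
      ∀ h, IsSite a h → (b h = true ↔ IsInside (stageGraph m a 0) (σ 0) h) := by
  classical
  -- The first pair serves `a` if its inhabitant is outside, and otherwise `a + 1` if needed.
  let swap : ℕ → Bool := fun h => (decide (h = a) && !b a) ||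
    (decide (h = a + 1) && b a && !b (a + 1))
  -- The second pair serves `a + 1` if the first one was occupied by `a`. In that case `a + 2` is
  -- inside by assumption, so no conflict arises.
  let swap' : ℕ → Bool := fun h => (decide (h = a + 1) && !b a && !b (a + 1)) ||
    (decide (h = a + 2) && (b a || b (a + 1)) && !b (a + 2))
  refine ⟨stageEmbedding m a b swap swap', isSimultaneousEmbedding_stage ha hm ?_ ?_ ?_, ?_⟩
  · refine validSwap_pairRole ?_ ?_
    · intro h hh
      simp only [swap, Bool.or_eq_true, Bool.and_eq_true, decide_eq_true_eq] at hh
      tauto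
    · simp only [swap]
      cases b a <;> simp
  · refine validSwap_pairRole ?_ ?_
    · intro h hh
      simp only [swap', Bool.or_eq_true, Bool.and_eq_true, decide_eq_true_eq] at hh
      tauto
    · simp only [swap']
      cases b a <;> cases b (a + 1) <;> simp
  · intro h hs
    have : h = a ∨ h = a + 1 ∨ h = a + 2 := by unfold IsSite at hs; omega
    obtain rfl | rfl | rfl := this
    · simp only [swap, swap']
      cases hh : b h <;> simp
    · simp only [swap, swap']
      cases hh : b a <;> cases hh' : b (a + 1) <;> simp
    · simp only [swap, swap']
      cases hh : b a <;> cases hh' : b (a + 1) <;> cases hh'' : b (a + 2) <;>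
        simp [hh, hh', hh''] at hb ⊢
  · intro h hs
    exact ((valid_stage ha hm 0).isInside_iff (b := b) hs).symm

end TemporalGraph

namespace TemporalGraph
open scoped Graph

variable {m a : ℕ} {role : ℕ → Role}

/-! ### Cycles of three and four elements -/

section Cycle

variable {β : Type*} {π : Equiv.Perm β}

/-- Rotators at vertices of small degree in an unknown embedding are enumerated, so that relations
between colours can be checked order by order. -/
theorem isCycleOn_three {a b c : β} (h : π.IsCycleOn {a, b, c}) (hab : a ≠ b) (hac : a ≠ c)
    (hbc : b ≠ c) : (π a = b ∧ π b = c ∧ π c = a) ∨ (π a = c ∧ π c = b ∧ π b = a) := by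
  classical
  have h' : π.IsCycleOn (({a, b, c} : Finset β) : Set β) := by simpa using h
  have hcard : ({a, b, c} : Finset β).card = 3 := Finset.card_eq_three.2 ⟨a, b, c, hab, hac, hbc, rfl⟩
  have ha : a ∈ ({a, b, c} : Finset β) := by simp
  have h1 := (h'.pow_apply_eq ha (n := 1)).not.2 (by rw [hcard]; norm_num)
  have h2 := (h'.pow_apply_eq ha (n := 2)).not.2 (by rw [hcard]; norm_num)
  have h3 := (h'.pow_apply_eq ha (n := 3)).2 (by rw [hcard])
  have m1 : π a ∈ ({a, b, c} : Set β) := h.1.mapsTo (by simp)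
  have m2 : π (π a) ∈ ({a, b, c} : Set β) := h.1.mapsTo m1
  have h12 : π (π a) ≠ π a := fun h => h1 (by simpa using h)
  simp only [pow_succ, pow_zero, one_mul, Equiv.Perm.mul_apply] at h1 h2 h3
  simp only [Set.mem_insert_iff, Set.mem_singleton_iff] at m1 m2
  clear h h' hcard ha
  grind

theorem isCycleOn_four {a b c d : β} (h : π.IsCycleOn {a, b, c, d}) (hd : [a, b, c, d].Nodup) :
    (π a = b ∧ π b = c ∧ π c = d ∧ π d = a) ∨ (π a = b ∧ π b = d ∧ π d = c ∧ π c = a) ∨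
    (π a = c ∧ π c = b ∧ π b = d ∧ π d = a) ∨ (π a = c ∧ π c = d ∧ π d = b ∧ π b = a) ∨
    (π a = d ∧ π d = b ∧ π b = c ∧ π c = a) ∨ (π a = d ∧ π d = c ∧ π c = b ∧ π b = a) := by
  classical
  have h' : π.IsCycleOn (({a, b, c, d} : Finset β) : Set β) := by simpa using h
  have hcard : ({a, b, c, d} : Finset β).card = 4 := by
    rw [← show [a, b, c, d].length = 4 from rfl, ← List.toFinset_card_of_nodup hd]
    congr 1
    ext x
    simp
  have ha : a ∈ ({a, b, c, d} : Finset β) := by simp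
  have h1 := (h'.pow_apply_eq ha (n := 1)).not.2 (by rw [hcard]; norm_num)
  have h2 := (h'.pow_apply_eq ha (n := 2)).not.2 (by rw [hcard]; norm_num)
  have h3 := (h'.pow_apply_eq ha (n := 3)).not.2 (by rw [hcard]; norm_num)
  have h4 := (h'.pow_apply_eq ha (n := 4)).2 (by rw [hcard])
  have m1 : π a ∈ ({a, b, c, d} : Set β) := h.1.mapsTo (by simp)
  have m2 : π (π a) ∈ ({a, b, c, d} : Set β) := h.1.mapsTo m1
  have m3 : π (π (π a)) ∈ ({a, b, c, d} : Set β) := h.1.mapsTo m2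
  have h12 : π (π a) ≠ π a := fun h => h1 (by simpa using h)
  have h23 : π (π (π a)) ≠ π (π a) := fun h => h12 (π.injective h)
  simp only [pow_succ, pow_zero, one_mul, Equiv.Perm.mul_apply] at h1 h2 h3 h4
  have h13 : π (π (π a)) ≠ π a := fun h => h2 (π.injective h)
  simp only [Set.mem_insert_iff, Set.mem_singleton_iff] at m1 m2 m3
  clear h h' hcard ha hd
  obtain m1 | m1 | m1 | m1 := m1 <;> rw [m1] at m2 m3 h1 h2 h3 h4 h12 h23 h13 <;>
    obtain m2 | m2 | m2 | m2 := m2 <;> rw [m2] at m3 h2 h3 h4 h12 h23 h13 <;>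
    obtain m3 | m3 | m3 | m3 := m3 <;> rw [m3] at h3 h4 h23 h13 <;>
    first | contradiction | simp only [m1, m2, m3, h4, and_self, true_or, or_true]

end Cycle

/-! ### Colourings -/

section Colouring

variable {α β : Type*} {G : Graph α β} {ρ : α → Equiv.Perm β} {K : Set β} {c : α × β → Bool}

/-- Around a vertex off `K` the colour is constant, and an edge between two such vertices does not
change it. This replaces a topological argument about paths disjoint from a cycle. -/
theorem IsColoring.eq_of_reachable (h : IsColoring G ρ K c)
    (hρ : ∀ v, (ρ v).IsCycleOn {e | G.Inc e v}) {S : Set α}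
    (hS : ∀ x ∈ S, ∀ e ∈ K, ¬ G.Inc e x) {x y : α} (hx : x ∈ S)
    (hxy : Relation.ReflTransGen (fun x y => y ∈ S ∧ G.Adj x y) x y) {e e' : β}
    (he : G.Inc e x) (he' : G.Inc e' y) : c (x, e) = c (y, e') := by
  induction hxy generalizing e' with
  | refl => exact h.const_at (hρ x) (hS x hx) he he'
  | tail _ hyz ih =>
    obtain ⟨hz, f, hf⟩ := hyz
    rw [ih hf.inc_left, (h.cross f _ _ hf).2 fun hK => hS _ hz f hK hf.inc_right]
    exact h.const_at (hρ _) (hS _ hz) hf.inc_right he'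

theorem IsColoring.eq_of_sameSide (h : IsColoring G ρ K c)
    (hρ : ∀ v, (ρ v).IsCycleOn {e | G.Inc e v}) {x y : α} (hx : ∀ e ∈ K, ¬ G.Inc e x)
    (hy : ∀ e ∈ K, ¬ G.Inc e y) (hs : SameSide G ρ K x y) {e e' : β} (he : G.Inc e x)
    (he' : G.Inc e' y) : c (x, e) = c (y, e') := by
  obtain ⟨f, f', hf, hf', hR⟩ := hs
  rw [h.const_at (hρ x) hx he hf, h.const_at (hρ y) hy he' hf']
  have key : ∀ d d', Relation.EqvGen (RegionStep G ρ K) d d' → c d = c d' := by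
    intro d d' hd
    induction hd with
    | rel d d' hd =>
      obtain ⟨h1, h2⟩ | ⟨h1, h2, h3⟩ := hd
      · have := h.face _ _ _ h1
        rw [← h2] at this
        exact this
      · have := (h.cross _ _ _ h1).2 h3
        rw [← h2] at this
        rw [show d' = (d'.1, d'.2) from rfl, ← this, h2]
    | refl => rfl
    | symm _ _ _ ih => exact ih.symm
    | trans _ _ _ _ _ ih ih' => exact ih.trans ih'
  exact key _ _ hR

theorem Joined.exists_exit {C : Set β} {x y : α} (h : Joined G C x y) {S : Set α} (hx : x ∈ S)
    (hy : y ∉ S) : ∃ e ∈ C, ∃ u ∈ S, ∃ v, v ∉ S ∧ G.IsLink e u v := by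
  by_contra hne
  push Not at hne
  exact hy (h.mem_of_closed (fun e he u v huv hu => by
    by_contra hv
    exact hne e he u hu v hv huv) hx)

end Colouring

/-! ### Edges of settlements -/

section Links

variable {h : ℕ}

theorem Valid.isLink_wall (hv : Valid m a role) (hs : IsSite a h) (hH : (role h).HasHouse) {k : ℕ}
    (h1 : 1 ≤ k) (h2 : k ≤ 6) : (settlement m a role).IsLink (.wall h k) (houseVertex h k)
      (houseVertex h (k + 1)) :=
  hv.isLink_iff.2 ⟨⟨hs, hH.hasWall.2 ⟨h1, h2⟩⟩, .inl (hH.wallEnds h k)⟩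

theorem Valid.isLink_claw_one (hv : Valid m a role) (hs : IsSite a h) (hH : (role h).HasHouse) :
    (settlement m a role).IsLink (.claw h 1) (.inhabitant h) (.house h 2) :=
  hv.isLink_iff.2 ⟨⟨hs, hH.hasClaw.1⟩, .inl (hH.clawEnds h).1⟩

theorem Valid.isLink_claw_three (hv : Valid m a role) (hs : IsSite a h)
    (hH : (role h).HasHouse) :
    (settlement m a role).IsLink (.claw h 3) (.inhabitant h) (.house h 6) :=
  hv.isLink_iff.2 ⟨⟨hs, hH.hasClaw.2⟩, .inl (hH.clawEnds h).2⟩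

theorem Valid.isLink_spoke (hv : Valid m a role) {j : ℕ} (h1 : 1 ≤ j) (h2 : j ≤ 4 * m) :
    (settlement m a role).IsLink (.spoke j) .centre (.surface j) :=
  hv.isLink_iff.2 ⟨⟨h1, h2⟩, .inl rfl⟩

theorem Valid.isLink_rim (hv : Valid m a role) {j : ℕ} (h1 : 1 ≤ j) (h2 : j < 4 * m) :
    (settlement m a role).IsLink (.rim j) (.surface j) (.surface (j + 1)) :=
  hv.isLink_iff.2 ⟨⟨h1, h2.le⟩, .inl (by simp [roleEnds, h2.ne])⟩

theorem Valid.isLink_rim_prev (hv : Valid m a role) {j : ℕ} (h1 : 1 ≤ j) (h2 : j ≤ 4 * m) :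
    (settlement m a role).IsLink (.rim (prev m j)) (.surface (prev m j)) (.surface j) := by
  refine hv.isLink_iff.2 ⟨?_, .inl ?_⟩
  · unfold prev IsEdge
    split_ifs <;> omega
  · simp only [roleEnds, Prod.mk.injEq, Vertex.surface.injEq, true_and]
    unfold prev
    split_ifs <;> omega

/-- The cycle of the inhabitant and the upper walls of a house. -/
def innerCycle (h : ℕ) : List Edge :=
  [.claw h 1, .wall h 2, .wall h 3, .wall h 4, .wall h 5, .claw h 3]

/-- A triangle of the planet. -/
def triangle (j : ℕ) : List Edge := [.spoke j, .rim j, .spoke (j + 1)]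

def boundingList (h : ℕ) : List Edge :=
  [.wall h 1, .wall h 2, .wall h 3, .wall h 4, .wall h 5, .wall h 6, .rim (4 * h - 2),
    .rim (4 * h - 3)]

theorem boundingCycle_eq (h : ℕ) : boundingCycle h = {e | e ∈ boundingList h} := by
  ext e
  simp only [boundingCycle, boundingList, Set.mem_ofPred_eq, List.mem_cons, List.not_mem_nil,
    or_false, Set.mem_Icc]
  constructor
  · rintro (⟨k, hk, rfl⟩ | rfl | rfl)
    · have : k = 1 ∨ k = 2 ∨ k = 3 ∨ k = 4 ∨ k = 5 ∨ k = 6 := by omega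
      obtain rfl | rfl | rfl | rfl | rfl | rfl := this <;> simp
    · simp
    · simp
  · rintro (rfl | rfl | rfl | rfl | rfl | rfl | rfl | rfl)
    all_goals first | exact .inl ⟨_, by omega, rfl⟩ | simp

variable {ρ : Vertex → Equiv.Perm Edge}

theorem Valid.exists_isColoring (hv : Valid m a role)
    (hρ : IsPlaneEmbedding (settlement m a role) ρ) {l : List Edge} (hl : l.Nodup) (hne : l ≠ [])
    {x : Vertex} (hw : IsWalk (settlement m a role) x l x) :
    ∃ c, IsColoring (settlement m a role) ρ {e | e ∈ l} c :=
  hρ.exists_isColoring vertexSet_finite (edgeSet_finite hv) hv.connected hv.loopless hl hne hw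

theorem Valid.exists_isColoring_innerCycle (hv : Valid m a role) (hs : IsSite a h)
    (hH : (role h).HasHouse) (hρ : IsPlaneEmbedding (settlement m a role) ρ) :
    ∃ c, IsColoring (settlement m a role) ρ {e | e ∈ innerCycle h} c := by
  refine hv.exists_isColoring hρ (x := .inhabitant h) (by simp [innerCycle]) (by simp [innerCycle])
    ⟨_, hv.isLink_claw_one hs hH, _, hv.isLink_wall hs hH (k := 2) (by omega) (by omega),
    _, hv.isLink_wall hs hH (k := 3) (by omega) (by omega),
    _, hv.isLink_wall hs hH (k := 4) (by omega) (by omega),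
    _, hv.isLink_wall hs hH (k := 5) (by omega) (by omega),
    _, (hv.isLink_claw_three hs hH).symm, rfl⟩

theorem Valid.exists_isColoring_triangle (hv : Valid m a role) {j : ℕ} (h1 : 1 ≤ j)
    (h2 : j < 4 * m) (hρ : IsPlaneEmbedding (settlement m a role) ρ) :
    ∃ c, IsColoring (settlement m a role) ρ {e | e ∈ triangle j} c :=
  hv.exists_isColoring hρ (x := .centre) (by simp [triangle]) (by simp [triangle])
    ⟨_, hv.isLink_spoke h1 h2.le, _, hv.isLink_rim h1 h2,
      _, (hv.isLink_spoke (by omega) (by omega)).symm, rfl⟩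

theorem Valid.exists_isColoring_boundingCycle (hv : Valid m a role) (hs : IsSite a h)
    (hH : (role h).HasHouse) (hρ : IsPlaneEmbedding (settlement m a role) ρ) :
    ∃ c, IsColoring (settlement m a role) ρ (boundingCycle h) c := by
  have ha := hv.one_le
  have hm := hv.le
  have hs' := hs
  unfold IsSite at hs'
  rw [boundingCycle_eq]
  have l1 := (hv.isLink_rim (j := 4 * h - 3) (by omega) (by omega)).symm
  have l2 := (hv.isLink_rim (j := 4 * h - 2) (by omega) (by omega)).symm
  rw [show 4 * h - 3 + 1 = 4 * h - 2 by omega] at l1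
  rw [show 4 * h - 2 + 1 = 4 * h - 1 by omega] at l2
  exact hv.exists_isColoring hρ (x := houseVertex h 1) (by simp [boundingList]; omega)
    (by simp [boundingList])
    ⟨_, hv.isLink_wall hs hH (k := 1) (by omega) (by omega),
    _, hv.isLink_wall hs hH (k := 2) (by omega) (by omega),
    _, hv.isLink_wall hs hH (k := 3) (by omega) (by omega),
    _, hv.isLink_wall hs hH (k := 4) (by omega) (by omega),
    _, hv.isLink_wall hs hH (k := 5) (by omega) (by omega),
    _, hv.isLink_wall hs hH (k := 6) (by omega) (by omega), _, l2, _, l1, rfl⟩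

end Links

end TemporalGraph

namespace TemporalGraph
open scoped Graph

variable {m a h : ℕ} {role : ℕ → Role} {ρ : Vertex → Equiv.Perm Edge}

/-! ### The bit of a house -/

/-- For colourings `c₀` and `c₁` of the inner cycle of a house and of the triangle below it, the
position of the inhabitant relative to the orientation of the planet, where `u` is an end of the second
wall. -/
def bit (h : ℕ) (u : Vertex) (c₀ c₁ : Vertex × Edge → Bool) : Bool :=
  (c₀ (u, .wall h 2) ^^ c₀ (.surface (4 * h - 3), .spoke (4 * h - 3))) ^^
    (c₁ (.surface (4 * h - 3), .rim (4 * h - 3)) ^^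
      c₁ (.surface (4 * h - 3), .rim (prev m (4 * h - 3))))

/-- The bit of a house in an embedding has a given value. -/
def HasBit (m : ℕ) (G : Graph Vertex Edge) (ρ : Vertex → Equiv.Perm Edge) (h : ℕ) (u : Vertex)
    (β : Bool) : Prop :=
  ∃ c₀ c₁, IsColoring G ρ {e | e ∈ innerCycle h} c₀ ∧
    IsColoring G ρ {e | e ∈ triangle (4 * h - 3)} c₁ ∧ bit (m := m) h u c₀ c₁ = β

theorem IsSite.bounds (hv : Valid m a role) (hs : IsSite a h) : 1 ≤ h ∧ h ≤ m := by
  have ha := hv.one_le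
  have hm := hv.le
  unfold IsSite at hs
  omega

/-- Each colouring enters the bit through a comparison of two of its own values, so exchanging its
colours has no effect. -/
theorem Valid.hasBit_unique (hv : Valid m a role) (hs : IsSite a h)
    (hρ : IsPlaneEmbedding (settlement m a role) ρ) {u : Vertex}
    (hu : (settlement m a role).Inc (.wall h 2) u) {β β' : Bool}
    (hβ : HasBit m (settlement m a role) ρ h u β) (hβ' : HasBit m (settlement m a role) ρ h u β') :
    β = β' := by
  have hb := hs.bounds hv
  obtain ⟨c₀, c₁, h0, h1, rfl⟩ := hβ
  obtain ⟨c₀', c₁', h0', h1', rfl⟩ := hβ'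
  unfold bit
  rw [h0.unique hv.connected hρ.isCycleOn h0' hu
      (hv.isLink_spoke (j := 4 * h - 3) (by omega) (by omega)).inc_right,
    h1.unique hv.connected hρ.isCycleOn h1'
      (hv.isLink_rim (j := 4 * h - 3) (by omega) (by omega)).inc_left
      (hv.isLink_rim_prev (j := 4 * h - 3) (by omega) (by omega)).inc_right]

theorem Valid.exists_hasBit (hv : Valid m a role) (hs : IsSite a h) (hH : (role h).HasHouse)
    (hρ : IsPlaneEmbedding (settlement m a role) ρ) (u : Vertex) :
    ∃ β, HasBit m (settlement m a role) ρ h u β := by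
  have hb := hs.bounds hv
  obtain ⟨c₀, h0⟩ := hv.exists_isColoring_innerCycle hs hH hρ
  obtain ⟨c₁, h1⟩ := hv.exists_isColoring_triangle (j := 4 * h - 3) (by omega) (by omega) hρ
  exact ⟨_, c₀, c₁, h0, h1, rfl⟩

/-! ### Vertices off cycles -/

/-- The vertices that are not on a cycle. -/
def offCycle (G : Graph Vertex Edge) (K : Set Edge) : Set Vertex := {x | ∀ e ∈ K, ¬ G.Inc e x}

theorem Valid.mem_offCycle_triangle (hv : Valid m a role) {j : ℕ} (hj : j < 4 * m) {x : Vertex}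
    (h0 : x ≠ .centre) (h1 : x ≠ .surface j) (h2 : x ≠ .surface (j + 1)) :
    x ∈ offCycle (settlement m a role) {e | e ∈ triangle j} := by
  intro e he
  rw [hv.inc_iff]
  simp only [triangle, Set.mem_ofPred_eq, List.mem_cons, List.not_mem_nil, or_false] at he
  obtain rfl | rfl | rfl := he <;>
    simp [roleEnds, h0.symm, h1.symm, h2.symm, hj.ne]

theorem Valid.mem_offCycle_innerCycle (hv : Valid m a role) (hH : (role h).HasHouse) (j : ℕ) :
    Vertex.surface j ∈ offCycle (settlement m a role) {e | e ∈ innerCycle h} := by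
  intro e he
  rw [hv.inc_iff]
  simp only [innerCycle, Set.mem_ofPred_eq, List.mem_cons, List.not_mem_nil, or_false] at he
  obtain rfl | rfl | rfl | rfl | rfl | rfl := he <;>
    simp [roleEnds, hH.wallEnds, hH.clawEnds, houseVertex]

theorem Valid.mem_offCycle_boundingCycle (hv : Valid m a role) (hs : IsSite a h)
    (hH : (role h).HasHouse) {x : Vertex} (h1 : ∀ k, x ≠ .house h k)
    (h2 : ∀ j, x = .surface j → j ≠ 4 * h - 3 ∧ j ≠ 4 * h - 2 ∧ j ≠ 4 * h - 1) :
    x ∈ offCycle (settlement m a role) (boundingCycle h) := by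
  have hb := hs.bounds hv
  intro e he
  rw [hv.inc_iff]
  have h4 : 4 * h - 3 + 1 = 4 * h - 2 := by omega
  have h5 : 4 * h - 2 + 1 = 4 * h - 1 := by omega
  have h6 : 4 * h - 2 ≠ 4 * m := by omega
  have h7 : 4 * h - 3 ≠ 4 * m := by omega
  have hS : ∀ j, j = 4 * h - 3 ∨ j = 4 * h - 2 ∨ j = 4 * h - 1 → Vertex.surface j ≠ x := by
    rintro j hj rfl
    have := h2 j rfl
    omega
  have hk : ∀ k, Vertex.house h k ≠ x := fun k hk => h1 k hk.symm
  rw [boundingCycle_eq] at he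
  simp only [boundingList, Set.mem_ofPred_eq, List.mem_cons, List.not_mem_nil, or_false] at he
  obtain rfl | rfl | rfl | rfl | rfl | rfl | rfl | rfl := he <;>
    simp [roleEnds, hH.wallEnds, houseVertex, h4, h5, h6, h7, hS, hk]

/-- Being joined by a path off a cycle. -/
def ReachOff (G : Graph Vertex Edge) (K : Set Edge) : Vertex → Vertex → Prop :=
  Relation.ReflTransGen fun x y => y ∈ offCycle G K ∧ G.Adj x y

theorem IsColoring.eq_of_reachOff {G : Graph Vertex Edge} {K : Set Edge} {c : Vertex × Edge → Bool}
    (h : IsColoring G ρ K c) (hρ : ∀ v, (ρ v).IsCycleOn {e | G.Inc e v}) {x y : Vertex}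
    (hx : x ∈ offCycle G K) (hxy : ReachOff G K x y) {e e' : Edge} (he : G.Inc e x)
    (he' : G.Inc e' y) : c (x, e) = c (y, e') :=
  h.eq_of_reachable hρ (S := offCycle G K) (fun _ hx => hx) hx hxy he he'

theorem Valid.reachOff_rim (hv : Valid m a role) {K : Set Edge} {i j : ℕ} (hi : 1 ≤ i) (hij : i ≤ j)
    (hj : j ≤ 4 * m)
    (hK : ∀ l, i ≤ l → l ≤ j → Vertex.surface l ∈ offCycle (settlement m a role) K) :
    ReachOff (settlement m a role) K (.surface i) (.surface j) := by
  induction j, hij using Nat.le_induction with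
  | base => exact .refl
  | succ j hij ih =>
    exact .tail (ih (by omega) fun l h1 h2 => hK l h1 (by omega))
      ⟨hK _ (by omega) le_rfl, _, hv.isLink_rim (by omega) (by omega)⟩

/-- From the second house vertex around the planet to the left neighbour of the house. -/
theorem Valid.reachOff_around (hv : Valid m a role) (hs : IsSite a h) (hH : (role h).HasHouse) :
    ReachOff (settlement m a role) {e | e ∈ triangle (4 * h - 3)} (.house h 2)
      (.surface (prev m (4 * h - 3))) := by
  have hb := hs.bounds hv
  have house : ∀ k, Vertex.house h k ∈ offCycle (settlement m a role)
      {e | e ∈ triangle (4 * h - 3)} := fun k =>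
    hv.mem_offCycle_triangle (by omega) (by simp) (by simp) (by simp)
  have surf : ∀ j, j ≠ 4 * h - 3 → j ≠ 4 * h - 2 →
      Vertex.surface j ∈ offCycle (settlement m a role) {e | e ∈ triangle (4 * h - 3)} :=
    fun j h1 h2 => hv.mem_offCycle_triangle (by omega) (by simp) (by simpa using h1)
      (by simp; omega)
  have h1 : ReachOff (settlement m a role) {e | e ∈ triangle (4 * h - 3)} (.house h 2)
      (.surface (4 * h - 1)) :=
    (((((Relation.ReflTransGen.refl.tail
      ⟨house 3, _, hv.isLink_wall hs hH (k := 2) (by omega) (by omega)⟩).tail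
      ⟨house 4, _, hv.isLink_wall hs hH (k := 3) (by omega) (by omega)⟩).tail
      ⟨house 5, _, hv.isLink_wall hs hH (k := 4) (by omega) (by omega)⟩).tail
      ⟨house 6, _, hv.isLink_wall hs hH (k := 5) (by omega) (by omega)⟩).tail
      ⟨surf (4 * h - 1) (by omega) (by omega), _,
        hv.isLink_wall hs hH (k := 6) (by omega) (by omega)⟩)
  have h2 := h1.trans (hv.reachOff_rim (K := {e | e ∈ triangle (4 * h - 3)}) (i := 4 * h - 1)
    (j := 4 * m) (by omega) (by omega) le_rfl fun l h3 h4 => surf l (by omega) (by omega))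
  -- For the first foundation, the left neighbour on the rim is s_{4m}, already reached; otherwise
  -- the path continues through the closing rim edge to s_1.
  by_cases h3 : 4 * h - 3 = 1
  · rw [prev, if_pos h3]
    exact h2
  · have l1 := hv.isLink_rim_prev (j := 1) le_rfl (by omega)
    simp only [prev, if_true] at l1
    have h4 := h2.tail ⟨surf 1 (by omega) (by omega), _, l1⟩
    refine h4.trans ?_
    rw [prev, if_neg h3]
    exact hv.reachOff_rim le_rfl (by omega) (by omega) fun l _ _ => surf l (by omega) (by omega)

/-- The bit of a bare house tells whether the inhabitant is outside. -/
theorem Valid.hasBit_bare (hv : Valid m a fun _ => .bare) (hs : IsSite a h)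
    (hρ : IsPlaneEmbedding (settlement m a fun _ => .bare) ρ) {c : Vertex × Edge → Bool}
    (hc : IsColoring (settlement m a fun _ => .bare) ρ (boundingCycle h) c) :
    HasBit m (settlement m a fun _ => .bare) ρ h (.house h 2)
      (c (.house h 2, .claw h 1) == c (.surface (4 * h - 3), .spoke (4 * h - 3))) := by
  classical
  have hb := hs.bounds hv
  have ha := hv.one_le
  have hm := hv.le
  have hH : ((fun _ => .bare : ℕ → Role) h).HasHouse := trivial
  obtain ⟨c₀, h0⟩ := hv.exists_isColoring_innerCycle hs hH hρ
  obtain ⟨c₁, h1⟩ := hv.exists_isColoring_triangle (j := 4 * h - 3) (by omega) (by omega) hρ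
  refine ⟨c₀, c₁, h0, h1, ?_⟩
  obtain ⟨p, hp⟩ : ∃ p, p = 4 * h - 3 := ⟨_, rfl⟩
  have hcyc := hρ.isCycleOn
  have hprev : prev m p ≠ p ∧ prev m p ≠ p + 1 ∧ prev m p ≠ p + 2 ∧ 1 ≤ prev m p ∧
      prev m p ≤ 4 * m := by
    unfold prev; split_ifs <;> omega
  have ls := hv.isLink_spoke (j := p) (by omega) (by omega)
  have ls' := hv.isLink_spoke (j := prev m p) (by omega) (by omega)
  have lr := hv.isLink_rim (j := p) (by omega) (by omega)
  have lr' := hv.isLink_rim_prev (j := p) (by omega) (by omega)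
  have lw1 := hv.isLink_wall hs hH (k := 1) le_rfl (by omega)
  have lw2 := hv.isLink_wall hs hH (k := 2) (by omega) (by omega)
  have lc := hv.isLink_claw_one hs hH
  simp only [houseVertex, ← hp] at lw1 lw2
  norm_num at lw1 lw2
  -- the colours around the first surface vertex
  have hset : {e | (settlement m a fun _ => .bare).Inc e (.surface p)} =
      {.spoke p, .rim p, .wall h 1, .rim (prev m p)} := by
    ext e
    have h2 : (p + 3) / 4 = h := by omega
    have h3 : p % 4 = 1 := by omega
    have h4 : 1 ≤ p ∧ p ≤ 4 * m := by omega
    rw [Set.mem_ofPred_eq, ← hv.mem_rotator_iff (b := fun _ => true)]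
    simp [rotator, up, h2, h3, h4, hs, Role.upFirst]
  have hset2 : {e | (settlement m a fun _ => .bare).Inc e (.house h 2)} =
      {.wall h 1, .wall h 2, .claw h 1} := by
    ext e
    rw [Set.mem_ofPred_eq, ← hv.mem_rotator_iff (b := fun _ => true)]
    simp [rotator_house, hs, Role.houseRot]
    tauto
  have hp4 := hcyc (.surface p)
  rw [hset] at hp4
  have hp3 := hcyc (.house h 2)
  rw [hset2] at hp3
  -- The centre and the left neighbour of the house are adjacent and both off the bounding cycle.
  have e1 : c (.surface p, .spoke p) = c (.surface p, .rim (prev m p)) := by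
    have hoff : ∀ x, (∀ k, x ≠ .house h k) → (∀ j, x = .surface j → j ≠ p ∧ j ≠ p + 1 ∧ j ≠ p + 2) →
        x ∈ offCycle (settlement m a fun _ => .bare) (boundingCycle h) := fun x h1 h2 =>
      hv.mem_offCycle_boundingCycle hs hH h1 fun j hj => by have := h2 j hj; omega
    rw [← (hc.cross _ _ _ lr').2 (by simp [boundingCycle]; omega),
      ← (hc.cross _ _ _ ls).2 (by simp [boundingCycle])]
    exact hc.eq_of_reachOff hcyc (hoff _ (by simp) (by simp))
      (.single ⟨hoff (.surface (prev m p)) (by simp) (by simpa using ⟨hprev.1, hprev.2.1, hprev.2.2.1⟩),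
        _, ls'⟩)
      ls.inc_left lr'.inc_left
  -- The path over the house and around the planet shows that both edges leave the triangle to the
  -- same side.
  have e2 : c₁ (.surface p, .wall h 1) = c₁ (.surface p, .rim (prev m p)) := by
    rw [(h1.cross _ _ _ lw1).2 (by simp [triangle]),
      ← (h1.cross _ _ _ lr').2 (by simp [triangle]; omega)]
    have := hv.reachOff_around hs hH
    rw [← hp] at this
    exact h1.eq_of_reachOff hcyc
      (hv.mem_offCycle_triangle (by omega) (by simp) (by simp) (by simp))
      (by rw [← hp]; exact this) lw1.inc_right lr'.inc_left
  have e3 : c₀ (.house h 2, .wall h 1) = c₀ (.surface p, .spoke p) := by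
    rw [← (h0.cross _ _ _ lw1).2 (by simp [innerCycle])]
    exact h0.const_at (hcyc _) (hv.mem_offCycle_innerCycle hH p) lw1.inc_left ls.inc_right
  have e4 : c (.surface p, .wall h 1) = !c (.house h 2, .wall h 1) := by
    have := (hc.cross _ _ _ lw1).not.2 (by simp [boundingCycle])
    revert this
    cases c (.surface p, .wall h 1) <;> cases c (.house h 2, .wall h 1) <;> simp
  -- how the colours change
  have cs := hc.same ls.inc_right (by simp [boundingCycle])
  have cr := hc.flip lr.inc_left (by simp [boundingCycle, hp])
  have cw := hc.flip lw1.inc_left (by simp [boundingCycle])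
  have cr' := hc.same lr'.inc_right (by simp [boundingCycle]; omega)
  have ds := h1.flip ls.inc_right (by simp [triangle, hp])
  have dr := h1.flip lr.inc_left (by simp [triangle, hp])
  have dw := h1.same lw1.inc_left (by simp [triangle])
  have dr' := h1.same lr'.inc_right (by simp [triangle]; omega)
  have fw1 := h0.same lw1.inc_right (by simp [innerCycle])
  have fw2 := h0.flip lw2.inc_left (by simp [innerCycle])
  have fc := h0.flip lc.inc_right (by simp [innerCycle])
  have gw1 := hc.flip lw1.inc_right (by simp [boundingCycle])
  have gw2 := hc.flip lw2.inc_left (by simp [boundingCycle])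
  have gc := hc.same lc.inc_right (by simp [boundingCycle])
  -- Of the six cyclic orders at s_{4h-3}, `e1` and `e2` leave only the expected one and its mirror
  -- image. In both, the orientation term can be rewritten through the bounding cycle.
  have key1 : (c₁ (.surface p, .rim p) ^^ c₁ (.surface p, .rim (prev m p))) =
      (c (.surface p, .wall h 1) ^^ c (.surface p, .spoke p)) := by
    have hnd : [Edge.spoke p, .rim p, .wall h 1, .rim (prev m p)].Nodup := by
      simp
      omega
    obtain ⟨q1, q2, q3, q4⟩ | ⟨q1, q2, q3, q4⟩ | ⟨q1, q2, q3, q4⟩ | ⟨q1, q2, q3, q4⟩ |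
      ⟨q1, q2, q3, q4⟩ | ⟨q1, q2, q3, q4⟩ := isCycleOn_four hp4 hnd <;>
    simp only [q1, q2, q3, q4] at cs cr cw cr' ds dr dw dr' <;>
    clear q1 q2 q3 q4 <;> simp_all
  -- At v_2, both orders of the three edges satisfy this, since the inner cycle and the bounding
  -- cycle share `wall h 2` there.
  have key2 : (c₀ (.house h 2, .wall h 2) ^^ c₀ (.surface p, .spoke p)) =
      (c (.house h 2, .claw h 1) ^^ c (.house h 2, .wall h 1)) := by
    obtain ⟨q1, q2, q3⟩ | ⟨q1, q2, q3⟩ := isCycleOn_three hp3 (by simp) (by simp) (by simp) <;>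
    rw [← e3] <;>
    simp only [q1, q2, q3] at fw1 fw2 fc gw1 gw2 gc <;>
    revert fw1 fw2 fc gw1 gw2 gc <;>
    generalize c₀ (Vertex.house h 2, Edge.wall h 1) = x1 <;>
    generalize c₀ (Vertex.house h 2, Edge.wall h 2) = x2 <;>
    generalize c₀ (Vertex.house h 2, Edge.claw h 1) = x3 <;>
    generalize c (Vertex.house h 2, Edge.wall h 1) = y1 <;>
    generalize c (Vertex.house h 2, Edge.wall h 2) = y2 <;>
    generalize c (Vertex.house h 2, Edge.claw h 1) = y3 <;>
    revert x1 x2 x3 y1 y2 y3 <;> decide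
  unfold bit
  rw [← hp, key1, key2, e4]
  cases c (.house h 2, .claw h 1) <;> cases c (.house h 2, .wall h 1) <;>
    cases c (.surface p, .spoke p) <;> rfl

end TemporalGraph

namespace TemporalGraph
open scoped Graph

variable {m a h : ℕ} {role role' : ℕ → Role} {ρ ρ' : Vertex → Equiv.Perm Edge} {C D : Set Edge}
  {f : Vertex → Vertex}

/-! ### Bits of minors -/

/-- All spokes survive with their labels and ends. The centre is recognised as the common end of two
of them, and this fixes the other ends. -/
theorem Valid.map_planet (hv : Valid m a role) (hv' : Valid m a role')
    (hmin : IsMinorVia (settlement m a role') (settlement m a role) C D f) :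
    f .centre = .centre ∧ ∀ j, 1 ≤ j → j ≤ 4 * m → f (.surface j) = .surface j := by
  have hm := hv.le
  have key : ∀ j, 1 ≤ j → j ≤ 4 * m → (f .centre = .centre ∧ f (.surface j) = .surface j) ∨
      (f .centre = .surface j ∧ f (.surface j) = .centre) := by
    intro j h1 h2
    have h3 := hmin.isLink_map (hv'.isLink_spoke h1 h2).edge_mem (hv.isLink_spoke h1 h2)
    exact h3.eq_and_eq_or_eq_and_eq (hv'.isLink_spoke h1 h2)
  have hc : f .centre = .centre := by
    obtain h1 | h1 := key 1 le_rfl (by omega)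
    · exact h1.1
    · obtain h2 | h2 := key 2 (by omega) (by omega)
      · exact h2.1
      · have := h1.1.symm.trans h2.1
        simp at this
  refine ⟨hc, fun j h1 h2 => ?_⟩
  obtain h3 | h3 := key j h1 h2
  · exact h3.2
  · rw [hc] at h3
    exact absurd h3.1 (by simp)

/-- Neither the inner cycle nor the triangle loses an edge by deletion, so both colourings descend,
and the four darts in the bit keep their colours. The end `u` of the second wall has to be followed
along `f`. -/
theorem Valid.hasBit_of_minor (hv : Valid m a role) (hv' : Valid m a role')
    (hρ : IsPlaneEmbedding (settlement m a role) ρ)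
    (hmin : IsMinorVia (settlement m a role') (settlement m a role) C D f)
    (hi : IsInducedVia (settlement m a role') ρ' (settlement m a role) ρ C D f)
    (hs : IsSite a h) (hD : ∀ e ∈ innerCycle h, e ∉ D)
    (hw : Edge.wall h 2 ∈ E(settlement m a role')) {u : Vertex}
    (hu : (settlement m a role).Inc (.wall h 2) u) {β : Bool}
    (hβ : HasBit m (settlement m a role) ρ h u β) :
    HasBit m (settlement m a role') ρ' h (f u) β := by
  have hb := hs.bounds hv
  have hD1 : ∀ e ∈ triangle (4 * h - 3), e ∉ D := by
    intro e he
    refine (hmin.mem_edgeSet_iff.1 ?_).2.2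
    simp only [triangle, List.mem_cons, List.not_mem_nil, or_false] at he
    obtain rfl | rfl | rfl := he
    · exact (hv'.isLink_spoke (by omega) (by omega)).edge_mem
    · exact (hv'.isLink_rim (by omega) (by omega)).edge_mem
    · exact (hv'.isLink_spoke (by omega) (by omega)).edge_mem
  obtain ⟨c₀, c₁, h0, h1, rfl⟩ := hβ
  obtain ⟨c₀', h0', k0⟩ := hmin.exists_isColoring hi hv'.loopless hρ.isCycleOn h0 hD
  obtain ⟨c₁', h1', k1⟩ := hmin.exists_isColoring hi hv'.loopless hρ.isCycleOn h1 hD1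
  refine ⟨c₀', c₁', h0', h1', ?_⟩
  have hf := (hv.map_planet hv' hmin).2 (4 * h - 3) (by omega) (by omega)
  have r1 := k0 _ hw u hu
  have r2 := k0 _ (hv'.isLink_spoke (j := 4 * h - 3) (by omega) (by omega)).edge_mem _
    (hv.isLink_spoke (j := 4 * h - 3) (by omega) (by omega)).inc_right
  have r3 := k1 _ (hv'.isLink_rim (j := 4 * h - 3) (by omega) (by omega)).edge_mem _
    (hv.isLink_rim (j := 4 * h - 3) (by omega) (by omega)).inc_left
  have r4 := k1 _ (hv'.isLink_rim_prev (j := 4 * h - 3) (by omega) (by omega)).edge_mem _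
    (hv.isLink_rim_prev (j := 4 * h - 3) (by omega) (by omega)).inc_right
  rw [hf] at r2 r3 r4
  unfold bit
  rw [r1, r2, r3, r4]

theorem Valid.map_house_two (hv : Valid m a role)
    (hmin : IsMinorVia (settlement m a fun _ => .bare) (settlement m a role) C D f)
    (hs : IsSite a h) (hH : (role h).HasHouse) : f (.house h 2) = .house h 2 := by
  have hb := hs.bounds hv
  have hf := (hv.map_planet hv.bare hmin).2 (4 * h - 3) (by omega) (by omega)
  have l1 := hv.bare.isLink_wall hs (by trivial) (k := 1) le_rfl (by omega)
  have l2 := hmin.isLink_map l1.edge_mem (hv.isLink_wall hs hH (k := 1) le_rfl (by omega))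
  simp only [houseVertex] at l1 l2
  norm_num at l1 l2
  obtain h1 | h1 := l2.eq_and_eq_or_eq_and_eq l1
  · exact h1.2
  · rw [hf] at h1
    simp at h1

theorem Valid.hasBit_of_bare_minor (hv : Valid m a role)
    (hρ : IsPlaneEmbedding (settlement m a role) ρ)
    (hmin : IsMinorVia (settlement m a fun _ => .bare) (settlement m a role) C D f)
    (hi : IsInducedVia (settlement m a fun _ => .bare) ρ' (settlement m a role) ρ C D f)
    (hs : IsSite a h) (hH : (role h).HasHouse) {β : Bool}
    (hβ : HasBit m (settlement m a role) ρ h (.house h 2) β) :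
    HasBit m (settlement m a fun _ => .bare) ρ' h (.house h 2) β := by
  have hw : ∀ k, 1 ≤ k → k ≤ 6 → Edge.wall h k ∈ E(settlement m a fun _ => .bare) :=
    fun k h1 h2 => (hv.bare.isLink_wall hs (by trivial) h1 h2).edge_mem
  have := hv.hasBit_of_minor hv.bare hρ hmin hi hs ?_ (hw 2 (by omega) (by omega))
    (hv.isLink_wall hs hH (k := 2) (by omega) (by omega)).inc_left hβ
  · simp only [houseVertex] at this
    norm_num at this
    rwa [hv.map_house_two hmin hs hH] at this
  · intro e he
    refine (hmin.mem_edgeSet_iff.1 ?_).2.2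
    simp only [innerCycle, List.mem_cons, List.not_mem_nil, or_false] at he
    obtain rfl | rfl | rfl | rfl | rfl | rfl := he
    · exact (hv.bare.isLink_claw_one hs (by trivial)).edge_mem
    · exact hw 2 (by omega) (by omega)
    · exact hw 3 (by omega) (by omega)
    · exact hw 4 (by omega) (by omega)
    · exact hw 5 (by omega) (by omega)
    · exact (hv.bare.isLink_claw_three hs (by trivial)).edge_mem

/-! ### Contractions -/

/-- The roles of the graphs that are contracted. -/
def Contractible (a : ℕ) (role : ℕ → Role) : Prop :=
  ∀ h, IsSite a h → role h = .bare ∨ role h = .left ∨ role h = .right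

theorem Contractible.hasHouse (hr : Contractible a role) (hs : IsSite a h) :
    (role h).HasHouse := by
  obtain h1 | h1 | h1 := hr h hs <;> simp [h1, Role.HasHouse]

theorem Valid.isLink_flat (hv : Valid m a role) (hs : IsSite a h) :
    (settlement m a fun _ => .flat).IsLink (.claw h 1) (.surface (4 * h - 3))
      (.surface (4 * h - 1)) ∧ (settlement m a fun _ => .flat).IsLink (.wall h 2)
      (.surface (4 * h - 3)) (.surface (4 * h - 1)) :=
  ⟨hv.flat.isLink_iff.2 ⟨⟨hs, rfl⟩, .inl rfl⟩, hv.flat.isLink_iff.2 ⟨⟨hs, rfl⟩, .inl rfl⟩⟩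

section Contraction

variable (hv : Valid m a role) (hr : Contractible a role)
  (hmin : IsMinorVia (settlement m a fun _ => .flat) (settlement m a role) C D f)
  (hs : IsSite a h)

include hmin in
theorem map_contracted {e : Edge} {x y : Vertex} (he : e ∈ C)
    (hl : (settlement m a role).IsLink e x y) : f x = f y :=
  (hmin.eq_iff _ hl.left_mem _ hl.right_mem).2 (.single ⟨e, he, hl⟩)

include hv hmin hs in
theorem not_contracted : Edge.claw h 1 ∉ C ∧ Edge.wall h 2 ∉ C :=
  ⟨(hmin.mem_edgeSet_iff.1 (hv.isLink_flat hs).1.edge_mem).2.1,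
    (hmin.mem_edgeSet_iff.1 (hv.isLink_flat hs).2.edge_mem).2.1⟩

include hv hr hmin hs in
/-- A house is contracted in the straight or in the swapped way. -/
theorem map_house_cases :
    (f (.house h 2) = .surface (4 * h - 3) ∧ f (.house h 3) = .surface (4 * h - 1) ∧
      f (.inhabitant h) = .surface (4 * h - 1)) ∨
    (f (.house h 2) = .surface (4 * h - 1) ∧ f (.house h 3) = .surface (4 * h - 3) ∧
      f (.inhabitant h) = .surface (4 * h - 3)) := by
  have hb := hs.bounds hv
  have hH := hr.hasHouse hs
  obtain ⟨l1, l2⟩ := hv.isLink_flat hs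
  have l1' := hmin.isLink_map l1.edge_mem (hv.isLink_claw_one hs hH)
  have l2' := hmin.isLink_map l2.edge_mem
    (hv.isLink_wall hs hH (k := 2) (by omega) (by omega))
  simp only [houseVertex] at l2'
  norm_num at l2'
  have hne : Vertex.surface (4 * h - 3) ≠ .surface (4 * h - 1) := by simp; omega
  -- Both surviving edges have v_2 as an end, so its image decides both alternatives and two of the
  -- four combinations contradict each other.
  obtain ⟨h1, h2⟩ | ⟨h1, h2⟩ := l1'.eq_and_eq_or_eq_and_eq l1 <;>
    obtain ⟨h3, h4⟩ | ⟨h3, h4⟩ := l2'.eq_and_eq_or_eq_and_eq l2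
  · exact absurd (h3.symm.trans h2) hne
  · exact .inr ⟨h3, h4, h1⟩
  · exact .inl ⟨h3, h4, h1⟩
  · exact absurd (h2.symm.trans h3) hne

include hv hmin hs in
/-- A set of vertices of a house that is contracted to the surface is left by a contracted edge. -/
theorem exists_contracted {x : Vertex} {S : Set Vertex} (hx : x ∈ V(settlement m a role))
    (hS : ∀ j, Vertex.surface j ∉ S) (hxS : x ∈ S)
    (hf : f x = .surface (4 * h - 3) ∨ f x = .surface (4 * h - 1)) :
    ∃ e ∈ C, ∃ u ∈ S, ∃ v, v ∉ S ∧ (settlement m a role).IsLink e u v := by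
  have hb := hs.bounds hv
  have hfj := (hv.map_planet hv.flat hmin).2
  have key : ∀ j, 1 ≤ j → j ≤ 4 * m → f x = .surface j →
      ∃ e ∈ C, ∃ u ∈ S, ∃ v, v ∉ S ∧ (settlement m a role).IsLink e u v := by
    intro j h1 h2 h3
    have h4 : Joined (settlement m a role) C x (.surface j) :=
      (hmin.eq_iff _ hx (.surface j) ⟨h1, h2⟩).1 (by rw [h3, hfj j h1 h2])
    exact h4.exists_exit hxS (hS j)
  obtain hf | hf := hf
  · exact key _ (by omega) (by omega) hf
  · exact key _ (by omega) (by omega) hf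

include hv hs in
theorem inc_house (hH : (role h).HasHouse) {e : Edge} (hp : role h ≠ .plain) :
    ((settlement m a role).Inc e (.inhabitant h) → role h ≠ .spike → e = .claw h 1 ∨ e = .claw h 3) ∧
    ((settlement m a role).Inc e (.house h 3) → e = .wall h 2 ∨ e = .wall h 3) ∧
    ((settlement m a role).Inc e (.house h 4) → e = .wall h 3 ∨ e = .wall h 4) ∧
    ((settlement m a role).Inc e (.house h 5) → e = .wall h 4 ∨ e = .wall h 5) := by
  rw [← hv.mem_rotator_iff (b := fun _ => true), ← hv.mem_rotator_iff (b := fun _ => true),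
    ← hv.mem_rotator_iff (b := fun _ => true), ← hv.mem_rotator_iff (b := fun _ => true)]
  cases hr : role h <;> simp [hr, Role.HasHouse] at hH hp <;>
    simp [rotator_house, rotator_inhabitant, hs, hr, Role.houseRot, Role.inhabitantRot] <;> tauto

-- Since v_3 and w are merged into the rim, contracted edges must lead out of {w}, {v_3}, {v_3, v_4}
-- and {v_3, v_4, v_5}. As `claw h 1` and `wall h 2` survive, each of these sets has a single
-- possible exit.
include hv hr hmin hs in
theorem contracted_walls : Edge.claw h 3 ∈ C ∧ Edge.wall h 3 ∈ C ∧ Edge.wall h 4 ∈ C ∧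
    Edge.wall h 5 ∈ C := by
  have hH := hr.hasHouse hs
  have hp : role h ≠ .plain ∧ role h ≠ .spike := by
    obtain h1 | h1 | h1 := hr h hs <;> simp [h1]
  have hinc := fun e => inc_house hv hs hH (e := e) hp.1
  obtain ⟨n1, n2⟩ := not_contracted hv hmin hs
  have hcases := map_house_cases hv hr hmin hs
  have l3 := hv.isLink_wall hs hH (k := 3) (by omega) (by omega)
  have l4 := hv.isLink_wall hs hH (k := 4) (by omega) (by omega)
  simp only [houseVertex] at l3 l4
  norm_num at l3 l4
  have hv3 : Vertex.house h 3 ∈ V(settlement m a role) := l3.left_mem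
  have hf3 : f (.house h 3) = .surface (4 * h - 3) ∨ f (.house h 3) = .surface (4 * h - 1) := by
    tauto
  have c3 : Edge.wall h 3 ∈ C := by
    obtain ⟨e, he, u, rfl, v, hvS, hl⟩ := exists_contracted hv hmin hs (S := {.house h 3}) hv3
      (by simp) rfl hf3
    obtain rfl | rfl := (hinc e).2.1 hl.inc_left
    · exact absurd he n2
    · exact he
  have c4 : Edge.wall h 4 ∈ C := by
    obtain ⟨e, he, u, hu, v, hvS, hl⟩ := exists_contracted hv hmin hs
      (S := {.house h 3, .house h 4}) hv3 (by simp) (by simp) hf3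
    have h1 : e ≠ .wall h 3 := by
      rintro rfl
      obtain ⟨rfl, rfl⟩ | ⟨rfl, rfl⟩ := hl.eq_and_eq_or_eq_and_eq l3 <;> simp at hvS
    obtain rfl | rfl := hu
    · obtain rfl | rfl := (hinc e).2.1 hl.inc_left
      · exact absurd he n2
      · exact absurd rfl h1
    · obtain rfl | rfl := (hinc e).2.2.1 hl.inc_left
      · exact absurd rfl h1
      · exact he
  refine ⟨?_, c3, c4, ?_⟩
  · obtain ⟨e, he, u, rfl, v, hvS, hl⟩ := exists_contracted hv hmin hs (S := {.inhabitant h})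
      (hv.isLink_claw_one hs hH).left_mem (by simp) rfl (by tauto)
    obtain rfl | rfl := (hinc e).1 hl.inc_left hp.2
    · exact absurd he n1
    · exact he
  · obtain ⟨e, he, u, hu, v, hvS, hl⟩ := exists_contracted hv hmin hs
      (S := {.house h 3, .house h 4, .house h 5}) hv3 (by simp) (by simp) hf3
    have h1 : e ≠ .wall h 3 := by
      rintro rfl
      obtain ⟨rfl, rfl⟩ | ⟨rfl, rfl⟩ := hl.eq_and_eq_or_eq_and_eq l3 <;> simp at hvS
    have h2 : e ≠ .wall h 4 := by
      rintro rfl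
      obtain ⟨rfl, rfl⟩ | ⟨rfl, rfl⟩ := hl.eq_and_eq_or_eq_and_eq l4 <;> simp at hvS
    obtain rfl | rfl | rfl := hu
    · obtain rfl | rfl := (hinc e).2.1 hl.inc_left
      · exact absurd he n2
      · exact absurd rfl h1
    · obtain rfl | rfl := (hinc e).2.2.1 hl.inc_left
      · exact absurd rfl h1
      · exact absurd rfl h2
    · obtain rfl | rfl := (hinc e).2.2.2 hl.inc_left
      · exact absurd rfl h2
      · exact he

include hv hr hmin hs in
theorem map_house_six : f (.house h 6) = f (.house h 3) := by
  have hH := hr.hasHouse hs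
  obtain ⟨-, c3, c4, c5⟩ := contracted_walls hv hr hmin hs
  have l3 := map_contracted hmin c3 (hv.isLink_wall hs hH (k := 3) (by omega) (by omega))
  have l4 := map_contracted hmin c4 (hv.isLink_wall hs hH (k := 4) (by omega) (by omega))
  have l5 := map_contracted hmin c5 (hv.isLink_wall hs hH (k := 5) (by omega) (by omega))
  exact ((l3.trans l4).trans l5).symm

open scoped Classical in
include hv hr hmin hs in
/-- The bit of a house changes if and only if the house is contracted in the swapped way. -/
theorem hasBit_of_flat_minor (hρ : IsPlaneEmbedding (settlement m a role) ρ)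
    (hi : IsInducedVia (settlement m a fun _ => .flat) ρ' (settlement m a role) ρ C D f)
    {β : Bool} (hβ : HasBit m (settlement m a role) ρ h (.house h 2) β) :
    HasBit m (settlement m a fun _ => .flat) ρ' h (.surface (4 * h - 3))
      (β ^^ decide (f (.house h 2) = .surface (4 * h - 1))) := by
  have hb := hs.bounds hv
  have hH := hr.hasHouse hs
  have hne : Vertex.surface (4 * h - 3) ≠ .surface (4 * h - 1) := by simp; omega
  obtain ⟨c1, c2, c3, c4⟩ := contracted_walls hv hr hmin hs
  have hC : ∀ e ∈ C, e ∉ D := fun e he h => Set.disjoint_left.1 hmin.disjoint he h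
  obtain ⟨l1, l2⟩ := hv.isLink_flat hs
  have hD : ∀ e ∈ innerCycle h, e ∉ D := by
    intro e he
    simp only [innerCycle, List.mem_cons, List.not_mem_nil, or_false] at he
    obtain rfl | rfl | rfl | rfl | rfl | rfl := he
    · exact (hmin.mem_edgeSet_iff.1 l1.edge_mem).2.2
    · exact (hmin.mem_edgeSet_iff.1 l2.edge_mem).2.2
    all_goals exact hC _ (by assumption)
  have lw := hv.isLink_wall hs hH (k := 2) (by omega) (by omega)
  simp only [houseVertex] at lw
  norm_num at lw
  obtain ⟨h1, -⟩ | ⟨h1, h2, -⟩ := map_house_cases hv hr hmin hs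
  · have := hv.hasBit_of_minor hv.flat hρ hmin hi hs hD l2.edge_mem lw.inc_left hβ
    rw [h1] at this ⊢
    simpa [hne] using this
  · have hβ' : HasBit m (settlement m a role) ρ h (.house h 3) (!β) := by
      obtain ⟨c₀, c₁, h0, h1, rfl⟩ := hβ
      refine ⟨c₀, c₁, h0, h1, ?_⟩
      have h3 := (h0.cross _ _ _ lw).not.2 (by simp [innerCycle])
      unfold bit
      revert h3
      cases c₀ (.house h 2, .wall h 2) <;> cases c₀ (.house h 3, .wall h 2) <;> simp
    have := hv.hasBit_of_minor hv.flat hρ hmin hi hs hD l2.edge_mem lw.inc_right hβ'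
    rw [h2] at this
    rw [h1]
    simpa using this

-- The only edge through which v_2 of a bare house can be merged into the rim is the first wall, and
-- that leads to s_{4h-3}.
include hv hr hmin hs in
theorem not_swapped_of_bare (hbare : role h = .bare) :
    f (.house h 2) ≠ .surface (4 * h - 1) := by
  intro hf
  have hb := hs.bounds hv
  have hH := hr.hasHouse hs
  obtain ⟨n1, n2⟩ := not_contracted hv hmin hs
  have lw := hv.isLink_wall hs hH (k := 1) le_rfl (by omega)
  simp only [houseVertex] at lw
  norm_num at lw
  obtain ⟨e, he, u, rfl, v, hvS, hl⟩ := exists_contracted hv hmin hs (S := {.house h 2})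
    lw.right_mem (by simp) rfl (.inr hf)
  have h1 := hv.mem_rotator_iff (b := fun _ => true).2 hl.inc_left
  simp only [rotator_house, hs, hbare, Role.houseRot, if_true, cond_true, List.mem_cons,
    List.not_mem_nil, or_false] at h1
  obtain rfl | rfl | rfl := h1
  · exact n2 he
  · have h2 := map_contracted hmin he lw
    rw [hf, (hv.map_planet hv.flat hmin).2 _ (by omega) (by omega)] at h2
    simp at h2
    omega
  · exact n1 he

-- A crossed v_2 cannot use the first wall, so it leaves through the edge to the shared vertex,
-- which is therefore merged with it.
include hv hr hmin hs in
theorem map_extra_of_left (hl : role h = .left) (hf : f (.house h 2) = .surface (4 * h - 1)) :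
    f (.extra h) = .surface (4 * h - 1) := by
  have hb := hs.bounds hv
  have hH := hr.hasHouse hs
  obtain ⟨n1, n2⟩ := not_contracted hv hmin hs
  have lw := hv.isLink_wall hs hH (k := 1) le_rfl (by omega)
  simp only [houseVertex] at lw
  norm_num at lw
  have lk : (settlement m a role).IsLink (.extra (3 * h + 1)) (.house h 2) (.extra h) :=
    hv.isLink_iff.2 (by simp [IsEdge, three_mul_div, hs, hl, Role.HasExtra, roleEnds,
      Role.extraEnds])
  obtain ⟨e, he, u, rfl, v, hvS, hl'⟩ := exists_contracted hv hmin hs (S := {.house h 2})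
    lw.right_mem (by simp) rfl (.inr hf)
  have h1 := hv.mem_rotator_iff (b := fun _ => true).2 hl'.inc_left
  simp only [rotator_house, hs, hl, Role.houseRot, if_true, cond_true, List.mem_cons,
    List.not_mem_nil, or_false] at h1
  obtain rfl | rfl | rfl | rfl := h1
  · exact absurd he n2
  · rw [← map_contracted hmin he lk, hf]
  · have h2 := map_contracted hmin he lw
    rw [hf, (hv.map_planet hv.flat hmin).2 _ (by omega) (by omega)] at h2
    simp at h2
    omega
  · exact absurd he n1

-- In the mirrored situation it is the merged set {v_3, ..., v_6, w} that has to leave. Its last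
-- wall leads to the wrong end of the foundation, so the exit is the edge from v_6 to the shared
-- vertex.
include hv hr hmin hs in
theorem map_extra_of_right (hl : role h = .right) (hf : f (.house h 2) = .surface (4 * h - 1)) :
    f (.extra (h - 1)) = .surface (4 * h - 3) := by
  have hb := hs.bounds hv
  have hH := hr.hasHouse hs
  have hne : Vertex.surface (4 * h - 3) ≠ .surface (4 * h - 1) := by simp; omega
  obtain ⟨n1, n2⟩ := not_contracted hv hmin hs
  have hinc := fun e => inc_house hv hs hH (e := e) (by simp [hl])
  have lw := fun k h1 h2 => hv.isLink_wall hs hH (k := k) h1 h2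
  have l3 := lw 3 (by omega) (by omega)
  have l4 := lw 4 (by omega) (by omega)
  have l5 := lw 5 (by omega) (by omega)
  have l6 := lw 6 (by omega) (by omega)
  have lc := hv.isLink_claw_three hs hH
  simp only [houseVertex] at l3 l4 l5 l6
  norm_num at l3 l4 l5 l6
  have lk : (settlement m a role).IsLink (.extra (3 * h + 1)) (.house h 6) (.extra (h - 1)) :=
    hv.isLink_iff.2 (by simp [IsEdge, three_mul_div, hs, hl, Role.HasExtra, roleEnds,
      Role.extraEnds])
  have h3 : f (.house h 3) = .surface (4 * h - 3) := by
    obtain h1 | h1 := map_house_cases hv hr hmin hs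
    · exact absurd (h1.1.symm.trans hf) hne
    · exact h1.2.1
  have h6 := (map_house_six hv hr hmin hs).trans h3
  obtain ⟨e, he, u, hu, v, hvS, hl'⟩ := exists_contracted hv hmin hs
    (S := {.house h 3, .house h 4, .house h 5, .house h 6, .inhabitant h})
    l3.left_mem (by simp) (by simp) (.inl h3)
  have hint : ∀ e' x y, (settlement m a role).IsLink e' x y →
      x ∈ ({.house h 3, .house h 4, .house h 5, .house h 6, .inhabitant h} : Set Vertex) →
      y ∈ ({.house h 3, .house h 4, .house h 5, .house h 6, .inhabitant h} : Set Vertex) →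
      e ≠ e' := by
    rintro e' x y hxy hx hy rfl
    obtain ⟨rfl, rfl⟩ | ⟨rfl, rfl⟩ := hl'.eq_and_eq_or_eq_and_eq hxy
    · exact hvS hy
    · exact hvS hx
  have i3 := hint _ _ _ l3 (by simp) (by simp)
  have i4 := hint _ _ _ l4 (by simp) (by simp)
  have i5 := hint _ _ _ l5 (by simp) (by simp)
  have ic := hint _ _ _ lc (by simp) (by simp)
  obtain rfl | rfl | rfl | rfl | rfl := hu
  · obtain rfl | rfl := (hinc e).2.1 hl'.inc_left
    · exact absurd he n2
    · exact absurd rfl i3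
  · obtain rfl | rfl := (hinc e).2.2.1 hl'.inc_left
    · exact absurd rfl i3
    · exact absurd rfl i4
  · obtain rfl | rfl := (hinc e).2.2.2 hl'.inc_left
    · exact absurd rfl i4
    · exact absurd rfl i5
  · have h1 := hv.mem_rotator_iff (b := fun _ => true).2 hl'.inc_left
    simp only [rotator_house, hs, hl, Role.houseRot, if_true, cond_true, List.mem_cons,
      List.not_mem_nil, or_false] at h1
    obtain rfl | rfl | rfl | rfl := h1
    · have h2 := map_contracted hmin he l6
      rw [h6, (hv.map_planet hv.flat hmin).2 _ (by omega) (by omega)] at h2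
      exact absurd h2 hne
    · rw [← map_contracted hmin he lk, h6]
    · exact absurd rfl i5
    · exact absurd rfl ic
  · obtain rfl | rfl := (hinc e).1 hl'.inc_left (by simp [hl])
    · exact absurd he n1
    · exact absurd rfl ic

include hv hr hmin hs in
/-- Neighbouring houses that share an extra vertex are not both swapped. -/
theorem not_swapped_both (hl : role h = .left) (hf : f (.house h 2) = .surface (4 * h - 1)) :
    f (.house (h + 1) 2) ≠ .surface (4 * (h + 1) - 1) := by
  intro hf'
  have h1 := hv.right_of_left h hs hl
  have h2 := map_extra_of_left hv hr hmin hs hl hf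
  have h3 := map_extra_of_right hv hr hmin h1.1 h1.2 hf'
  rw [Nat.add_sub_cancel, h2] at h3
  have := hs.bounds hv
  simp at h3
  omega

end Contraction

end TemporalGraph

namespace TemporalGraph
open scoped Graph

variable {m a h : ℕ} {role : ℕ → Role} {ρ ρ' : Vertex → Equiv.Perm Edge} {C D : Set Edge}
  {f : Vertex → Vertex} {c : Vertex × Edge → Bool}

/-! ### The bits at both ends of the sequence -/

/-- The whole bounding cycle survives in the bare graph, so its colouring descends to the place
where inside and outside determine the bit. -/
theorem Valid.hasBit_of_isColoring (hv : Valid m a role)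
    (hρ : IsPlaneEmbedding (settlement m a role) ρ)
    (hρ' : IsPlaneEmbedding (settlement m a fun _ => .bare) ρ')
    (hmin : IsMinorVia (settlement m a fun _ => .bare) (settlement m a role) C D f)
    (hi : IsInducedVia (settlement m a fun _ => .bare) ρ' (settlement m a role) ρ C D f)
    (hs : IsSite a h) (hH : (role h).HasHouse)
    (hc : IsColoring (settlement m a role) ρ (boundingCycle h) c) :
    HasBit m (settlement m a fun _ => .bare) ρ' h (.house h 2)
      (c (.inhabitant h, .claw h 1) == c (.centre, .spoke (4 * h - 3))) := by
  have hb := hs.bounds hv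
  have hD : ∀ e ∈ boundingCycle h, e ∉ D := by
    intro e he
    refine (hmin.mem_edgeSet_iff.1 ?_).2.2
    obtain ⟨k, hk, rfl⟩ | rfl | rfl := he
    · exact (hv.bare.isLink_wall hs trivial hk.1 hk.2).edge_mem
    · exact (hv.bare.isLink_rim (by omega) (by omega)).edge_mem
    · exact (hv.bare.isLink_rim (by omega) (by omega)).edge_mem
  obtain ⟨c', hc', k⟩ := hmin.exists_isColoring hi hv.bare.loopless hρ.isCycleOn hc hD
  have ls := hv.isLink_spoke (j := 4 * h - 3) (by omega) (by omega)
  have r1 := k _ (hv.bare.isLink_claw_one hs trivial).edge_mem _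
    (hv.isLink_claw_one hs hH).inc_right
  have r2 := k _ (hv.bare.isLink_spoke (j := 4 * h - 3) (by omega) (by omega)).edge_mem _
    ls.inc_right
  rw [hv.map_house_two hmin hs hH] at r1
  rw [(hv.map_planet hv.bare hmin).2 _ (by omega) (by omega)] at r2
  rw [(hc.cross _ _ _ (hv.isLink_claw_one hs hH)).2 (by simp [boundingCycle]),
    (hc.cross _ _ _ ls).2 (by simp [boundingCycle]), ← r1, ← r2]
  exact hv.bare.hasBit_bare hs hρ' hc'

/-- If the inhabitant is outside, then the bit of its house is `true`. -/
theorem Valid.hasBit_of_not_isInside (hv : Valid m a role)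
    (hρ : IsPlaneEmbedding (settlement m a role) ρ)
    (hρ' : IsPlaneEmbedding (settlement m a fun _ => .bare) ρ')
    (hmin : IsMinorVia (settlement m a fun _ => .bare) (settlement m a role) C D f)
    (hi : IsInducedVia (settlement m a fun _ => .bare) ρ' (settlement m a role) ρ C D f)
    (hs : IsSite a h) (hH : (role h).HasHouse) (hout : ¬ IsInside (settlement m a role) ρ h) :
    HasBit m (settlement m a fun _ => .bare) ρ' h (.house h 2) true := by
  have hb := hs.bounds hv
  obtain ⟨c, hc⟩ := hv.exists_isColoring_boundingCycle hs hH hρ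
  have h1 := hv.hasBit_of_isColoring hρ hρ' hmin hi hs hH hc
  have h2 := hc.eq_of_sameSide hρ.isCycleOn
    (hv.mem_offCycle_boundingCycle hs hH (by simp) (by simp))
    (hv.mem_offCycle_boundingCycle hs hH (by simp) (by simp)) (not_not.1 hout)
    (hv.isLink_claw_one hs hH).inc_left
    (hv.isLink_spoke (j := 4 * h - 3) (by omega) (by omega)).inc_left
  rwa [h2, beq_self_eq_true] at h1

/-- The bounding cycle of a house separates its centre from an inhabitant who is attached to the planet. -/
theorem Valid.ne_of_spike (hv : Valid m a role) (hρ : IsPlaneEmbedding (settlement m a role) ρ)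
    (hs : IsSite a h) (hr : role h = .spike)
    (hc : IsColoring (settlement m a role) ρ (boundingCycle h) c) :
    c (.inhabitant h, .claw h 1) ≠ c (.centre, .spoke (4 * h - 3)) := by
  classical
  have hb := hs.bounds hv
  have hH : (role h).HasHouse := by simp [hr, Role.HasHouse]
  obtain ⟨p, hp⟩ : ∃ p, p = 4 * h - 3 := ⟨_, rfl⟩
  have hcyc := hρ.isCycleOn
  obtain ⟨c₁, h1⟩ := hv.exists_isColoring_triangle (j := p) (by omega) (by omega) hρ
  obtain ⟨c₂, h2⟩ := hv.exists_isColoring_triangle (j := p + 1) (by omega) (by omega) hρ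
  have ls := hv.isLink_spoke (j := p) (by omega) (by omega)
  have ls' := hv.isLink_spoke (j := p + 1) (by omega) (by omega)
  have lr := hv.isLink_rim (j := p) (by omega) (by omega)
  have lr' := hv.isLink_rim (j := p + 1) (by omega) (by omega)
  have lw1 := hv.isLink_wall hs hH (k := 1) le_rfl (by omega)
  have lw6 := hv.isLink_wall hs hH (k := 6) (by omega) le_rfl
  have lc1 := hv.isLink_claw_one hs hH
  have lc3 := hv.isLink_claw_three hs hH
  have lc2 : (settlement m a role).IsLink (.claw h 2) (.inhabitant h) (.surface (p + 1)) :=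
    hv.isLink_iff.2 ⟨⟨hs, by simp [hr, Role.HasClaw]⟩, .inl (by
      simp [roleEnds, hr, Role.clawEnds]; omega)⟩
  have hq : 4 * h - 1 = p + 1 + 1 := by omega
  simp only [houseVertex, ← hp, hq] at lw1 lw6
  norm_num at lw1 lw6
  have hset : {e | (settlement m a role).Inc e (.surface (p + 1))} =
      {.spoke (p + 1), .rim (p + 1), .claw h 2, .rim p} := by
    ext e
    have h3 : (p + 1 + 3) / 4 = h := by omega
    have h4 : (p + 1) % 4 = 2 := by omega
    have h5 : 1 ≤ p + 1 ∧ p + 1 ≤ 4 * m := by omega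
    have h6 : p ≠ 0 := by omega
    rw [Set.mem_ofPred_eq, ← hv.mem_rotator_iff (b := fun _ => true)]
    simp [rotator, up, h3, h4, h5.2, h6, hs, hr, Role.upSecond, prev]
  have hp4 := hcyc (.surface (p + 1))
  rw [hset] at hp4
  -- From w a path through v_6 to s_{4h-1} avoids the first triangle; symmetrically, a path through
  -- v_2 to s_{4h-3} avoids the second one.
  have e1 : c₁ (.surface (p + 1), .claw h 2) = c₁ (.surface (p + 1), .rim (p + 1)) := by
    rw [← (h1.cross _ _ _ lc2).2 (by simp [triangle]),
      (h1.cross _ _ _ lr').2 (by simp [triangle])]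
    have off := fun x => hv.mem_offCycle_triangle (j := p) (x := x) (by omega)
    exact h1.eq_of_reachOff hcyc (off _ (by simp) (by simp) (by simp))
      ((Relation.ReflTransGen.single ⟨off _ (by simp) (by simp) (by simp), _, lc3⟩).tail
        ⟨off _ (by simp) (by simp; omega) (by simp), _, lw6⟩) lc2.inc_left lr'.inc_right
  have e2 : c₂ (.surface (p + 1), .claw h 2) = c₂ (.surface (p + 1), .rim p) := by
    rw [← (h2.cross _ _ _ lc2).2 (by simp [triangle]),
      ← (h2.cross _ _ _ lr).2 (by simp [triangle])]
    have off := fun x => hv.mem_offCycle_triangle (j := p + 1) (x := x) (by omega)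
    exact h2.eq_of_reachOff hcyc (off _ (by simp) (by simp) (by simp))
      ((Relation.ReflTransGen.single ⟨off _ (by simp) (by simp) (by simp), _, lc1⟩).tail
        ⟨off _ (by simp) (by simp) (by simp; omega), _, lw1.symm⟩) lc2.inc_left lr.inc_left
  have off : ∀ x, (∀ k, x ≠ .house h k) → (∀ j, x ≠ .surface j) →
      x ∈ offCycle (settlement m a role) (boundingCycle h) := fun x h1 h2 =>
    hv.mem_offCycle_boundingCycle hs hH h1 fun j hj => absurd hj (h2 j)
  rw [← hp, hc.const_at (hcyc _) (off _ (by simp) (by simp)) lc1.inc_left lc2.inc_left,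
    hc.const_at (hcyc _) (off .centre (by simp) (by simp)) ls.inc_left ls'.inc_left,
    (hc.cross _ _ _ lc2).2 (by simp [boundingCycle]),
    (hc.cross _ _ _ ls').2 (by simp [boundingCycle])]
  have cs := hc.same ls'.inc_right (by simp [boundingCycle])
  have cr := hc.flip lr.inc_right (by simp [boundingCycle, hp])
  have cr' := hc.flip lr'.inc_left (by simp [boundingCycle]; omega)
  have cn := hc.same lc2.inc_right (by simp [boundingCycle])
  have ds := h1.flip ls'.inc_right (by simp [triangle])
  have dr := h1.flip lr.inc_right (by simp [triangle])
  have dr' := h1.same lr'.inc_left (by simp [triangle])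
  have dn := h1.same lc2.inc_right (by simp [triangle])
  have fs := h2.flip ls'.inc_right (by simp [triangle])
  have fr := h2.same lr.inc_right (by simp [triangle])
  have fr' := h2.flip lr'.inc_left (by simp [triangle])
  have fn := h2.same lc2.inc_right (by simp [triangle])
  clear hset hcyc
  -- Only the orders in which the claw edge and the spoke alternate with the two rim edges are
  -- compatible with `e1` and `e2`; there, the bounding cycle separates claw and spoke.
  obtain ⟨q1, q2, q3, q4⟩ | ⟨q1, q2, q3, q4⟩ | ⟨q1, q2, q3, q4⟩ | ⟨q1, q2, q3, q4⟩ |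
    ⟨q1, q2, q3, q4⟩ | ⟨q1, q2, q3, q4⟩ := isCycleOn_four hp4 (by simp) <;>
  simp only [q1, q2, q3, q4] at cs cr cr' cn ds dr dr' dn fs fr fr' fn <;>
  clear q1 q2 q3 q4 <;> grind

theorem Valid.hasBit_of_spike (hv : Valid m a role)
    (hρ : IsPlaneEmbedding (settlement m a role) ρ)
    (hρ' : IsPlaneEmbedding (settlement m a fun _ => .bare) ρ')
    (hmin : IsMinorVia (settlement m a fun _ => .bare) (settlement m a role) C D f)
    (hi : IsInducedVia (settlement m a fun _ => .bare) ρ' (settlement m a role) ρ C D f)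
    (hs : IsSite a h) (hr : role h = .spike) :
    HasBit m (settlement m a fun _ => .bare) ρ' h (.house h 2) false := by
  have hH : (role h).HasHouse := by simp [hr, Role.HasHouse]
  obtain ⟨c, hc⟩ := hv.exists_isColoring_boundingCycle hs hH hρ
  have h1 := hv.hasBit_of_isColoring hρ hρ' hmin hi hs hH hc
  rwa [beq_eq_false_iff_ne.2 (hv.ne_of_spike hρ hs hr hc)] at h1

end TemporalGraph

namespace TemporalGraph
open scoped Graph

variable {m a : ℕ} {σ : Fin 9 → Vertex → Equiv.Perm Edge}

/-! ### The allocation set -/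

theorem contractible_pairRole (g : ℕ) : Contractible a (pairRole g) := by
  intro h _
  unfold pairRole
  split_ifs <;> simp

/-- Between two bare graphs, at most one of the two houses that share an extra vertex changes its bit. -/
theorem exists_swap (ha : 1 ≤ a) (hm : a + 2 ≤ m) {g : ℕ} (h1 : a ≤ g) (h2 : g ≤ a + 1)
    {ρ₁ ρ₂ ρ₃ ρ₄ : Vertex → Equiv.Perm Edge}
    (hρ₁ : IsPlaneEmbedding (settlement m a fun _ => .bare) ρ₁)
    (hρ₂ : IsPlaneEmbedding (settlement m a (pairRole g)) ρ₂)
    (hρ₃ : IsPlaneEmbedding (settlement m a fun _ => .flat) ρ₃)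
    (hρ₄ : IsPlaneEmbedding (settlement m a fun _ => .bare) ρ₄)
    (h₁₂ : InducesForSomeChoice (settlement m a fun _ => .bare) ρ₁ (settlement m a (pairRole g)) ρ₂)
    (h₃₂ : InducesForSomeChoice (settlement m a fun _ => .flat) ρ₃ (settlement m a (pairRole g)) ρ₂)
    (h₃₄ : InducesForSomeChoice (settlement m a fun _ => .flat) ρ₃
      (settlement m a fun _ => .bare) ρ₄) :
    ∃ s : ℕ → Bool, (∀ h, s h = true → IsSite a h → h = g ∨ h = g + 1) ∧
      (s g = true → s (g + 1) = false) ∧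
      ∀ h β, IsSite a h → HasBit m (settlement m a fun _ => .bare) ρ₁ h (.house h 2) β →
        HasBit m (settlement m a fun _ => .bare) ρ₄ h (.house h 2) (β ^^ s h) := by
  classical
  have hv := valid_pairRole ha hm h1 h2
  have hr : Contractible a (pairRole g) := contractible_pairRole g
  have hr' : Contractible a fun _ => .bare := fun _ _ => .inl rfl
  obtain ⟨C, D, f, hmin, hi⟩ := h₁₂
  obtain ⟨C', D', f', hmin', hi'⟩ := h₃₂
  obtain ⟨C'', D'', f'', hmin'', hi''⟩ := h₃₄
  -- The houses crossed in the contraction of the joined pair.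
  refine ⟨fun h => decide (f' (.house h 2) = .surface (4 * h - 1)), ?_, ?_, ?_⟩
  · intro h hh hs
    by_contra hne
    have hbare : pairRole g h = .bare := by
      unfold pairRole
      split_ifs <;> tauto
    exact not_swapped_of_bare hv hr hmin' hs hbare (of_decide_eq_true hh)
  · intro hh
    exact decide_eq_false (not_swapped_both hv hr hmin' ⟨h1, by omega⟩ (pairRole_left.2 rfl)
      (of_decide_eq_true hh))
  · intro h β hs hβ
    have hw : (settlement m a fun _ => Role.bare).Inc (.wall h 2) (.house h 2) :=
      (hv.bare.isLink_wall hs trivial (k := 2) (by omega) (by omega)).inc_left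
    obtain ⟨β₂, hβ₂⟩ := hv.exists_hasBit hs (hr.hasHouse hs) hρ₂ (.house h 2)
    obtain rfl := hv.bare.hasBit_unique hs hρ₁ hw
      (hv.hasBit_of_bare_minor hρ₂ hmin hi hs (hr.hasHouse hs) hβ₂) hβ
    -- The flat graph receives its bit from both neighbours. The bare side contracts straight, so
    -- uniqueness transfers the possibly changed bit unaltered to the second bare graph.
    have k1 := hasBit_of_flat_minor hv hr hmin' hs hρ₂ hi' hβ₂
    obtain ⟨β₄, hβ₄⟩ := hv.bare.exists_hasBit hs trivial hρ₄ (.house h 2)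
    have k2 := hasBit_of_flat_minor hv.bare hr' hmin'' hs hρ₄ hi'' hβ₄
    rw [decide_eq_false (not_swapped_of_bare hv.bare hr' hmin'' hs rfl), Bool.xor_false] at k2
    rwa [hv.flat.hasBit_unique hs hρ₃ (hv.isLink_flat hs).2.inc_left k1 k2]

/-- In every simultaneous embedding, some inhabitant is inside at the start. -/
theorem exists_isInside (ha : 1 ≤ a) (hm : a + 2 ≤ m)
    (hσ : IsSimultaneousEmbedding (stageGraph m a) σ) :
    ∃ h, IsSite a h ∧ IsInside (stageGraph m a 0) (σ 0) h := by
  by_contra hne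
  push Not at hne
  have hv := valid_stage ha hm
  have hi := fun k l (h : IsStep k l) => hσ.induces ha hm h
  obtain ⟨C, D, f, hmin, hind⟩ := hi 1 0 (by simp [IsStep])
  obtain ⟨C', D', f', hmin', hind'⟩ := hi 7 8 (by simp [IsStep])
  have b1 : ∀ h, IsSite a h →
      HasBit m (settlement m a fun _ => .bare) (σ 1) h (.house h 2) true := fun h hs =>
    (hv 0).hasBit_of_not_isInside (hσ.1 0) (hσ.1 1) hmin hind hs trivial (hne h hs)
  have b7 : ∀ h, IsSite a h →
      HasBit m (settlement m a fun _ => .bare) (σ 7) h (.house h 2) false := fun h hs =>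
    (hv 8).hasBit_of_spike (hσ.1 8) (hσ.1 7) hmin' hind' hs rfl
  obtain ⟨s, s1, s2, s3⟩ := exists_swap ha hm (g := a) le_rfl (by omega) (hσ.1 1) (hσ.1 2)
    (hσ.1 3) (hσ.1 4) (hi 1 2 (by simp [IsStep])) (hi 3 2 (by simp [IsStep]))
    (hi 3 4 (by simp [IsStep]))
  obtain ⟨t, t1, t2, t3⟩ := exists_swap ha hm (g := a + 1) (by omega) le_rfl (hσ.1 4) (hσ.1 5)
    (hσ.1 6) (hσ.1 7) (hi 4 5 (by simp [IsStep])) (hi 6 5 (by simp [IsStep]))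
    (hi 6 7 (by simp [IsStep]))
  have key : ∀ h, IsSite a h → ((true ^^ s h) ^^ t h) = false := fun h hs =>
    (hv 7).hasBit_unique hs (hσ.1 7)
      ((hv 7).isLink_wall hs trivial (k := 2) (by omega) (by omega)).inc_left
      (t3 h _ hs (s3 h _ hs (b1 h hs))) (b7 h hs)
  have site : IsSite a a ∧ IsSite a (a + 1) ∧ IsSite a (a + 2) := by
    unfold IsSite
    omega
  have k0 := key a site.1
  have k1 := key (a + 1) site.2.1
  have k2 := key (a + 2) site.2.2
  -- House `a` is not in the second pair, and house `a + 2` is not in the first.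
  have h0 : t a = false := by
    by_contra h
    have := t1 a (by simpa using h) site.1
    omega
  have h2 : s (a + 2) = false := by
    by_contra h
    have := s1 (a + 2) (by simpa using h) site.2.2
    omega
  rw [h0] at k0
  rw [h2] at k2
  -- All three bits would have to change: `a` in the first pair and `a + 2` in the second, which
  -- leaves no pair in which `a + 1` could change.
  revert s2 t2 k0 k1 k2
  cases s a <;> cases s (a + 1) <;> cases t (a + 1) <;> cases t (a + 2) <;> simp

theorem allocationSet_stageGraph (ha : 1 ≤ a) (hm : a + 2 ≤ m) :
    allocationSet {a, a + 1, a + 2} (stageGraph m a) =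
      orSet {a, a + 1, a + 2} {(a, a + 1, a + 2)} := by
  have mem : ∀ h, h ∈ ({a, a + 1, a + 2} : Finset ℕ) ↔ IsSite a h := by
    intro h
    simp only [Finset.mem_insert, Finset.mem_singleton]
    unfold IsSite
    omega
  have orSet_iff : ∀ g : ℕ → Bool,
      ((fun h => g h : ({a, a + 1, a + 2} : Finset ℕ) → Bool) ∈
        orSet {a, a + 1, a + 2} {(a, a + 1, a + 2)} ↔ (g a || g (a + 1) || g (a + 2)) = true) := by
    intro g
    constructor
    · intro h
      exact h ⟨a, by simp⟩ ⟨a + 1, by simp⟩ ⟨a + 2, by simp⟩ rfl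
    · rintro h ⟨i, _⟩ ⟨j, _⟩ ⟨k, _⟩ hK
      obtain ⟨rfl, rfl, rfl⟩ : i = a ∧ j = a + 1 ∧ k = a + 2 := by simpa using hK
      exact h
  ext f
  -- The embeddings are indexed by bits on all of ℕ, so the allocation is extended by `false`.
  obtain ⟨g, rfl⟩ : ∃ g : ℕ → Bool, f = fun h : ({a, a + 1, a + 2} : Finset ℕ) => g h :=
    ⟨fun h => if hh : h ∈ ({a, a + 1, a + 2} : Finset ℕ) then f ⟨h, hh⟩ else false, by
      ext ⟨h, hh⟩
      simp only [hh, dif_pos]⟩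
  rw [orSet_iff]
  constructor
  · rintro ⟨σ, hσ, hf⟩
    obtain ⟨h, hs, hin⟩ := exists_isInside ha hm hσ
    have hg : g h = true := (hf ⟨h, (mem h).2 hs⟩).2 hin
    have : h = a ∨ h = a + 1 ∨ h = a + 2 := by
      unfold IsSite at hs
      omega
    obtain rfl | rfl | rfl := this <;> simp [hg]
  · intro h
    obtain ⟨σ, hσ, hf⟩ := exists_isSimultaneousEmbedding ha hm h
    exact ⟨σ, hσ, fun i => hf i ((mem i).1 i.2)⟩

end TemporalGraph

/-! ### The result for the i-th block of three houses -/

open TemporalGraph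

theorem mainTheorem11 (m i : ℕ) (hm : 3 ∣ m) (hi : i ∈ Finset.Icc 1 (m / 3)) :
    ∃ G : Fin 9 → Graph Vertex Edge,
      IsIndefiniteSemiHousingSequence {3 * i - 2, 3 * i - 1, 3 * i} m G ∧
      size G ≤ 300 * m ∧
      allocationSet {3 * i - 2, 3 * i - 1, 3 * i} G =
        orSet {3 * i - 2, 3 * i - 1, 3 * i} {(3 * i - 2, 3 * i - 1, 3 * i)} ∧
      arches {3 * i - 2, 3 * i - 1, 3 * i} m G =
        {s(3 * i - 2, 3 * i - 1), s(3 * i - 1, 3 * i)} := by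
  rw [Finset.mem_Icc] at hi
  obtain ⟨a, ha⟩ : ∃ a, a = 3 * i - 2 := ⟨_, rfl⟩
  have h1 : 1 ≤ a := by omega
  have h2 : a + 2 ≤ m := by omega
  rw [← ha, show 3 * i - 1 = a + 1 by omega, show 3 * i = a + 2 by omega]
  exact ⟨stageGraph m a, isIndefiniteSemiHousingSequence_stage h1 h2, size_settlement_le h1 h2,
    allocationSet_stageGraph h1 h2, arches_settlement h1 h2⟩
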